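/- Let $G\rightrightarrows M$ be a Lie groupoid ($G$, $M$ finite-dimensional, Hausdorff, second countable smooth manifolds) with source $\alpha$, target $\beta$, unit map $\epsilon$, inversion $i$, and product $gh$ defined when $\beta(g)=\alpha(h)$; write $l_g$ and $r_g$ for left and right translation. Let $\tau:AG\to M$ be its Lie algebroid: $A_xG=\ker T_{\epsilon(x)}\alpha$, the anchor is $\rho=T\beta|_{AG}$, and the bracket is that of left-invariant vector fields. Let $\tau^*:A^*G\to M$ be the dual bundle. The prolongation $\mathcal P^{\tau^*}(AG)\to A^*G$ is the Lie algebroid whose fibre at $\mu$ is $\{(v,X)\in A_{\tau^*(\mu)}G\times T_\mu A^*G : \rho(v)=T_\mu\tau^*(X)\}$, with anchor $(v,X)\mapsto X$ and with bracket determined by $[(X_0\circ\tau^*,U_0),(X_1\circ\tau^*,U_1)]=([X_0,X_1]\circ\tau^*,[U_0,U_1])$ on projectable sections ($X_j$ a smooth section of $AG$, $U_j$ a smooth vector field on $A^*G$ that projects to $\rho(X_j)$); let $d$ be its differential. The Liouville section is $\Theta(\mu)(v,X)=\mu(v)$ and $\Omega=-d\Theta$. For $f\in C^\infty(A^*G)$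 let $\xi_f$ be the section with $i_{\xi_f}\Omega=df$; the canonical linear Poisson bracket on $A^*G$ is $\{f,g\}=-\Omega(\xi_f,\xi_g)$. Let $L:G\to\mathbb R$ be a smooth function. Its discrete Legendre transformations $\mathbb F^\pm L:G\to A^*G$ are $$\mathbb F^-L(h)(v)=-v(L\circ r_h\circ i)\quad (v\in A_{\alpha(h)}G),\qquad \mathbb F^+L(g)(v)=v(L\circ l_g)\quad (v\in A_{\beta(g)}G).$$ Assume that $\mathbb F^-L$ and $\mathbb F^+L$ are (global) diffeomorphisms from $G$ onto $A^*G$; in particular $L$ is regular. For $g\in G$ put $\mathcal P^\tau_gG=V_g\beta\oplus V_g\alpha$, where $V_g\beta=\ker T_g\beta$ and $V_g\alpha=\ker T_g\alpha$, and let $$\mathcal P^\tau\mathbb F^-L(X,Y)=\big(T_g(i\circ r_{g^{-1}})X,\;T_g\mathbb F^-L(X+Y)\big),\qquad \mathcal P^\tau\mathbb F^+L(X,Y)=\big(T_gl_{g^{-1}}Y,\;T_g\mathbb F^+L(X+Y)\big)$$ for $(X,Y)\in\mathcal P^\tau_gG$, with values in the fibres of $\mathcal P^{\tau^*}(AG)$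 at $\mathbb F^-L(g)$ and $\mathbb F^+L(g)$. The discrete Hamiltonian evolution operator and its prolongation are $$\tilde\xi_L=\mathbb F^+L\circ(\mathbb F^-L)^{-1}:A^*G\to A^*G,\qquad \mathcal P^{\tau^*}\tilde\xi_L=\mathcal P^\tau\mathbb F^+L\circ(\mathcal P^\tau\mathbb F^-L)^{-1}:\mathcal P^{\tau^*}(AG)\to\mathcal P^{\tau^*}(AG).$$ Then $\Omega$ is well defined and nondegenerate, $\mathcal P^\tau\mathbb F^-L$ is a linear isomorphism on each fibre (so the objects above are well defined), and $$(\mathcal P^{\tau^*}\tilde\xi_L,\tilde\xi_L)^*\Theta=\Theta+d\big(L\circ(\mathbb F^-L)^{-1}\big),\qquad (\mathcal P^{\tau^*}\tilde\xi_L,\tilde\xi_L)^*\Omega=\Omega.$$ Moreover $\tilde\xi_L$ is a Poisson morphism for the canonical linear Poisson bracket on $A^*G$: $\{f\circ\tilde\xi_L,\,g\circ\tilde\xi_L\}=\{f,g\}\circ\tilde\xi_L$ for all $f,g\in C^\infty(A^*G)$. -/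

import Mathlib

open Set Bundle Topology Filter VectorField Function
open scoped Manifold ContDiff

universe u v w t

noncomputable section
set_option linter.unusedSectionVars false

/-- A Lie groupoid `G ⇉ M` on finite-dimensional smooth manifolds without boundary, modelled on `EG`
and `EM`. `src`, `tgt`, `unit`, `inv`, `mul` are `α`, `β`, `ε`, `i`, `m`. The multiplication is a
total function whose values matter only on the composable pairs
`G₂ = {(g, h) | β g = α h}`; all laws and its smoothness are required there only. `G₂` is a closed
submanifold of `G × G`, and `ContMDiffOn` on it is smoothness on this submanifold. -/
structure LieGroupoid (EG : Type u) (EM : Type v) (G : Type w) (M : Type t)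
    [NormedAddCommGroup EG] [NormedSpace ℝ EG] [NormedAddCommGroup EM] [NormedSpace ℝ EM]
    [TopologicalSpace G] [ChartedSpace EG G] [TopologicalSpace M] [ChartedSpace EM M] where
  src : G → M
  tgt : G → M
  unit : M → G
  inv : G → G
  mul : G → G → G
  src_mul : ∀ g h, tgt g = src h → src (mul g h) = src g
  tgt_mul : ∀ g h, tgt g = src h → tgt (mul g h) = tgt h
  mul_assoc : ∀ g h k, tgt g = src h → tgt h = src k → mul g (mul h k) = mul (mul g h) k
  src_unit : ∀ x, src (unit x) = x
  tgt_unit : ∀ x, tgt (unit x) = x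
  unit_mul : ∀ g, mul (unit (src g)) g = g
  mul_unit : ∀ g, mul g (unit (tgt g)) = g
  src_inv : ∀ g, src (inv g) = tgt g
  tgt_inv : ∀ g, tgt (inv g) = src g
  inv_mul : ∀ g, mul (inv g) g = unit (tgt g)
  mul_inv : ∀ g, mul g (inv g) = unit (src g)
  contMDiff_src : ContMDiff 𝓘(ℝ, EG) 𝓘(ℝ, EM) ∞ src
  contMDiff_tgt : ContMDiff 𝓘(ℝ, EG) 𝓘(ℝ, EM) ∞ tgt
  contMDiff_unit : ContMDiff 𝓘(ℝ, EM) 𝓘(ℝ, EG) ∞ unit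
  contMDiff_inv : ContMDiff 𝓘(ℝ, EG) 𝓘(ℝ, EG) ∞ inv
  contMDiffOn_mul : ContMDiffOn (𝓘(ℝ, EG).prod 𝓘(ℝ, EG)) 𝓘(ℝ, EG) ∞
    (fun p : G × G => mul p.1 p.2) {p : G × G | tgt p.1 = src p.2}
  submersion_src : ∀ g, Surjective (mfderiv 𝓘(ℝ, EG) 𝓘(ℝ, EM) src g)
  submersion_tgt : ∀ g, Surjective (mfderiv 𝓘(ℝ, EG) 𝓘(ℝ, EM) tgt g)

namespace LieGroupoid

section tangentCone

/-- A vector killed by the surjective derivative of `f` is tangent to the level set of `f`. -/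
theorem mem_tangentConeAt_levelSet {E E' : Type*} [NormedAddCommGroup E] [NormedSpace ℝ E]
    [NormedAddCommGroup E'] [NormedSpace ℝ E'] [CompleteSpace E] [FiniteDimensional ℝ E']
    {f : E → E'} {f' : E →L[ℝ] E'} {a : E} (hf : HasStrictFDerivAt f f' a)
    (hs : Surjective f') {v : E} (hv : f' v = 0) {s : Set E} (hsa : ∀ᶠ y in 𝓝 a, f y = f a → y ∈ s) :
    v ∈ tangentConeAt ℝ s a := by
  have hr : f'.range = ⊤ := LinearMap.range_eq_top.2 hs
  let φ := hf.implicitFunction f f' hr (f a)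
  have hφ : HasStrictFDerivAt φ f'.ker.subtypeL 0 := hf.to_implicitFunction hr
  have h0 : φ 0 = a := hf.implicitFunction_apply_image hr
  have h1 : ∀ᶠ y in 𝓝 (0 : f'.ker), f (φ y) = f a := by
    have := hf.map_implicitFunction_eq hr
    exact ((Continuous.prodMk_right (f a)).tendsto (0 : f'.ker)).eventually this
  have h2 : ∀ᶠ y in 𝓝 (0 : f'.ker), φ y ∈ s := by
    have hc : Tendsto φ (𝓝 0) (𝓝 a) := by
      have := hφ.continuousAt.tendsto
      rwa [h0] at this
    filter_upwards [h1, hc.eventually hsa] with y hy1 hy2 using hy2 hy1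
  have h3 : (⟨v, hv⟩ : f'.ker) ∈ tangentConeAt ℝ {y : f'.ker | φ y ∈ s} 0 := by
    rw [tangentConeAt_of_mem_nhds h2]; trivial
  have h4 := hφ.hasFDerivAt.hasFDerivWithinAt.mapsTo_tangent_cone h3
  rw [h0] at h4
  exact tangentConeAt_mono (by rintro _ ⟨y, hy, rfl⟩; exact hy) h4

/-- The derivative of a map along a fibre of a submersion is uniquely determined on the vectors
that are tangent to the fibre. -/
theorem hasMFDerivWithinAt_unique_levelSet {E E' E'' : Type*} {G M N : Type*}
    [NormedAddCommGroup E] [NormedSpace ℝ E] [NormedAddCommGroup E'] [NormedSpace ℝ E']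
    [NormedAddCommGroup E''] [NormedSpace ℝ E'']
    [CompleteSpace E] [FiniteDimensional ℝ E'] [TopologicalSpace G] [ChartedSpace E G]
    [TopologicalSpace M] [ChartedSpace E' M] [TopologicalSpace N] [ChartedSpace E'' N]
    {f : G → M} {h : G} (hf : ContMDiffAt 𝓘(ℝ, E) 𝓘(ℝ, E') 1 f h)
    (hs : Surjective (mfderiv 𝓘(ℝ, E) 𝓘(ℝ, E') f h))
    {k : G → N} {D D' : TangentSpace 𝓘(ℝ, E) h →L[ℝ] TangentSpace 𝓘(ℝ, E'') (k h)}
    (hD : HasMFDerivWithinAt 𝓘(ℝ, E) 𝓘(ℝ, E'') k {x | f x = f h} h D)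
    (hD' : HasMFDerivWithinAt 𝓘(ℝ, E) 𝓘(ℝ, E'') k {x | f x = f h} h D')
    {v : TangentSpace 𝓘(ℝ, E) h} (hv : mfderiv 𝓘(ℝ, E) 𝓘(ℝ, E') f h v = 0) : D v = D' v := by
  let D₁ : E →L[ℝ] E'' := D
  let D₂ : E →L[ℝ] E'' := D'
  have hD₁ : HasFDerivWithinAt (writtenInExtChartAt 𝓘(ℝ, E) 𝓘(ℝ, E'') h k) D₁
    ((extChartAt 𝓘(ℝ, E) h).symm ⁻¹' {x | f x = f h} ∩ range 𝓘(ℝ, E)) (extChartAt 𝓘(ℝ, E) h h) := hD.2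
  have hD₂ : HasFDerivWithinAt (writtenInExtChartAt 𝓘(ℝ, E) 𝓘(ℝ, E'') h k) D₂
    ((extChartAt 𝓘(ℝ, E) h).symm ⁻¹' {x | f x = f h} ∩ range 𝓘(ℝ, E)) (extChartAt 𝓘(ℝ, E) h h) := hD'.2
  have key : v ∈ tangentConeAt ℝ ((extChartAt 𝓘(ℝ, E) h).symm ⁻¹' {x | f x = f h} ∩
      range 𝓘(ℝ, E)) (extChartAt 𝓘(ℝ, E) h h) → D v = D' v := fun hv' =>
    HasFDerivWithinAt.unique_on hD₁ hD₂ hv'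
  refine key ?_
  have hc : ContDiffAt ℝ 1 (writtenInExtChartAt 𝓘(ℝ, E) 𝓘(ℝ, E') h f)
      (extChartAt 𝓘(ℝ, E) h h) := by
    have := (contMDiffAt_iff.1 hf).2
    simpa [contDiffWithinAt_univ, writtenInExtChartAt] using this
  have hm : mfderiv 𝓘(ℝ, E) 𝓘(ℝ, E') f h =
      fderiv ℝ (writtenInExtChartAt 𝓘(ℝ, E) 𝓘(ℝ, E') h f) (extChartAt 𝓘(ℝ, E) h h) := by
    rw [(hf.mdifferentiableAt one_ne_zero).mfderiv]
    simp [fderivWithin_univ]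
    rfl
  have hst := hc.hasStrictFDerivAt one_ne_zero
  rw [hm] at hs hv
  refine mem_tangentConeAt_levelSet hst hs hv ?_
  have hcont : ContinuousAt (fun y => f ((extChartAt 𝓘(ℝ, E) h).symm y)) (extChartAt 𝓘(ℝ, E) h h) := by
    have h1 : ContinuousAt (extChartAt 𝓘(ℝ, E) h).symm (extChartAt 𝓘(ℝ, E) h h) :=
      continuousAt_extChartAt_symm h
    refine ContinuousAt.comp (g := f) ?_ h1
    simpa using hf.continuousAt
  have hsrc : ∀ᶠ y in 𝓝 (extChartAt 𝓘(ℝ, E) h h),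
      f ((extChartAt 𝓘(ℝ, E) h).symm y) ∈ (extChartAt 𝓘(ℝ, E') (f h)).source := by
    refine hcont.eventually_mem ?_
    simpa using extChartAt_source_mem_nhds (I := 𝓘(ℝ, E')) (f h)
  filter_upwards [hsrc] with y hy hyy
  simp only [writtenInExtChartAt, comp_apply, extChartAt_to_inv] at hyy
  have := (extChartAt 𝓘(ℝ, E') (f h)).injOn hy (mem_extChartAt_source (f h)) hyy
  simpa using this

end tangentCone

section Algebroid

variable {EG : Type u} {EM : Type v} {G : Type w} {M : Type t}
  [NormedAddCommGroup EG] [NormedSpace ℝ EG] [NormedAddCommGroup EM] [NormedSpace ℝ EM]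
  [TopologicalSpace G] [ChartedSpace EG G] [TopologicalSpace M] [ChartedSpace EM M]
  (𝒢 : LieGroupoid EG EM G M)

/-- The vertical space `V_g α = ker T_g α`. -/
def vertSrc (g : G) : Submodule ℝ (TangentSpace 𝓘(ℝ, EG) g) :=
  (mfderiv 𝓘(ℝ, EG) 𝓘(ℝ, EM) 𝒢.src g).ker

/-- The vertical space `V_g β = ker T_g β`. -/
def vertTgt (g : G) : Submodule ℝ (TangentSpace 𝓘(ℝ, EG) g) :=
  (mfderiv 𝓘(ℝ, EG) 𝓘(ℝ, EM) 𝒢.tgt g).ker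

/-- The fibre `A_x G = V_{ε x} α` of the Lie algebroid `τ : AG → M`. -/
def A (x : M) : Type u := 𝒢.vertSrc (𝒢.unit x)

instance (x : M) : AddCommGroup (𝒢.A x) := inferInstanceAs (AddCommGroup (𝒢.vertSrc (𝒢.unit x)))
instance (x : M) : Module ℝ (𝒢.A x) := inferInstanceAs (Module ℝ (𝒢.vertSrc (𝒢.unit x)))
instance (x : M) : TopologicalSpace (𝒢.A x) :=
  inferInstanceAs (TopologicalSpace (𝒢.vertSrc (𝒢.unit x)))
instance (x : M) : IsTopologicalAddGroup (𝒢.A x) :=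
  inferInstanceAs (IsTopologicalAddGroup (𝒢.vertSrc (𝒢.unit x)))
instance (x : M) : ContinuousSMul ℝ (𝒢.A x) :=
  inferInstanceAs (ContinuousSMul ℝ (𝒢.vertSrc (𝒢.unit x)))

/-- The inclusion `A_x G ⊆ T_{ε x} G`. -/
def incl (x : M) : 𝒢.A x →L[ℝ] TangentSpace 𝓘(ℝ, EG) (𝒢.unit x) :=
  (𝒢.vertSrc (𝒢.unit x)).subtypeL

theorem incl_injective (x : M) : Injective (𝒢.incl x) := Subtype.val_injective

theorem mfderiv_src_incl (x : M) (v : 𝒢.A x) :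
    mfderiv 𝓘(ℝ, EG) 𝓘(ℝ, EM) 𝒢.src (𝒢.unit x) (𝒢.incl x v) = 0 := v.2

/-- The derivative of `ε ∘ α` at its fixed point `ε x`. -/
def dUnitSrc (x : M) : TangentSpace 𝓘(ℝ, EG) (𝒢.unit x) →L[ℝ] TangentSpace 𝓘(ℝ, EG) (𝒢.unit x) :=
  mfderiv 𝓘(ℝ, EG) 𝓘(ℝ, EG) (fun g => 𝒢.unit (𝒢.src g)) (𝒢.unit x)

theorem mfderiv_src_dUnitSrc (x : M) (v : TangentSpace 𝓘(ℝ, EG) (𝒢.unit x)) :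
    mfderiv 𝓘(ℝ, EG) 𝓘(ℝ, EM) 𝒢.src (𝒢.unit x) (𝒢.dUnitSrc x v) =
      mfderiv 𝓘(ℝ, EG) 𝓘(ℝ, EM) 𝒢.src (𝒢.unit x) v := by
  have h0 : (fun g => 𝒢.unit (𝒢.src g)) (𝒢.unit x) = 𝒢.unit x := by simp [𝒢.src_unit]
  have hs := 𝒢.contMDiff_src.mdifferentiable (by simp)
  have hu := 𝒢.contMDiff_unit.mdifferentiable (by simp)
  have h1 := mfderiv_comp_of_eq (I := 𝓘(ℝ, EG)) (I' := 𝓘(ℝ, EG)) (I'' := 𝓘(ℝ, EM)) (x := 𝒢.unit x) (g := 𝒢.src)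
    (f := fun g => 𝒢.unit (𝒢.src g)) (hs (𝒢.unit x)) ((hu _).comp (𝒢.unit x) (hs _)) h0
  have h2 : 𝒢.src ∘ (fun g => 𝒢.unit (𝒢.src g)) = 𝒢.src := by
    funext g; simp [𝒢.src_unit]
  have h3 : ∀ y, y = 𝒢.unit x → ∀ w : EG, (mfderiv 𝓘(ℝ, EG) 𝓘(ℝ, EM) 𝒢.src y : EG → EM) w =
      (mfderiv 𝓘(ℝ, EG) 𝓘(ℝ, EM) 𝒢.src (𝒢.unit x) : EG → EM) w := by
    rintro y rfl w; rfl
  rw [h2] at h1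
  exact (h3 _ h0 _).symm.trans (DFunLike.congr_fun h1 v).symm

/-- The projection `v ↦ v - T(ε ∘ α) v` of `T_{ε x} G` onto `A_x G` along the units. It is the
identity on vertical vectors (`incl_vertProj_of_mem`). -/
def vertProj (x : M) : TangentSpace 𝓘(ℝ, EG) (𝒢.unit x) →L[ℝ] 𝒢.A x :=
  (ContinuousLinearMap.id ℝ (TangentSpace 𝓘(ℝ, EG) (𝒢.unit x)) - 𝒢.dUnitSrc x).codRestrict
    (𝒢.vertSrc (𝒢.unit x)) fun v => by
      change mfderiv 𝓘(ℝ, EG) 𝓘(ℝ, EM) 𝒢.src (𝒢.unit x) (v - 𝒢.dUnitSrc x v) = 0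
      rw [map_sub, mfderiv_src_dUnitSrc, sub_self]

theorem dUnitSrc_eq_zero {x : M} {v : TangentSpace 𝓘(ℝ, EG) (𝒢.unit x)}
    (hv : mfderiv 𝓘(ℝ, EG) 𝓘(ℝ, EM) 𝒢.src (𝒢.unit x) v = 0) : 𝒢.dUnitSrc x v = 0 := by
  have hs := 𝒢.contMDiff_src.mdifferentiable (by simp)
  have hu := 𝒢.contMDiff_unit.mdifferentiable (by simp)
  have h1 := mfderiv_comp (I := 𝓘(ℝ, EG)) (I' := 𝓘(ℝ, EM)) (I'' := 𝓘(ℝ, EG)) (g := 𝒢.unit)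
    (f := 𝒢.src) (𝒢.unit x) (hu _) (hs _)
  have h2 := DFunLike.congr_fun h1 v
  refine h2.trans ?_
  rw [ContinuousLinearMap.comp_apply, hv, map_zero]
  rfl

theorem incl_vertProj_of_mem {x : M} {v : TangentSpace 𝓘(ℝ, EG) (𝒢.unit x)}
    (hv : mfderiv 𝓘(ℝ, EG) 𝓘(ℝ, EM) 𝒢.src (𝒢.unit x) v = 0) :
    𝒢.incl x (𝒢.vertProj x v) = v := by
  change v - 𝒢.dUnitSrc x v = v
  rw [𝒢.dUnitSrc_eq_zero hv, sub_zero]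


variable [FiniteDimensional ℝ EG] [FiniteDimensional ℝ EM]
  [IsManifold 𝓘(ℝ, EG) ∞ G] [IsManifold 𝓘(ℝ, EM) ∞ M]

/-- The model fibre of `AG`, of dimension `dim G - dim M`. -/
abbrev AModel (EG : Type u) (EM : Type v) [NormedAddCommGroup EG] [NormedSpace ℝ EG]
    [NormedAddCommGroup EM] [NormedSpace ℝ EM] : Type :=
  EuclideanSpace ℝ (Fin (Module.finrank ℝ EG - Module.finrank ℝ EM))

/-- The preferred local trivialisation of `TG` around `ε x₀`. -/
def tanTriv (x₀ : M) : Trivialization EG (π EG (TangentSpace 𝓘(ℝ, EG) : G → Type _)) :=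
  trivializationAt EG (TangentSpace 𝓘(ℝ, EG)) (𝒢.unit x₀)

instance (x₀ : M) : MemTrivializationAtlas (𝒢.tanTriv x₀) := by
  unfold tanTriv; infer_instance

instance (x₀ : M) : (𝒢.tanTriv x₀).IsLinear ℝ := by
  unfold tanTriv; infer_instance

/-- The Jacobian matrix of `α` at `ε x`, in the preferred charts around `ε x₀` and `x₀`. -/
def srcJac (x₀ x : M) : EG →L[ℝ] EM :=
  fderiv ℝ (fun y => extChartAt 𝓘(ℝ, EM) x₀ (𝒢.src ((extChartAt 𝓘(ℝ, EG) (𝒢.unit x₀)).symm y)))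
    (extChartAt 𝓘(ℝ, EG) (𝒢.unit x₀) (𝒢.unit x))

/-- The points `x` for which `ε x` and `x` lie in these charts. -/
def frameDom₀ (x₀ : M) : Set M :=
  𝒢.unit ⁻¹' (chartAt EG (𝒢.unit x₀)).source ∩ (chartAt EM x₀).source

theorem isOpen_frameDom₀ (x₀ : M) : IsOpen (𝒢.frameDom₀ x₀) :=
  ((chartAt EG (𝒢.unit x₀)).open_source.preimage 𝒢.contMDiff_unit.continuous).inter
    (chartAt EM x₀).open_source

theorem mem_frameDom₀ (x₀ : M) : x₀ ∈ 𝒢.frameDom₀ x₀ :=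
  ⟨mem_chart_source EG (𝒢.unit x₀), mem_chart_source EM x₀⟩

theorem contDiffAt_srcLoc {x₀ x : M} (hx : x ∈ 𝒢.frameDom₀ x₀) :
    ContDiffAt ℝ ∞
      (fun y => extChartAt 𝓘(ℝ, EM) x₀ (𝒢.src ((extChartAt 𝓘(ℝ, EG) (𝒢.unit x₀)).symm y)))
      (extChartAt 𝓘(ℝ, EG) (𝒢.unit x₀) (𝒢.unit x)) := by
  rw [← contMDiffAt_iff_contDiffAt]
  have hx1 : 𝒢.unit x ∈ (extChartAt 𝓘(ℝ, EG) (𝒢.unit x₀)).source := by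
    rw [extChartAt_source]; exact hx.1
  have hinv := (extChartAt 𝓘(ℝ, EG) (𝒢.unit x₀)).left_inv hx1
  have h1 : ContMDiffAt 𝓘(ℝ, EG) 𝓘(ℝ, EG) ∞ (extChartAt 𝓘(ℝ, EG) (𝒢.unit x₀)).symm
      (extChartAt 𝓘(ℝ, EG) (𝒢.unit x₀) (𝒢.unit x)) :=
    (contMDiffOn_extChartAt_symm (𝒢.unit x₀)).contMDiffAt
      (extChartAt_target_mem_nhds' ((extChartAt 𝓘(ℝ, EG) (𝒢.unit x₀)).map_source hx1))
  have h2 : ContMDiffAt 𝓘(ℝ, EM) 𝓘(ℝ, EM) ∞ (extChartAt 𝓘(ℝ, EM) x₀)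
      (𝒢.src ((extChartAt 𝓘(ℝ, EG) (𝒢.unit x₀)).symm
        (extChartAt 𝓘(ℝ, EG) (𝒢.unit x₀) (𝒢.unit x)))) := by
    rw [hinv, 𝒢.src_unit]
    exact contMDiffAt_extChartAt' hx.2
  have h3 := ContMDiffAt.comp (g := 𝒢.src) (f := (extChartAt 𝓘(ℝ, EG) (𝒢.unit x₀)).symm) _
    (𝒢.contMDiff_src _) h1
  exact ContMDiffAt.comp (g := extChartAt 𝓘(ℝ, EM) x₀)
    (f := fun y => 𝒢.src ((extChartAt 𝓘(ℝ, EG) (𝒢.unit x₀)).symm y)) _ h2 h3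

theorem contMDiffOn_srcJac (x₀ : M) :
    ContMDiffOn 𝓘(ℝ, EM) 𝓘(ℝ, EG →L[ℝ] EM) ∞ (𝒢.srcJac x₀) (𝒢.frameDom₀ x₀) := by
  intro x hx
  refine ContMDiffAt.contMDiffWithinAt ?_
  have h1 := (𝒢.contDiffAt_srcLoc hx).fderiv_right (m := ∞) (by simp)
  have h2 : ContMDiffAt 𝓘(ℝ, EM) 𝓘(ℝ, EG) ∞
      (fun x => extChartAt 𝓘(ℝ, EG) (𝒢.unit x₀) (𝒢.unit x)) x :=
    (contMDiffAt_extChartAt' hx.1).comp x (𝒢.contMDiff_unit x)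
  exact h1.contMDiffAt.comp x h2

theorem srcJac_tanTriv {x₀ x : M} (hx : x ∈ 𝒢.frameDom₀ x₀)
    (v : TangentSpace 𝓘(ℝ, EG) (𝒢.unit x)) :
    𝒢.srcJac x₀ x ((𝒢.tanTriv x₀).continuousLinearMapAt ℝ (𝒢.unit x) v) =
      mfderiv 𝓘(ℝ, EM) 𝓘(ℝ, EM) (extChartAt 𝓘(ℝ, EM) x₀) (𝒢.src (𝒢.unit x))
        (mfderiv 𝓘(ℝ, EG) 𝓘(ℝ, EM) 𝒢.src (𝒢.unit x) v) := by
  have hx1 : 𝒢.unit x ∈ (extChartAt 𝓘(ℝ, EG) (𝒢.unit x₀)).source := by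
    rw [extChartAt_source]; exact hx.1
  have hx2 : 𝒢.src (𝒢.unit x) ∈ (chartAt EM x₀).source := by rw [𝒢.src_unit]; exact hx.2
  have e1 : (𝒢.tanTriv x₀).continuousLinearMapAt ℝ (𝒢.unit x) =
      mfderiv 𝓘(ℝ, EG) 𝓘(ℝ, EG) (extChartAt 𝓘(ℝ, EG) (𝒢.unit x₀)) (𝒢.unit x) :=
    TangentBundle.continuousLinearMapAt_trivializationAt hx.1
  rw [e1]
  have hψ := mdifferentiableAt_extChartAt (I := 𝓘(ℝ, EM)) hx2
  have hφ := mdifferentiableAt_extChartAt (I := 𝓘(ℝ, EG)) hx.1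
  have hs := 𝒢.contMDiff_src.mdifferentiable (by simp) (𝒢.unit x)
  have c1 := mfderiv_comp (𝒢.unit x) hψ hs
  have hl := (𝒢.contDiffAt_srcLoc hx).differentiableAt (by simp)
  have c2 := mfderiv_comp (𝒢.unit x) hl.mdifferentiableAt hφ
  have e2 : (fun y => extChartAt 𝓘(ℝ, EM) x₀ (𝒢.src ((extChartAt 𝓘(ℝ, EG) (𝒢.unit x₀)).symm y))) ∘
      (extChartAt 𝓘(ℝ, EG) (𝒢.unit x₀)) =ᶠ[𝓝 (𝒢.unit x)] (extChartAt 𝓘(ℝ, EM) x₀) ∘ 𝒢.src := by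
    filter_upwards [extChartAt_source_mem_nhds' hx1] with y hy
    simp only [comp_apply, (extChartAt 𝓘(ℝ, EG) (𝒢.unit x₀)).left_inv hy]
  have e3 := e2.mfderiv_eq (I := 𝓘(ℝ, EG)) (I' := 𝓘(ℝ, EM))
  have a1 := DFunLike.congr_fun c1 v
  have a2 := DFunLike.congr_fun c2 v
  have a3 : (mfderiv 𝓘(ℝ, EG) 𝓘(ℝ, EM) _ (𝒢.unit x) : EG → EM) v = _ := congrArg (fun D : EG →L[ℝ] EM => D v) e3
  rw [mfderiv_eq_fderiv] at a2
  exact a2.symm.trans (a3.trans a1)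

theorem vertical_iff_srcJac {x₀ x : M} (hx : x ∈ 𝒢.frameDom₀ x₀)
    (v : TangentSpace 𝓘(ℝ, EG) (𝒢.unit x)) :
    mfderiv 𝓘(ℝ, EG) 𝓘(ℝ, EM) 𝒢.src (𝒢.unit x) v = 0 ↔
    𝒢.srcJac x₀ x ((𝒢.tanTriv x₀).continuousLinearMapAt ℝ (𝒢.unit x) v) = 0 := by
  rw [srcJac_tanTriv _ hx]
  have hx2 : 𝒢.src (𝒢.unit x) ∈ (extChartAt 𝓘(ℝ, EM) x₀).source := by
    rw [𝒢.src_unit, extChartAt_source]; exact hx.2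
  have hi := isInvertible_mfderiv_extChartAt hx2
  constructor
  · intro h; rw [h, map_zero]; rfl
  · intro h; exact hi.injective (h.trans (map_zero _).symm)

theorem mem_tanTriv_baseSet {x₀ x : M} (hx : x ∈ 𝒢.frameDom₀ x₀) :
    𝒢.unit x ∈ (𝒢.tanTriv x₀).baseSet := hx.1

theorem srcJac_surjective {x₀ x : M} (hx : x ∈ 𝒢.frameDom₀ x₀) : Surjective (𝒢.srcJac x₀ x) := by
  have hx2 : 𝒢.src (𝒢.unit x) ∈ (extChartAt 𝓘(ℝ, EM) x₀).source := by
    rw [𝒢.src_unit, extChartAt_source]; exact hx.2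
  have hi := isInvertible_mfderiv_extChartAt hx2
  intro w
  obtain ⟨u, hu⟩ := hi.surjective w
  obtain ⟨v, hv⟩ := 𝒢.submersion_src (𝒢.unit x) u
  exact ⟨_, (𝒢.srcJac_tanTriv hx v).trans (by rw [hv, hu])⟩

theorem exists_complement {A : EG →L[ℝ] EM} (hA : Surjective A) :
    ∃ K : EG →L[ℝ] AModel EG EM, (A.prod K).IsInvertible := by
  have hk : Module.finrank ℝ A.ker = Module.finrank ℝ (AModel EG EM) := by
    have h1 := LinearMap.finrank_range_add_finrank_ker (A : EG →ₗ[ℝ] EM)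
    have h2 : Module.finrank ℝ (LinearMap.range (A : EG →ₗ[ℝ] EM)) = Module.finrank ℝ EM := by
      rw [LinearMap.range_eq_top.2 hA, finrank_top]
    rw [finrank_euclideanSpace, Fintype.card_fin]
    change Module.finrank ℝ (LinearMap.ker (A : EG →ₗ[ℝ] EM)) = _
    omega
  let e : A.ker ≃ₗ[ℝ] AModel EG EM := LinearEquiv.ofFinrankEq _ _ hk
  obtain ⟨p, hp⟩ := Submodule.ClosedComplemented.of_finiteDimensional A.ker
  let K : EG →L[ℝ] AModel EG EM := (LinearMap.toContinuousLinearMap (e : A.ker →ₗ[ℝ] AModel EG EM)) ∘L p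
  refine ⟨K, ?_⟩
  have hinj : Injective (A.prod K) := by
    rw [injective_iff_map_eq_zero]
    intro v hv
    have hv1 : A v = 0 := congrArg Prod.fst hv
    have hv2 : e (p v) = 0 := congrArg Prod.snd hv
    have hv3 : p v = 0 := by simpa using hv2
    have hv4 := hp ⟨v, hv1⟩
    rw [hv3] at hv4
    exact (congrArg Subtype.val hv4).symm
  have hfr : Module.finrank ℝ EG = Module.finrank ℝ (EM × AModel EG EM) := by
    have h1 := LinearMap.finrank_range_add_finrank_ker (A : EG →ₗ[ℝ] EM)
    have h2 : Module.finrank ℝ (LinearMap.range (A : EG →ₗ[ℝ] EM)) = Module.finrank ℝ EM := by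
      rw [LinearMap.range_eq_top.2 hA, finrank_top]
    rw [Module.finrank_prod, finrank_euclideanSpace, Fintype.card_fin]
    omega
  let E := LinearEquiv.ofInjectiveOfFinrankEq ((A.prod K : EG →L[ℝ] EM × AModel EG EM) : EG →ₗ[ℝ] EM × AModel EG EM) hinj hfr
  exact ⟨E.toContinuousLinearEquiv, by ext v <;> rfl⟩

/-- A linear map that complements the Jacobian of `α` at `ε x₀` to an isomorphism. -/
def frameCompl (x₀ : M) : EG →L[ℝ] AModel EG EM :=
  (exists_complement (𝒢.srcJac_surjective (𝒢.mem_frameDom₀ x₀))).choose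

/-- The Jacobian of `α` at `ε x`, complemented by the fixed map `frameCompl x₀`. -/
def frame (x₀ x : M) : EG →L[ℝ] EM × AModel EG EM := (𝒢.srcJac x₀ x).prod (𝒢.frameCompl x₀)

/-- The open neighbourhood of `x₀` over which `AG` is trivialised by `frameCompl x₀`. -/
def frameDom (x₀ : M) : Set M := {x ∈ 𝒢.frameDom₀ x₀ | (𝒢.frame x₀ x).IsInvertible}

theorem mem_frameDom (x₀ : M) : x₀ ∈ 𝒢.frameDom x₀ :=
  ⟨𝒢.mem_frameDom₀ x₀, (exists_complement (𝒢.srcJac_surjective (𝒢.mem_frameDom₀ x₀))).choose_spec⟩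

theorem contMDiffOn_frame (x₀ : M) :
    ContMDiffOn 𝓘(ℝ, EM) 𝓘(ℝ, EG →L[ℝ] EM × AModel EG EM) ∞ (𝒢.frame x₀) (𝒢.frameDom₀ x₀) := by
  have h := (ContinuousLinearMap.compL ℝ EG EM (EM × AModel EG EM)
    (ContinuousLinearMap.inl ℝ EM (AModel EG EM))).contDiff (n := ∞)
  have h2 : ContDiff ℝ ∞ fun B : EG →L[ℝ] EM => B.prod (𝒢.frameCompl x₀) := by
    have : (fun B : EG →L[ℝ] EM => B.prod (𝒢.frameCompl x₀)) = fun B =>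
        (ContinuousLinearMap.compL ℝ EG EM (EM × AModel EG EM)
          (ContinuousLinearMap.inl ℝ EM (AModel EG EM))) B +
        (ContinuousLinearMap.inr ℝ EM (AModel EG EM)) ∘L (𝒢.frameCompl x₀) := by
      funext B; ext v <;> simp
    rw [this]
    exact h.add contDiff_const
  exact h2.contMDiff.comp_contMDiffOn (𝒢.contMDiffOn_srcJac x₀)

theorem isOpen_frameDom (x₀ : M) : IsOpen (𝒢.frameDom x₀) := by
  have := (𝒢.contMDiffOn_frame x₀).continuousOn.isOpen_inter_preimage (𝒢.isOpen_frameDom₀ x₀)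
    (ContinuousLinearEquiv.isOpen (𝕜 := ℝ) (E := EG) (F := EM × AModel EG EM))
  exact this

theorem contMDiffOn_frame_inverse (x₀ : M) :
    ContMDiffOn 𝓘(ℝ, EM) 𝓘(ℝ, EM × AModel EG EM →L[ℝ] EG) ∞
      (fun x => (𝒢.frame x₀ x).inverse) (𝒢.frameDom x₀) := by
  intro x hx
  have h1 := (hx.2.contDiffAt_map_inverse (n := ∞)).contMDiffAt
  exact h1.comp_contMDiffWithinAt x ((𝒢.contMDiffOn_frame x₀ x hx.1).mono fun y hy => hy.1)

/-- The fibre coordinates on `A_x G` given by `frameCompl x₀`. -/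
def toCoord (x₀ x : M) : 𝒢.A x →L[ℝ] AModel EG EM :=
  𝒢.frameCompl x₀ ∘L (𝒢.tanTriv x₀).continuousLinearMapAt ℝ (𝒢.unit x) ∘L 𝒢.incl x

/-- The inverse of `toCoord` for `x ∈ frameDom x₀`. -/
def ofCoord (x₀ x : M) : AModel EG EM →L[ℝ] 𝒢.A x :=
  𝒢.vertProj x ∘L (𝒢.tanTriv x₀).symmL ℝ (𝒢.unit x) ∘L (𝒢.frame x₀ x).inverse ∘L
    ContinuousLinearMap.inr ℝ EM (AModel EG EM)

theorem incl_ofCoord {x₀ x : M} (hx : x ∈ 𝒢.frameDom x₀) (w : AModel EG EM) :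
    𝒢.incl x (𝒢.ofCoord x₀ x w) =
      (𝒢.tanTriv x₀).symmL ℝ (𝒢.unit x) ((𝒢.frame x₀ x).inverse (0, w)) := by
  refine 𝒢.incl_vertProj_of_mem ?_
  rw [𝒢.vertical_iff_srcJac hx.1]
  change 𝒢.srcJac x₀ x ((𝒢.tanTriv x₀).continuousLinearMapAt ℝ (𝒢.unit x)
    ((𝒢.tanTriv x₀).symmL ℝ (𝒢.unit x) ((𝒢.frame x₀ x).inverse (0, w)))) = 0
  rw [Trivialization.continuousLinearMapAt_symmL _ (𝒢.mem_tanTriv_baseSet hx.1)]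
  exact congrArg Prod.fst (hx.2.self_apply_inverse (0, w))

theorem toCoord_ofCoord {x₀ x : M} (hx : x ∈ 𝒢.frameDom x₀) (w : AModel EG EM) :
    𝒢.toCoord x₀ x (𝒢.ofCoord x₀ x w) = w := by
  change 𝒢.frameCompl x₀ ((𝒢.tanTriv x₀).continuousLinearMapAt ℝ (𝒢.unit x)
    (𝒢.incl x (𝒢.ofCoord x₀ x w))) = w
  rw [𝒢.incl_ofCoord hx, Trivialization.continuousLinearMapAt_symmL _ (𝒢.mem_tanTriv_baseSet hx.1)]
  exact congrArg Prod.snd (hx.2.self_apply_inverse (0, w))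

theorem ofCoord_toCoord {x₀ x : M} (hx : x ∈ 𝒢.frameDom x₀) (v : 𝒢.A x) :
    𝒢.ofCoord x₀ x (𝒢.toCoord x₀ x v) = v := by
  apply 𝒢.incl_injective x
  rw [𝒢.incl_ofCoord hx]
  have h1 : ((0 : EM), 𝒢.toCoord x₀ x v) = 𝒢.frame x₀ x
      ((𝒢.tanTriv x₀).continuousLinearMapAt ℝ (𝒢.unit x) (𝒢.incl x v)) := by
    refine Prod.ext ?_ rfl
    exact ((𝒢.vertical_iff_srcJac hx.1 _).1 (𝒢.mfderiv_src_incl x v)).symm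
  rw [h1, hx.2.inverse_apply_self,
    Trivialization.symmL_continuousLinearMapAt _ (𝒢.mem_tanTriv_baseSet hx.1)]

/-- The local trivialisation of `AG` around `x₀`. -/
def pretriv (x₀ : M) : Pretrivialization (AModel EG EM) (π (AModel EG EM) 𝒢.A) where
  toFun p := (p.1, 𝒢.toCoord x₀ p.1 p.2)
  invFun q := ⟨q.1, 𝒢.ofCoord x₀ q.1 q.2⟩
  source := π (AModel EG EM) 𝒢.A ⁻¹' 𝒢.frameDom x₀
  target := 𝒢.frameDom x₀ ×ˢ univ
  map_source' _ hp := ⟨hp, trivial⟩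
  map_target' _ hq := hq.1
  left_inv' := by
    rintro ⟨x, v⟩ hp
    exact congrArg (TotalSpace.mk x) (𝒢.ofCoord_toCoord hp v)
  right_inv' := by
    rintro ⟨x, w⟩ hq
    exact Prod.ext rfl (𝒢.toCoord_ofCoord hq.1 w)
  open_target := (𝒢.isOpen_frameDom x₀).prod isOpen_univ
  baseSet := 𝒢.frameDom x₀
  open_baseSet := 𝒢.isOpen_frameDom x₀
  source_eq := rfl
  target_eq := rfl
  proj_toFun _ _ := rfl

/-- The coordinate changes between these trivialisations. -/
def frameChange (x₀ x₁ x : M) : AModel EG EM →L[ℝ] AModel EG EM :=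
  𝒢.frameCompl x₁ ∘L ((𝒢.tanTriv x₀).coordChangeL ℝ (𝒢.tanTriv x₁) (𝒢.unit x) : EG →L[ℝ] EG) ∘L
    (𝒢.frame x₀ x).inverse ∘L ContinuousLinearMap.inr ℝ EM (AModel EG EM)

theorem contMDiffOn_frameChange (x₀ x₁ : M) :
    ContMDiffOn 𝓘(ℝ, EM) 𝓘(ℝ, AModel EG EM →L[ℝ] AModel EG EM) ∞ (𝒢.frameChange x₀ x₁)
      (𝒢.frameDom x₀ ∩ 𝒢.frameDom x₁) := by
  have h1 : ContMDiffOn 𝓘(ℝ, EM) 𝓘(ℝ, EG →L[ℝ] EG) ∞ (fun x =>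
      ((𝒢.tanTriv x₀).coordChangeL ℝ (𝒢.tanTriv x₁) (𝒢.unit x) : EG →L[ℝ] EG))
      (𝒢.frameDom x₀ ∩ 𝒢.frameDom x₁) :=
    (contMDiffOn_coordChangeL (IB := 𝓘(ℝ, EG)) (n := ∞) (𝒢.tanTriv x₀) (𝒢.tanTriv x₁)).comp
      𝒢.contMDiff_unit.contMDiffOn fun x hx =>
        ⟨𝒢.mem_tanTriv_baseSet hx.1.1, 𝒢.mem_tanTriv_baseSet hx.2.1⟩
  have h2 := (𝒢.contMDiffOn_frame_inverse x₀).mono (inter_subset_left (t := 𝒢.frameDom x₁))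
  exact contMDiffOn_const.clm_comp (h1.clm_comp (h2.clm_comp contMDiffOn_const))

theorem frameChange_apply {x₀ x₁ x : M} (hx : x ∈ 𝒢.frameDom x₀ ∩ 𝒢.frameDom x₁)
    (w : AModel EG EM) :
    𝒢.frameChange x₀ x₁ x w = 𝒢.toCoord x₁ x (𝒢.ofCoord x₀ x w) := by
  change 𝒢.frameCompl x₁ ((𝒢.tanTriv x₀).coordChangeL ℝ (𝒢.tanTriv x₁) (𝒢.unit x)
    ((𝒢.frame x₀ x).inverse (0, w))) = 𝒢.frameCompl x₁
      ((𝒢.tanTriv x₁).continuousLinearMapAt ℝ (𝒢.unit x) (𝒢.incl x (𝒢.ofCoord x₀ x w)))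
  rw [𝒢.incl_ofCoord hx.1, Trivialization.coordChangeL_apply _ _
    ⟨𝒢.mem_tanTriv_baseSet hx.1.1, 𝒢.mem_tanTriv_baseSet hx.2.1⟩]
  congr 1
  rw [Trivialization.continuousLinearMapAt_apply, Trivialization.linearMapAt_apply,
    if_pos (𝒢.mem_tanTriv_baseSet hx.2.1), Trivialization.symmL_apply]
  exact 𝒢.mem_tanTriv_baseSet hx.1.1

theorem pretriv_symm {x₀ x : M} (hx : x ∈ 𝒢.frameDom x₀) (w : AModel EG EM) :
    (𝒢.pretriv x₀).symm x w = 𝒢.ofCoord x₀ x w := by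
  rw [Pretrivialization.symm_apply _ hx]
  rfl

/-- The smooth vector bundle structure of `τ : AG → M`, as a subbundle of the restriction of `TG`
to the units. -/
def prebundle : VectorPrebundle ℝ (AModel EG EM) 𝒢.A where
  pretrivializationAtlas := range 𝒢.pretriv
  pretrivialization_linear' := by
    rintro _ ⟨x₀, rfl⟩
    exact ⟨fun x _ => (𝒢.toCoord x₀ x).toLinearMap.isLinear⟩
  pretrivializationAt := 𝒢.pretriv
  mem_base_pretrivializationAt := 𝒢.mem_frameDom
  pretrivialization_mem_atlas := mem_range_self
  exists_coordChange := by
    rintro _ ⟨x₀, rfl⟩ _ ⟨x₁, rfl⟩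
    refine ⟨𝒢.frameChange x₀ x₁, (𝒢.contMDiffOn_frameChange x₀ x₁).continuousOn, ?_⟩
    intro x hx w
    rw [𝒢.pretriv_symm hx.1]
    exact 𝒢.frameChange_apply hx w
  totalSpaceMk_isInducing x := by
    have h1 : IsInducing (𝒢.toCoord x x) :=
      (Homeomorph.mk ⟨𝒢.toCoord x x, 𝒢.ofCoord x x, 𝒢.ofCoord_toCoord (𝒢.mem_frameDom x),
        𝒢.toCoord_ofCoord (𝒢.mem_frameDom x)⟩ (𝒢.toCoord x x).continuous
        (𝒢.ofCoord x x).continuous).isInducing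
    exact (isInducing_const_prod (x := x)).2 h1

instance : 𝒢.prebundle.IsContMDiff 𝓘(ℝ, EM) ∞ where
  exists_contMDiffCoordChange := by
    rintro _ ⟨x₀, rfl⟩ _ ⟨x₁, rfl⟩
    refine ⟨𝒢.frameChange x₀ x₁, 𝒢.contMDiffOn_frameChange x₀ x₁, ?_⟩
    intro x hx w
    rw [𝒢.pretriv_symm hx.1]
    exact 𝒢.frameChange_apply hx w

instance : TopologicalSpace (TotalSpace (AModel EG EM) 𝒢.A) := 𝒢.prebundle.totalSpaceTopology
instance : FiberBundle (AModel EG EM) 𝒢.A := 𝒢.prebundle.toFiberBundle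
instance : VectorBundle ℝ (AModel EG EM) 𝒢.A := 𝒢.prebundle.toVectorBundle
instance : ContMDiffVectorBundle ∞ (AModel EG EM) 𝒢.A 𝓘(ℝ, EM) :=
  𝒢.prebundle.contMDiffVectorBundle 𝓘(ℝ, EM)

/-- The model fibre of the dual bundle. -/
abbrev DualModel (EG : Type u) (EM : Type v) [NormedAddCommGroup EG] [NormedSpace ℝ EG]
    [NormedAddCommGroup EM] [NormedSpace ℝ EM] : Type := AModel EG EM →L[ℝ] ℝ

/-- The total space of the dual bundle `τ^* : A^*G → M`. -/
abbrev AStar : Type (max t u) :=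
  TotalSpace (DualModel EG EM) (fun x : M => 𝒢.A x →L[ℝ] Bundle.Trivial M ℝ x)

/-- The model of the manifold `A^*G`. -/
abbrev starModel (EG : Type u) (EM : Type v) [NormedAddCommGroup EG] [NormedSpace ℝ EG]
    [NormedAddCommGroup EM] [NormedSpace ℝ EM] :
    ModelWithCorners ℝ (EM × DualModel EG EM) (ModelProd EM (DualModel EG EM)) :=
  𝓘(ℝ, EM).prod 𝓘(ℝ, DualModel EG EM)


instance : IsManifold (starModel EG EM) ∞ 𝒢.AStar :=
  Bundle.TotalSpace.isManifold (DualModel EG EM) (fun x : M => 𝒢.A x →L[ℝ] Bundle.Trivial M ℝ x)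

/-- The anchor `ρ : A_x G → T_x M`, `v ↦ T_{ε x} β (v)` (note that `β (ε x) = x`). -/
def anchor (x : M) : 𝒢.A x →L[ℝ] TangentSpace 𝓘(ℝ, EM) x :=
  (show TangentSpace 𝓘(ℝ, EG) (𝒢.unit x) →L[ℝ] TangentSpace 𝓘(ℝ, EM) x from
    mfderiv 𝓘(ℝ, EG) 𝓘(ℝ, EM) 𝒢.tgt (𝒢.unit x)) ∘L 𝒢.incl x

/-- `T_{ε(β g)} l_g : A_{β g} G → T_g G`, the derivative of the left translation
`l_g : α⁻¹(β g) → G`, `h ↦ g h`, along the `α`-fibre (note that `l_g (ε (β g)) = g`). -/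
def dLeft (g : G) : 𝒢.A (𝒢.tgt g) →L[ℝ] TangentSpace 𝓘(ℝ, EG) g :=
  (show TangentSpace 𝓘(ℝ, EG) (𝒢.unit (𝒢.tgt g)) →L[ℝ] TangentSpace 𝓘(ℝ, EG) g from
    mfderivWithin 𝓘(ℝ, EG) 𝓘(ℝ, EG) (fun h => 𝒢.mul g h) {h | 𝒢.src h = 𝒢.tgt g}
      (𝒢.unit (𝒢.tgt g))) ∘L 𝒢.incl (𝒢.tgt g)

/-- `T_{ε(α h)} (r_h ∘ i) : A_{α h} G → T_h G`, the derivative of `k ↦ k⁻¹ h` along the `α`-fibre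
of `α h` (which maps `ε (α h)` to `h`). -/
def dRightInv (h : G) : 𝒢.A (𝒢.src h) →L[ℝ] TangentSpace 𝓘(ℝ, EG) h :=
  (show TangentSpace 𝓘(ℝ, EG) (𝒢.unit (𝒢.src h)) →L[ℝ] TangentSpace 𝓘(ℝ, EG) h from
    mfderivWithin 𝓘(ℝ, EG) 𝓘(ℝ, EG) (fun k => 𝒢.mul (𝒢.inv k) h) {k | 𝒢.src k = 𝒢.src h}
      (𝒢.unit (𝒢.src h))) ∘L 𝒢.incl (𝒢.src h)

/-- The left-invariant vector field `g ↦ T_{ε(β g)} l_g (X (β g))` of a section `X` of `AG`. -/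
def leftInvariant (X : ∀ x, 𝒢.A x) (g : G) : TangentSpace 𝓘(ℝ, EG) g := 𝒢.dLeft g (X (𝒢.tgt g))

/-- The Lie bracket of sections of `AG`: the value at `ε x` of the bracket of the left-invariant
vector fields. For smooth sections that bracket is `α`-vertical, so that `vertProj` is then the
identity on it. -/
def bracket (X Y : ∀ x, 𝒢.A x) (x : M) : 𝒢.A x :=
  𝒢.vertProj x (mlieBracket 𝓘(ℝ, EG) (𝒢.leftInvariant X) (𝒢.leftInvariant Y) (𝒢.unit x))

/-- The discrete Legendre transformation `F⁻L : G → A^*G`, `F⁻L (h) (v) = - v (L ∘ r_h ∘ i)`. -/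
def legMinus (L : G → ℝ) (h : G) : 𝒢.AStar :=
  ⟨𝒢.src h, -((show TangentSpace 𝓘(ℝ, EG) h →L[ℝ] ℝ from mfderiv 𝓘(ℝ, EG) 𝓘(ℝ, ℝ) L h) ∘L
    𝒢.dRightInv h)⟩

/-- The discrete Legendre transformation `F⁺L : G → A^*G`, `F⁺L (g) (v) = v (L ∘ l_g)`. -/
def legPlus (L : G → ℝ) (g : G) : 𝒢.AStar :=
  ⟨𝒢.tgt g, (show TangentSpace 𝓘(ℝ, EG) g →L[ℝ] ℝ from mfderiv 𝓘(ℝ, EG) 𝓘(ℝ, ℝ) L g) ∘L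
    𝒢.dLeft g⟩

/-- The space `A_{τ^* μ} G × T_μ (A^*G)`. -/
abbrev Pair (μ : 𝒢.AStar) : Type (max u v) := 𝒢.A μ.proj × TangentSpace (starModel EG EM) μ

/-- `T_μ τ^*`. -/
def dProj (μ : 𝒢.AStar) :
    TangentSpace (starModel EG EM) μ →L[ℝ] TangentSpace 𝓘(ℝ, EM) μ.proj :=
  mfderiv (starModel EG EM) 𝓘(ℝ, EM) (fun ν : 𝒢.AStar => ν.proj) μ

/-- The fibre at `μ` of the prolongation `P^{τ^*}(AG) → A^*G`: the pairs
`(v, X) ∈ A_{τ^* μ} G × T_μ (A^*G)` with `ρ v = T_μ τ^* (X)`. -/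
def Prol (μ : 𝒢.AStar) : Submodule ℝ (𝒢.Pair μ) :=
  LinearMap.eqLocus ((𝒢.anchor μ.proj).toLinearMap ∘ₗ LinearMap.fst ℝ _ _)
    ((𝒢.dProj μ).toLinearMap ∘ₗ LinearMap.snd ℝ _ _)

/-- Transport of elements of the prolongation along an equality of base points. -/
def transport {μ ν : 𝒢.AStar} (h : μ = ν) (z : 𝒢.Prol μ) : 𝒢.Prol ν := h ▸ z

/-- Chain rule along the fibres of a submersion. -/
theorem mfderiv_mfderivWithin_of_vertical {f p q : G → M} {k : G → G} {h y : G}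
    (hf : ContMDiff 𝓘(ℝ, EG) 𝓘(ℝ, EM) ∞ f)
    (hs : Surjective (mfderiv 𝓘(ℝ, EG) 𝓘(ℝ, EM) f h))
    (hp : MDifferentiableAt 𝓘(ℝ, EG) 𝓘(ℝ, EM) p y) (hq : MDifferentiableAt 𝓘(ℝ, EG) 𝓘(ℝ, EM) q h)
    {s : Set G} (hst : s = {x | f x = f h})
    (hk : MDifferentiableWithinAt 𝓘(ℝ, EG) 𝓘(ℝ, EG) k s h)
    (hy : k h = y) (hpq : ∀ x ∈ s, p (k x) = q x)
    {v : TangentSpace 𝓘(ℝ, EG) h} (hv : mfderiv 𝓘(ℝ, EG) 𝓘(ℝ, EM) f h v = 0) :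
    (mfderiv 𝓘(ℝ, EG) 𝓘(ℝ, EM) p y : EG → EM)
      ((mfderivWithin 𝓘(ℝ, EG) 𝓘(ℝ, EG) k s h : EG → EG) v) =
      (mfderiv 𝓘(ℝ, EG) 𝓘(ℝ, EM) q h : EG → EM) v := by
  subst hy hst
  have h1 := hp.hasMFDerivAt.comp_hasMFDerivWithinAt h hk.hasMFDerivWithinAt
  have h2 := (hq.hasMFDerivAt.hasMFDerivWithinAt (s := {x | f x = f h})).congr_of_eventuallyEq
    (f₁ := p ∘ k) (eventually_of_mem self_mem_nhdsWithin hpq) (hpq h rfl)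
  exact hasMFDerivWithinAt_unique_levelSet (hf.of_le (by simp)).contMDiffAt hs h1 h2 hv

theorem mdifferentiableWithinAt_rightAux (h : G) :
    MDifferentiableWithinAt 𝓘(ℝ, EG) 𝓘(ℝ, EG) (fun k => 𝒢.inv (𝒢.mul k (𝒢.inv h)))
      {k | 𝒢.tgt k = 𝒢.tgt h} h := by
  have h1 : ContMDiffOn 𝓘(ℝ, EG) 𝓘(ℝ, EG) ∞ (fun k => 𝒢.mul k (𝒢.inv h))
      {k | 𝒢.tgt k = 𝒢.tgt h} :=
    𝒢.contMDiffOn_mul.comp (contMDiff_id.prodMk contMDiff_const).contMDiffOn fun k hk => by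
      simpa [𝒢.src_inv] using hk
  exact (𝒢.contMDiff_inv.comp_contMDiffOn h1 h rfl).mdifferentiableWithinAt (by simp)

theorem mdifferentiableWithinAt_leftAux (g : G) :
    MDifferentiableWithinAt 𝓘(ℝ, EG) 𝓘(ℝ, EG) (fun k => 𝒢.mul (𝒢.inv g) k)
      {k | 𝒢.src k = 𝒢.src g} g := by
  have h1 : ContMDiffOn 𝓘(ℝ, EG) 𝓘(ℝ, EG) ∞ (fun k => 𝒢.mul (𝒢.inv g) k)
      {k | 𝒢.src k = 𝒢.src g} :=
    𝒢.contMDiffOn_mul.comp (contMDiff_const.prodMk contMDiff_id).contMDiffOn fun k hk => by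
      simpa [𝒢.tgt_inv] using hk.symm
  exact (h1 g rfl).mdifferentiableWithinAt (by simp)

/-- `T_h (i ∘ r_{h⁻¹})`, the derivative at `h` of `k ↦ (k h⁻¹)⁻¹` along the `β`-fibre of `h`;
only its values on `V_h β` are used. -/
def dInvRight (h : G) : TangentSpace 𝓘(ℝ, EG) h →L[ℝ] TangentSpace 𝓘(ℝ, EG) (𝒢.unit (𝒢.src h)) :=
  mfderivWithin 𝓘(ℝ, EG) 𝓘(ℝ, EG) (fun k => 𝒢.inv (𝒢.mul k (𝒢.inv h)))
    {k | 𝒢.tgt k = 𝒢.tgt h} h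

/-- `T_g l_{g⁻¹}`, the derivative at `g` of `k ↦ g⁻¹ k` along the `α`-fibre of `g`; only its
values on `V_g α` are used. -/
def dLeftInv (g : G) : TangentSpace 𝓘(ℝ, EG) g →L[ℝ] TangentSpace 𝓘(ℝ, EG) (𝒢.unit (𝒢.tgt g)) :=
  mfderivWithin 𝓘(ℝ, EG) 𝓘(ℝ, EG) (fun k => 𝒢.mul (𝒢.inv g) k)
    {k | 𝒢.src k = 𝒢.src g} g

theorem inv_unit (x : M) : 𝒢.inv (𝒢.unit x) = 𝒢.unit x := by
  have h1 := 𝒢.mul_inv (𝒢.unit x)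
  have h2 := 𝒢.unit_mul (𝒢.inv (𝒢.unit x))
  rw [𝒢.src_inv, 𝒢.tgt_unit] at h2
  rw [h2, 𝒢.src_unit] at h1
  exact h1

theorem mfderiv_src_dInvRight {h : G} (X : 𝒢.vertTgt h) :
    mfderiv 𝓘(ℝ, EG) 𝓘(ℝ, EM) 𝒢.src (𝒢.unit (𝒢.src h)) (𝒢.dInvRight h X) = 0 := by
  have h1 := mfderiv_mfderivWithin_of_vertical (p := 𝒢.src) (q := fun _ => 𝒢.src h)
    (y := 𝒢.unit (𝒢.src h)) 𝒢.contMDiff_tgt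
    (𝒢.submersion_tgt h) (𝒢.contMDiff_src.mdifferentiable (by simp) _) mdifferentiableAt_const rfl
    (𝒢.mdifferentiableWithinAt_rightAux h) (by rw [𝒢.mul_inv, 𝒢.inv_unit])
    (fun k (hk : 𝒢.tgt k = 𝒢.tgt h) => by
      rw [𝒢.src_inv, 𝒢.tgt_mul _ _ (by rw [𝒢.src_inv, hk]), 𝒢.tgt_inv]) X.2
  refine h1.trans ?_
  rw [mfderiv_const]; rfl

theorem mfderiv_tgt_dInvRight {h : G} (X : 𝒢.vertTgt h) :
    (mfderiv 𝓘(ℝ, EG) 𝓘(ℝ, EM) 𝒢.tgt (𝒢.unit (𝒢.src h)) : EG → EM) (𝒢.dInvRight h X) =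
      (mfderiv 𝓘(ℝ, EG) 𝓘(ℝ, EM) 𝒢.src h : EG → EM) X :=
  mfderiv_mfderivWithin_of_vertical (p := 𝒢.tgt) (q := 𝒢.src)
    (y := 𝒢.unit (𝒢.src h)) 𝒢.contMDiff_tgt
    (𝒢.submersion_tgt h) (𝒢.contMDiff_tgt.mdifferentiable (by simp) _)
    (𝒢.contMDiff_src.mdifferentiable (by simp) _) rfl
    (𝒢.mdifferentiableWithinAt_rightAux h) (by rw [𝒢.mul_inv, 𝒢.inv_unit])
    (fun k (hk : 𝒢.tgt k = 𝒢.tgt h) => by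
      rw [𝒢.tgt_inv, 𝒢.src_mul _ _ (by rw [𝒢.src_inv, hk])]) X.2

theorem mfderiv_src_dLeftInv {g : G} (Y : 𝒢.vertSrc g) :
    mfderiv 𝓘(ℝ, EG) 𝓘(ℝ, EM) 𝒢.src (𝒢.unit (𝒢.tgt g)) (𝒢.dLeftInv g Y) = 0 := by
  have h1 := mfderiv_mfderivWithin_of_vertical (p := 𝒢.src) (q := fun _ => 𝒢.tgt g)
    (y := 𝒢.unit (𝒢.tgt g)) 𝒢.contMDiff_src
    (𝒢.submersion_src g) (𝒢.contMDiff_src.mdifferentiable (by simp) _) mdifferentiableAt_const rfl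
    (𝒢.mdifferentiableWithinAt_leftAux g) (𝒢.inv_mul g)
    (fun k (hk : 𝒢.src k = 𝒢.src g) => by
      rw [𝒢.src_mul _ _ (by rw [𝒢.tgt_inv, hk]), 𝒢.src_inv]) Y.2
  refine h1.trans ?_
  rw [mfderiv_const]; rfl

theorem mfderiv_tgt_dLeftInv {g : G} (Y : 𝒢.vertSrc g) :
    (mfderiv 𝓘(ℝ, EG) 𝓘(ℝ, EM) 𝒢.tgt (𝒢.unit (𝒢.tgt g)) : EG → EM) (𝒢.dLeftInv g Y) =
      (mfderiv 𝓘(ℝ, EG) 𝓘(ℝ, EM) 𝒢.tgt g : EG → EM) Y :=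
  mfderiv_mfderivWithin_of_vertical (p := 𝒢.tgt) (q := 𝒢.tgt)
    (y := 𝒢.unit (𝒢.tgt g)) 𝒢.contMDiff_src
    (𝒢.submersion_src g) (𝒢.contMDiff_tgt.mdifferentiable (by simp) _)
    (𝒢.contMDiff_tgt.mdifferentiable (by simp) _) rfl
    (𝒢.mdifferentiableWithinAt_leftAux g) (𝒢.inv_mul g)
    (fun k (hk : 𝒢.src k = 𝒢.src g) => by
      rw [𝒢.tgt_mul _ _ (by rw [𝒢.tgt_inv, hk])]) Y.2

/-- The map `T_h (i ∘ r_{h⁻¹}) : V_h β → A_{α h} G`. -/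
def phiAlpha (h : G) : 𝒢.vertTgt h →ₗ[ℝ] 𝒢.A (𝒢.src h) :=
  ((𝒢.dInvRight h).toLinearMap ∘ₗ (𝒢.vertTgt h).subtype).codRestrict
    (𝒢.vertSrc (𝒢.unit (𝒢.src h))) fun X => 𝒢.mfderiv_src_dInvRight X

/-- The map `T_g l_{g⁻¹} : V_g α → A_{β g} G`. -/
def phiBeta (g : G) : 𝒢.vertSrc g →ₗ[ℝ] 𝒢.A (𝒢.tgt g) :=
  ((𝒢.dLeftInv g).toLinearMap ∘ₗ (𝒢.vertSrc g).subtype).codRestrict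
    (𝒢.vertSrc (𝒢.unit (𝒢.tgt g))) fun Y => 𝒢.mfderiv_src_dLeftInv Y

/-- The fibre `V_g β ⊕ V_g α` of `P^τ G → G`. -/
abbrev PTau (g : G) : Type u := 𝒢.vertTgt g × 𝒢.vertSrc g

/-- The anchor `(X, Y) ↦ X + Y` of `P^τ G`. -/
def anchorTau (g : G) : 𝒢.PTau g →ₗ[ℝ] TangentSpace 𝓘(ℝ, EG) g :=
  (𝒢.vertTgt g).subtype.coprod (𝒢.vertSrc g).subtype

theorem mfderiv_src_anchorTau {g : G} (z : 𝒢.PTau g) :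
    mfderiv 𝓘(ℝ, EG) 𝓘(ℝ, EM) 𝒢.src g (𝒢.anchorTau g z) =
      mfderiv 𝓘(ℝ, EG) 𝓘(ℝ, EM) 𝒢.src g z.1 := by
  have h2 : mfderiv 𝓘(ℝ, EG) 𝓘(ℝ, EM) 𝒢.src g z.2 = 0 := z.2.2
  change mfderiv 𝓘(ℝ, EG) 𝓘(ℝ, EM) 𝒢.src g ((z.1 : TangentSpace 𝓘(ℝ, EG) g) + z.2) = _
  rw [map_add, h2, add_zero]

theorem mfderiv_tgt_anchorTau {g : G} (z : 𝒢.PTau g) :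
    mfderiv 𝓘(ℝ, EG) 𝓘(ℝ, EM) 𝒢.tgt g (𝒢.anchorTau g z) =
      mfderiv 𝓘(ℝ, EG) 𝓘(ℝ, EM) 𝒢.tgt g z.2 := by
  have h2 : mfderiv 𝓘(ℝ, EG) 𝓘(ℝ, EM) 𝒢.tgt g z.1 = 0 := z.1.2
  change mfderiv 𝓘(ℝ, EG) 𝓘(ℝ, EM) 𝒢.tgt g ((z.1 : TangentSpace 𝓘(ℝ, EG) g) + z.2) = _
  rw [map_add, h2, zero_add]

theorem dProj_mfderiv {F : G → 𝒢.AStar} {g : G}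
    (hF : MDifferentiableAt 𝓘(ℝ, EG) (starModel EG EM) F g)
    (v : TangentSpace 𝓘(ℝ, EG) g) :
    𝒢.dProj (F g) (mfderiv 𝓘(ℝ, EG) (starModel EG EM) F g v) =
      mfderiv 𝓘(ℝ, EG) 𝓘(ℝ, EM) (fun h => (F h).proj) g v := by
  have h1 := mfderiv_comp (I := 𝓘(ℝ, EG)) (I' := starModel EG EM) (I'' := 𝓘(ℝ, EM)) g
    (g := fun ν : 𝒢.AStar => ν.proj) (f := F)
    ((Bundle.contMDiff_proj (IB := 𝓘(ℝ, EM)) (n := ∞) (fun x : M => 𝒢.A x →L[ℝ] Bundle.Trivial M ℝ x)).mdifferentiable (by simp) _) hF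
  exact (DFunLike.congr_fun h1 v).symm

/-- The prolongation `P^τ F⁻L` at `h`:
`(X, Y) ↦ (T_h (i ∘ r_{h⁻¹}) X, T_h (F⁻L) (X + Y))`. -/
def prolMinus {L : G → ℝ} (hF : ContMDiff 𝓘(ℝ, EG) (starModel EG EM) ∞ (𝒢.legMinus L)) (h : G) :
    𝒢.PTau h →ₗ[ℝ] 𝒢.Prol (𝒢.legMinus L h) :=
  ((𝒢.phiAlpha h ∘ₗ LinearMap.fst ℝ _ _).prod
    ((mfderiv 𝓘(ℝ, EG) (starModel EG EM) (𝒢.legMinus L) h).toLinearMap ∘ₗ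
      𝒢.anchorTau h)).codRestrict (𝒢.Prol (𝒢.legMinus L h)) fun z => by
    change 𝒢.anchor (𝒢.src h) (𝒢.phiAlpha h z.1) = 𝒢.dProj (𝒢.legMinus L h)
      (mfderiv 𝓘(ℝ, EG) (starModel EG EM) (𝒢.legMinus L) h (𝒢.anchorTau h z))
    rw [𝒢.dProj_mfderiv (hF.mdifferentiable (by simp) h)]
    exact (𝒢.mfderiv_tgt_dInvRight z.1).trans (𝒢.mfderiv_src_anchorTau z).symm

/-- The prolongation `P^τ F⁺L` at `g`:
`(X, Y) ↦ (T_g l_{g⁻¹} Y, T_g (F⁺L) (X + Y))`. -/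
def prolPlus {L : G → ℝ} (hF : ContMDiff 𝓘(ℝ, EG) (starModel EG EM) ∞ (𝒢.legPlus L)) (g : G) :
    𝒢.PTau g →ₗ[ℝ] 𝒢.Prol (𝒢.legPlus L g) :=
  ((𝒢.phiBeta g ∘ₗ LinearMap.snd ℝ _ _).prod
    ((mfderiv 𝓘(ℝ, EG) (starModel EG EM) (𝒢.legPlus L) g).toLinearMap ∘ₗ
      𝒢.anchorTau g)).codRestrict (𝒢.Prol (𝒢.legPlus L g)) fun z => by
    change 𝒢.anchor (𝒢.tgt g) (𝒢.phiBeta g z.2) = 𝒢.dProj (𝒢.legPlus L g)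
      (mfderiv 𝓘(ℝ, EG) (starModel EG EM) (𝒢.legPlus L) g (𝒢.anchorTau g z))
    rw [𝒢.dProj_mfderiv (hF.mdifferentiable (by simp) g)]
    exact (𝒢.mfderiv_tgt_dLeftInv z.2).trans (𝒢.mfderiv_tgt_anchorTau z).symm

/-- The differential of a function in the Lie algebroid `P^{τ^*}(AG)`, whose anchor is
`(v, X) ↦ X`. -/
def dFun (f : 𝒢.AStar → ℝ) (μ : 𝒢.AStar) (z : 𝒢.Prol μ) : ℝ :=
  mfderiv (starModel EG EM) 𝓘(ℝ, ℝ) f μ z.1.2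

/-- The Liouville section `Θ (μ) (v, X) = μ (v)`. -/
def liouville (μ : 𝒢.AStar) : 𝒢.Pair μ →ₗ[ℝ] ℝ :=
  (show 𝒢.A μ.proj →L[ℝ] ℝ from μ.2).toLinearMap ∘ₗ LinearMap.fst ℝ _ _

/-- Smoothness of a section of `AG`. -/
def SmoothSection (X : ∀ x, 𝒢.A x) : Prop :=
  ContMDiff 𝓘(ℝ, EM) (𝓘(ℝ, EM).prod 𝓘(ℝ, AModel EG EM)) ∞
    (fun x => (⟨x, X x⟩ : TotalSpace (AModel EG EM) 𝒢.A))

/-- Smoothness of a vector field on `A^*G`. -/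
def SmoothField (U : ∀ μ : 𝒢.AStar, TangentSpace (starModel EG EM) μ) : Prop :=
  ContMDiff (starModel EG EM) (starModel EG EM).tangent ∞
    (fun μ => (⟨μ, U μ⟩ : TangentBundle (starModel EG EM) 𝒢.AStar))

/-- The projectable sections of `P^{τ^*}(AG)`: pairs of a smooth section `X` of `AG` and a smooth
vector field `U` on `A^*G` that projects to `ρ X`; the section is `μ ↦ (X (τ^* μ), U μ)`. -/
def ProjSection : Type (max t u v) :=
  {Z : (∀ x, 𝒢.A x) × (∀ μ : 𝒢.AStar, TangentSpace (starModel EG EM) μ) //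
    𝒢.SmoothSection Z.1 ∧ 𝒢.SmoothField Z.2 ∧
      ∀ μ : 𝒢.AStar, 𝒢.anchor μ.proj (Z.1 μ.proj) = 𝒢.dProj μ (Z.2 μ)}

/-- The section of `AG` under a projectable section. -/
def ProjSection.X {𝒢 : LieGroupoid EG EM G M} (Z : 𝒢.ProjSection) : ∀ x, 𝒢.A x := Z.1.1

/-- The vector field on `A^*G` of a projectable section. -/
def ProjSection.U {𝒢 : LieGroupoid EG EM G M} (Z : 𝒢.ProjSection) :
    ∀ μ : 𝒢.AStar, TangentSpace (starModel EG EM) μ := Z.1.2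

/-- The value at `μ` of a projectable section. -/
def ProjSection.val {𝒢 : LieGroupoid EG EM G M} (Z : 𝒢.ProjSection) (μ : 𝒢.AStar) :
    𝒢.Prol μ :=
  ⟨(Z.X μ.proj, Z.U μ), Z.2.2.2 μ⟩

/-- The function `dθ (Z₀, Z₁) = ρ(Z₀) (θ(Z₁)) - ρ(Z₁) (θ(Z₀)) - θ ([Z₀, Z₁])` on projectable
sections, where the bracket of `P^{τ^*}(AG)` is
`[(X₀ ∘ τ^*, U₀), (X₁ ∘ τ^*, U₁)] = ([X₀, X₁] ∘ τ^*, [U₀, U₁])`. The one-section `θ` is given by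
linear forms on the ambient spaces `A_{τ^* μ} G × T_μ (A^*G)`; only their restrictions to the
prolongation matter, since the bracket is again a section of it. -/
def dOne (θ : ∀ μ : 𝒢.AStar, 𝒢.Pair μ →ₗ[ℝ] ℝ) (Z₀ Z₁ : 𝒢.ProjSection) (μ : 𝒢.AStar) : ℝ :=
  (show ℝ from mfderiv (starModel EG EM) 𝓘(ℝ, ℝ) (fun ν => θ ν (Z₁.val ν)) μ (Z₀.U μ)) -
  (show ℝ from mfderiv (starModel EG EM) 𝓘(ℝ, ℝ) (fun ν => θ ν (Z₀.val ν)) μ (Z₁.U μ)) -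
  θ μ (𝒢.bracket Z₀.X Z₁.X μ.proj, mlieBracket (starModel EG EM) Z₀.U Z₁.U μ)

/-- Families of bilinear forms on the fibres of `P^{τ^*}(AG)`. -/
abbrev TwoSection : Type _ := ∀ μ : 𝒢.AStar, 𝒢.Prol μ →ₗ[ℝ] 𝒢.Prol μ →ₗ[ℝ] ℝ

/-- `η = dθ` in the Lie algebroid `P^{τ^*}(AG)`. Every element of the prolongation is the value of
a projectable section, so this determines `η`. -/
def IsDifferential (θ : ∀ μ : 𝒢.AStar, 𝒢.Pair μ →ₗ[ℝ] ℝ) (η : 𝒢.TwoSection) : Prop :=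
  ∀ (Z₀ Z₁ : 𝒢.ProjSection) (μ : 𝒢.AStar), η μ (Z₀.val μ) (Z₁.val μ) = 𝒢.dOne θ Z₀ Z₁ μ

open Classical in
/-- The differential `dθ` of a one-section of the dual of `P^{τ^*}(AG)`. -/
def differential (θ : ∀ μ : 𝒢.AStar, 𝒢.Pair μ →ₗ[ℝ] ℝ) : 𝒢.TwoSection :=
  if h : ∃ η, 𝒢.IsDifferential θ η then h.choose else 0

/-- The canonical symplectic section `Ω = - dΘ`. -/
def Omega : 𝒢.TwoSection := -𝒢.differential 𝒢.liouville

open Classical in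
/-- The Hamiltonian section `ξ_f` of `f`, given by `i_{ξ_f} Ω = df`. -/
def hamSection (f : 𝒢.AStar → ℝ) (μ : 𝒢.AStar) : 𝒢.Prol μ :=
  if h : ∃ z, ∀ w, 𝒢.Omega μ z w = 𝒢.dFun f μ w then h.choose else 0

/-- The canonical linear Poisson bracket `{f, g} = - Ω (ξ_f, ξ_g)` on `A^*G`. -/
def poissonBracket (f g : 𝒢.AStar → ℝ) (μ : 𝒢.AStar) : ℝ :=
  -𝒢.Omega μ (𝒢.hamSection f μ) (𝒢.hamSection g μ)

/-- The discrete Hamiltonian evolution operator `F⁺L ∘ (F⁻L)⁻¹`, where `Φ` is `F⁻L`. -/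
def hamEvol (L : G → ℝ) (Φ : G ≃ₘ⟮𝓘(ℝ, EG), starModel EG EM⟯ 𝒢.AStar) (μ : 𝒢.AStar) : 𝒢.AStar :=
  𝒢.legPlus L (Φ.symm μ)

/-- The prolongation `P^τ F⁺L ∘ (P^τ F⁻L)⁻¹` of the discrete Hamiltonian evolution operator, where
`Φ` is `F⁻L` and `Ψ` is `F⁺L`. -/
def prolHamEvol {L : G → ℝ} {Φ Ψ : G ≃ₘ⟮𝓘(ℝ, EG), starModel EG EM⟯ 𝒢.AStar}
    (hΦ : ∀ g, Φ g = 𝒢.legMinus L g) (hΨ : ∀ g, Ψ g = 𝒢.legPlus L g) (μ : 𝒢.AStar)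
    (z : 𝒢.Prol μ) : 𝒢.Prol (𝒢.hamEvol L Φ μ) :=
  𝒢.prolPlus (funext hΨ ▸ Ψ.contMDiff) (Φ.symm μ)
    (invFun (𝒢.prolMinus (funext hΦ ▸ Φ.contMDiff) (Φ.symm μ))
      (𝒢.transport ((Φ.apply_symm_apply μ).symm.trans (hΦ (Φ.symm μ))) z))

end Algebroid
end LieGroupoid

end

/-! Everything is pulled back to `G`. A fibre of the prolongation at `F⁻L(g)` is identified with
`V_gβ ⊕ V_gα` by `P^τ F⁻L`, the fibre at `F⁺L(g)` with the same space by `P^τ F⁺L`, and in these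
identifications the prolonged evolution operator is the identity. So it suffices to compare the two
pull-backs of `Θ` and of `Ω`.

For `Θ` this is immediate: at `(X, Y)` the pull-back by `F⁻L` is `-dL(X)` and the one by `F⁺L` is
`dL(Y)`, and the difference is `dL(X + Y)`, the differential of `L ∘ (F⁻L)⁻¹`.

For `dΘ`, a section `X` of `AG` gives the function `ν ↦ ν(X)` on `A^*G`. Its pull-back by `F⁻L` is
minus the derivative of `L` along the right-invariant field of `X`, and its pull-back by `F⁺L` is
the derivative of `L` along the left-invariant field. Thus `dΘ` becomes an expression in second
derivatives of `L`. The second derivatives along two right-invariant fields, or along two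
left-invariant fields, cancel against the bracket term, because the commutator of invariant fields
is the invariant field of the bracket (`leftDeriv_bracket`, `rightDeriv_bracket`). What survives is
a mixed Hessian `b` of `L` on `V_gβ × V_gα`, which does not depend on the order of differentiation
because left- and right-invariant fields commute (`rightDeriv_leftDeriv_comm`). Both pull-backs of
`dΘ` equal `b(X₀, Y₁) - b(X₁, Y₀)` (`dOne_liouville_legMinus`, `dOne_liouville_legPlus`), hence `Ω`
is preserved.

The same formula gives the rest. It depends only on the values of the two sections at the point, so
`dΘ` is a family of bilinear forms. It is nondegenerate because a vector in the kernel of `b` on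
either side is killed by the derivative of `F⁻L` or of `F⁺L` (`eq_zero_of_tder_pairing`), and these
are injective. Finally, a surjective map that preserves a nondegenerate `Ω` and is compatible with
differentials of functions matches Hamiltonian sections, whence the Poisson property. -/

noncomputable section
set_option linter.unusedSectionVars false

/-! ### Derivatives and Lie brackets of vector fields on manifolds -/

section ManifoldGeneralities

variable {E E' E'' F H H' H'' : Type*} [NormedAddCommGroup E] [NormedSpace ℝ E]
  [NormedAddCommGroup E'] [NormedSpace ℝ E'] [NormedAddCommGroup E''] [NormedSpace ℝ E'']
  [NormedAddCommGroup F] [NormedSpace ℝ F]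
  [TopologicalSpace H] [TopologicalSpace H'] [TopologicalSpace H'']
  {I : ModelWithCorners ℝ E H} {I' : ModelWithCorners ℝ E' H'} {I'' : ModelWithCorners ℝ E'' H''}
  {N N' N'' : Type*} [TopologicalSpace N] [ChartedSpace H N] [TopologicalSpace N']
  [ChartedSpace H' N'] [TopologicalSpace N''] [ChartedSpace H'' N'']

variable (I I') in
/-- The derivative of a map of manifolds, as a map of the model spaces. -/
def tder (f : N → N') (x : N) : E →L[ℝ] E' := mfderiv I I' f x

theorem tder_comp {g : N' → N''} {f : N → N'} {x : N} {y : N'} (hy : f x = y)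
    (hg : MDifferentiableAt I' I'' g y) (hf : MDifferentiableAt I I' f x) (v : E) :
    tder I I'' (fun z => g (f z)) x v = tder I' I'' g y (tder I I' f x v) := by
  subst hy
  exact DFunLike.congr_fun (mfderiv_comp x hg hf) v

theorem tder_congr {f g : N → N'} {x : N} (h : f =ᶠ[𝓝 x] g) : tder I I' f x = tder I I' g x :=
  h.mfderiv_eq

theorem tder_const (c : N') (x : N) : tder I I' (fun _ : N => c) x = 0 := mfderiv_const

theorem tder_id (x : N) (v : E) : tder I I (fun z : N => z) x v = v :=
  DFunLike.congr_fun (mfderiv_id (I := I) (x := x)) v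

theorem tder_eq_fderiv {f : E → F} {x : E} : tder 𝓘(ℝ, E) 𝓘(ℝ, F) f x = fderiv ℝ f x :=
  mfderiv_eq_fderiv

/-- By the product rule both terms contain the second derivative of `f` at `(V x, W x)`. It cancels
by symmetry, and the derivatives of `W` and `V` that remain make up the bracket. -/
theorem fderiv_lieBracket_apply {f : E → F} {V W : E → E} {x : E} (hf : ContDiffAt ℝ 2 f x)
    (hV : DifferentiableAt ℝ V x) (hW : DifferentiableAt ℝ W x) :
    fderiv ℝ f x (lieBracket ℝ V W x) =
      fderiv ℝ (fun y => fderiv ℝ f y (W y)) x (V x) -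
        fderiv ℝ (fun y => fderiv ℝ f y (V y)) x (W x) := by
  have hf' : DifferentiableAt ℝ (fderiv ℝ f) x :=
    (hf.fderiv_right (m := 1) (by norm_num)).differentiableAt one_ne_zero
  have hs := (hf.isSymmSndFDerivAt (by simp)).eq (V x) (W x)
  rw [fderiv_clm_apply hf' hW, fderiv_clm_apply hf' hV, lieBracket]
  simp [hs]

variable {N : Type*} [TopologicalSpace N] [ChartedSpace E N] [IsManifold 𝓘(ℝ, E) ∞ N]

/-- Chain rule through the preferred chart at `x`. -/
theorem tder_eq_fderiv_extChartAt {f : N → F} {x : N}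
    (hf : DifferentiableAt ℝ (f ∘ (extChartAt 𝓘(ℝ, E) x).symm) (extChartAt 𝓘(ℝ, E) x x)) (v : E) :
    tder 𝓘(ℝ, E) 𝓘(ℝ, F) f x v =
      fderiv ℝ (f ∘ (extChartAt 𝓘(ℝ, E) x).symm) (extChartAt 𝓘(ℝ, E) x x)
        (tder 𝓘(ℝ, E) 𝓘(ℝ, E) (extChartAt 𝓘(ℝ, E) x) x v) := by
  have hφ : MDifferentiableAt 𝓘(ℝ, E) 𝓘(ℝ, E) (extChartAt 𝓘(ℝ, E) x) x :=
    mdifferentiableAt_extChartAt (mem_chart_source E x)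
  have h2 : (fun z => (f ∘ (extChartAt 𝓘(ℝ, E) x).symm) (extChartAt 𝓘(ℝ, E) x z)) =ᶠ[𝓝 x] f := by
    filter_upwards [extChartAt_source_mem_nhds (I := 𝓘(ℝ, E)) x] with y hy
    simp only [comp_apply, (extChartAt 𝓘(ℝ, E) x).left_inv hy]
  rw [← tder_congr h2, tder_comp rfl hf.mdifferentiableAt hφ, tder_eq_fderiv]

/-- The bracket on a manifold is the flat bracket of the chart expressions `T V` and `T W`, carried
back by the chart, so the identity reduces to `fderiv_lieBracket_apply`. Vector values of `f` are
allowed so that it also applies to a source map read in a chart. -/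
theorem tder_mlieBracket_apply [CompleteSpace E] {f : N → F}
    {V W : ∀ y : N, TangentSpace 𝓘(ℝ, E) y} {x : N}
    (hf : ContMDiffAt 𝓘(ℝ, E) 𝓘(ℝ, F) ∞ f x)
    (hV : MDifferentiableAt 𝓘(ℝ, E) 𝓘(ℝ, E).tangent
      (fun y => (⟨y, V y⟩ : TangentBundle 𝓘(ℝ, E) N)) x)
    (hW : MDifferentiableAt 𝓘(ℝ, E) 𝓘(ℝ, E).tangent
      (fun y => (⟨y, W y⟩ : TangentBundle 𝓘(ℝ, E) N)) x) :
    tder 𝓘(ℝ, E) 𝓘(ℝ, F) f x (mlieBracket 𝓘(ℝ, E) V W x) =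
      tder 𝓘(ℝ, E) 𝓘(ℝ, F) (fun y => tder 𝓘(ℝ, E) 𝓘(ℝ, F) f y (W y)) x (V x) -
      tder 𝓘(ℝ, E) 𝓘(ℝ, F) (fun y => tder 𝓘(ℝ, E) 𝓘(ℝ, F) f y (V y)) x (W x) := by
  have : IsManifold 𝓘(ℝ, E) 2 N := IsManifold.of_le (n := ∞) (by norm_cast)
  let φ := extChartAt 𝓘(ℝ, E) x
  have hfφ' : ContDiffAt ℝ ∞ (f ∘ φ.symm) (φ x) := by
    exact contMDiffAt_iff_contDiffAt.1 (ContMDiffAt.comp_of_eq hf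
      ((contMDiffOn_extChartAt_symm x).contMDiffAt (extChartAt_target_mem_nhds x))
      (extChartAt_to_inv x))
  have hfφ : ContDiffAt ℝ 2 (f ∘ φ.symm) (φ x) := hfφ'.of_le (by norm_cast)
  -- the chart expression of a vector field
  let T : (∀ y : N, TangentSpace 𝓘(ℝ, E) y) → E → E :=
    fun V => mpullbackWithin 𝓘(ℝ, E) 𝓘(ℝ, E) φ.symm V (range 𝓘(ℝ, E))
  have hT : ∀ V : (∀ y : N, TangentSpace 𝓘(ℝ, E) y),
      MDifferentiableAt 𝓘(ℝ, E) 𝓘(ℝ, E).tangent (fun y => (⟨y, V y⟩ : TangentBundle 𝓘(ℝ, E) N)) x →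
      DifferentiableAt ℝ (T V) (φ x) := by
    intro V hV
    have h : DifferentiableWithinAt ℝ (T V)
        ((extChartAt 𝓘(ℝ, E) x).symm ⁻¹' univ ∩ range 𝓘(ℝ, E)) (φ x) :=
      MDifferentiableWithinAt.differentiableWithinAt_mpullbackWithin_vectorField (s := univ)
        (hV.mdifferentiableWithinAt)
    have hu : (extChartAt 𝓘(ℝ, E) x).symm ⁻¹' univ ∩ range 𝓘(ℝ, E) = univ := by simp
    rw [hu, differentiableWithinAt_univ] at h
    exact h
  have hTx : ∀ V : (∀ y : N, TangentSpace 𝓘(ℝ, E) y),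
      tder 𝓘(ℝ, E) 𝓘(ℝ, E) φ x (V x) = T V (φ x) := by
    intro V
    have h1 := mfderiv_extChartAt_comp_mfderivWithin_extChartAt_symm' (I := 𝓘(ℝ, E))
      (mem_extChartAt_source x)
    have h2 := isInvertible_mfderivWithin_extChartAt_symm (I := 𝓘(ℝ, E))
      (mem_extChartAt_target (I := 𝓘(ℝ, E)) x)
    have h3 : (mfderivWithin 𝓘(ℝ, E) 𝓘(ℝ, E) φ.symm (range 𝓘(ℝ, E)) (φ x) : E → E)
        (T V (φ x)) = V (φ.symm (φ x)) := h2.self_apply_inverse _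
    have h4 : ∀ y, y = x → (V y : E) = V x := by rintro _ rfl; rfl
    have h5 := h3.trans (h4 _ (extChartAt_to_inv x))
    exact (congrArg (tder 𝓘(ℝ, E) 𝓘(ℝ, E) φ x) h5.symm).trans (DFunLike.congr_fun h1 (T V (φ x)))
  -- This is needed on a neighbourhood of `φ x` and not only at the point, since both sides are
  -- differentiated once more in `hmain`.
  have hloc : ∀ V : (∀ y : N, TangentSpace 𝓘(ℝ, E) y),
      (fun y => tder 𝓘(ℝ, E) 𝓘(ℝ, F) f y (V y)) ∘ φ.symm =ᶠ[𝓝 (φ x)]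
        fun y => fderiv ℝ (f ∘ φ.symm) y (T V y) := by
    intro V
    have ht : ∀ᶠ y in 𝓝 (φ x), y ∈ φ.target := extChartAt_target_mem_nhds x
    have hd : ∀ᶠ y in 𝓝 (φ x), DifferentiableAt ℝ (f ∘ φ.symm) y := by
      filter_upwards [hfφ.eventually (by simp)] with y hy using hy.differentiableAt (by simp)
    filter_upwards [ht, hd] with y hy hdy
    have h1 : (mfderivWithin 𝓘(ℝ, E) 𝓘(ℝ, E) φ.symm (range 𝓘(ℝ, E)) y : E → E) (T V y) =
        V (φ.symm y) :=
      (isInvertible_mfderivWithin_extChartAt_symm (I := 𝓘(ℝ, E)) hy).self_apply_inverse _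
    have h5 : mfderivWithin 𝓘(ℝ, E) 𝓘(ℝ, E) φ.symm (range 𝓘(ℝ, E)) y =
      mfderiv 𝓘(ℝ, E) 𝓘(ℝ, E) φ.symm y := by simp
    rw [h5] at h1
    have h2 : MDifferentiableAt 𝓘(ℝ, E) 𝓘(ℝ, E) φ.symm y := by
      have h := mdifferentiableWithinAt_extChartAt_symm (I := 𝓘(ℝ, E)) hy
      rw [modelWithCornersSelf_coe, range_id, mdifferentiableWithinAt_univ] at h
      exact h
    have h6 : MDifferentiableAt 𝓘(ℝ, E) 𝓘(ℝ, E) φ (φ.symm y) :=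
      mdifferentiableAt_extChartAt (by
        have := φ.map_target hy
        rwa [extChartAt_source] at this)
    have hdf : MDifferentiableAt 𝓘(ℝ, E) 𝓘(ℝ, F) f (φ.symm y) := by
      have h7 : MDifferentiableAt 𝓘(ℝ, E) 𝓘(ℝ, F) ((f ∘ φ.symm) ∘ φ) (φ.symm y) :=
        MDifferentiableAt.comp (φ.symm y) (by rw [φ.right_inv hy]; exact hdy.mdifferentiableAt) h6
      refine h7.congr_of_eventuallyEq ?_
      filter_upwards [extChartAt_source_mem_nhds' (I := 𝓘(ℝ, E)) (φ.map_target hy)] with z hz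
      simp only [comp_apply]
      rw [φ.left_inv hz]
    have h3 := tder_comp (I'' := 𝓘(ℝ, F)) rfl hdf h2 (T V y)
    rw [tder_eq_fderiv] at h3
    exact (h3.trans (congrArg (tder 𝓘(ℝ, E) 𝓘(ℝ, F) f (φ.symm y)) h1)).symm
  have hmain : ∀ V W : (∀ y : N, TangentSpace 𝓘(ℝ, E) y), DifferentiableAt ℝ (T W) (φ x) →
      tder 𝓘(ℝ, E) 𝓘(ℝ, F) (fun y => tder 𝓘(ℝ, E) 𝓘(ℝ, F) f y (W y)) x (V x) =
      fderiv ℝ (fun y => fderiv ℝ (f ∘ φ.symm) y (T W y)) (φ x) (T V (φ x)) := by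
    intro V W hTW
    have hd : DifferentiableAt ℝ (fun y => fderiv ℝ (f ∘ φ.symm) y (T W y)) (φ x) :=
      ((hfφ.fderiv_right (m := 1) (by norm_num)).differentiableAt one_ne_zero).clm_apply hTW
    rw [tder_eq_fderiv_extChartAt ((hloc W).differentiableAt_iff.2 hd) (V x)]
    refine Eq.trans ?_ (congrArg _ (hTx V))
    exact DFunLike.congr_fun (hloc W).fderiv_eq _
  rw [hmain V W (hT W hW), hmain W V (hT V hV), ← fderiv_lieBracket_apply hfφ (hT V hV) (hT W hW)]
  have h1 := tder_eq_fderiv_extChartAt (hfφ.differentiableAt (by simp)) (mlieBracket 𝓘(ℝ, E) V W x)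
  refine h1.trans (congrArg _ ?_)
  have h2 : (mlieBracket 𝓘(ℝ, E) V W x : E) = (tder 𝓘(ℝ, E) 𝓘(ℝ, E) φ x).inverse
      (lieBracket ℝ (T V) (T W) (φ x)) := by
    rw [← mlieBracketWithin_univ, mlieBracketWithin_apply]
    have hu : (extChartAt 𝓘(ℝ, E) x).symm ⁻¹' univ ∩ range 𝓘(ℝ, E) = univ := by simp
    rw [hu]
    exact congrArg (tder 𝓘(ℝ, E) 𝓘(ℝ, E) φ x).inverse
      (congrFun (lieBracketWithin_univ (V := T V) (W := T W)) _)
  rw [h2]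
  exact (isInvertible_mfderiv_extChartAt (I := 𝓘(ℝ, E)) (mem_extChartAt_source x)).self_apply_inverse
    _

end ManifoldGeneralities

theorem tder_prodMk {E E' E'' H H' H'' : Type*} [NormedAddCommGroup E] [NormedSpace ℝ E]
    [NormedAddCommGroup E'] [NormedSpace ℝ E'] [NormedAddCommGroup E''] [NormedSpace ℝ E'']
    [TopologicalSpace H] [TopologicalSpace H'] [TopologicalSpace H'']
    {I : ModelWithCorners ℝ E H} {I' : ModelWithCorners ℝ E' H'} {I'' : ModelWithCorners ℝ E'' H''}
    {N N' N'' : Type*} [TopologicalSpace N] [ChartedSpace H N] [TopologicalSpace N']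
    [ChartedSpace H' N'] [TopologicalSpace N''] [ChartedSpace H'' N'']
    {f : N → N'} {g : N → N''} {x : N}
    (hf : MDifferentiableAt I I' f x) (hg : MDifferentiableAt I I'' g x) (v : E) :
    tder I (I'.prod I'') (fun y => (f y, g y)) x v = (tder I I' f x v, tder I I'' g x v) :=
  DFunLike.congr_fun (mfderiv_prodMk hf hg) v

/-- The derivative within a set determines the derivative along maps into that set. -/
theorem tder_comp_mfderivWithin {E E' E'' H H' H'' : Type*} [NormedAddCommGroup E] [NormedSpace ℝ E]
    [NormedAddCommGroup E'] [NormedSpace ℝ E'] [NormedAddCommGroup E''] [NormedSpace ℝ E'']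
    [TopologicalSpace H] [TopologicalSpace H'] [TopologicalSpace H'']
    {I : ModelWithCorners ℝ E H} {I' : ModelWithCorners ℝ E' H'} {I'' : ModelWithCorners ℝ E'' H''}
    {N N' N'' : Type*} [TopologicalSpace N] [ChartedSpace H N] [TopologicalSpace N']
    [ChartedSpace H' N'] [TopologicalSpace N''] [ChartedSpace H'' N'']
    {k : N' → N''} {S : Set N'} {y : N'} (hk : MDifferentiableWithinAt I' I'' k S y)
    {s : N → N'} {p : N} (hs : MDifferentiableAt I I' s p) (hy : s p = y)
    (hS : ∀ᶠ q in 𝓝 p, s q ∈ S) (u : E) :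
    tder I I'' (fun q => k (s q)) p u =
      (show E'' from (mfderivWithin I' I'' k S y : E' → E'') (tder I I' s p u)) := by
  subst hy
  -- The composite is differentiated within `s ⁻¹' S`, which `hS` makes a neighbourhood of `p`; the
  -- result is therefore an unrestricted derivative.
  have h1 := hk.hasMFDerivWithinAt.comp p (hs.hasMFDerivAt.hasMFDerivWithinAt (s := s ⁻¹' S))
    subset_rfl
  exact DFunLike.congr_fun (h1.hasMFDerivAt hS).mfderiv u

/-- For fields whose computed base point is only provably equal to the intended one, such as `i (i
h)` and `h`. -/
theorem totalSpace_tangent_ext {E : Type*} [NormedAddCommGroup E] [NormedSpace ℝ E]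
    {H : Type*} [TopologicalSpace H] {I : ModelWithCorners ℝ E H}
    {N : Type*} [TopologicalSpace N] [ChartedSpace H N] {y z : N} (h : y = z)
    {a : TangentSpace I y} {b : TangentSpace I z} (hab : (a : E) = b) :
    (⟨y, a⟩ : TangentBundle I N) = ⟨z, b⟩ := by
  subst h; exact congrArg _ hab

theorem contMDiffAt_tder_apply {E F : Type*} [NormedAddCommGroup E] [NormedSpace ℝ E]
    [NormedAddCommGroup F] [NormedSpace ℝ F] {H : Type*} [TopologicalSpace H]
    {I : ModelWithCorners ℝ E H} {N : Type*} [TopologicalSpace N] [ChartedSpace H N]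
    [IsManifold I ∞ N] {f : N → F} {V : ∀ y : N, TangentSpace I y} {x : N}
    (hf : ContMDiffAt I 𝓘(ℝ, F) ∞ f x)
    (hV : ContMDiffAt I I.tangent ∞ (fun y => (⟨y, V y⟩ : TangentBundle I N)) x) :
    ContMDiffAt I 𝓘(ℝ, F) ∞ (fun y => tder I 𝓘(ℝ, F) f y (V y)) x := by
  have h1 := ContMDiffAt.clm_apply_of_inCoordinates
    (ContMDiffAt.mfderiv_const (m := ∞) hf (by simp)) hV hf
  exact ((contMDiff_snd_tangentBundle_modelSpace F 𝓘(ℝ, F)).of_le le_top).contMDiffAt.comp x h1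

/-- Symmetry of mixed partial derivatives. -/
theorem fderiv_partial_comm {F : ℝ × ℝ → ℝ} (hF : ContDiffAt ℝ ∞ F (0, 0)) {a b : ℝ → ℝ}
    (ha : ∀ t, fderiv ℝ (fun s => F (t, s)) 0 1 = a t)
    (hb : ∀ s, fderiv ℝ (fun t => F (t, s)) 0 1 = b s) :
    fderiv ℝ a 0 1 = fderiv ℝ b 0 1 := by
  have h2 : ContDiffAt ℝ 2 F (0, 0) := hF.of_le (by norm_cast)
  have hd : ∀ᶠ p in 𝓝 ((0 : ℝ), (0 : ℝ)), DifferentiableAt ℝ F p :=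
    (h2.eventually (by simp)).mono fun p hp => hp.differentiableAt (by simp)
  have hF' : HasFDerivAt (fderiv ℝ F) (fderiv ℝ (fderiv ℝ F) (0, 0)) (0, 0) :=
    ((h2.fderiv_right (m := 1) (by norm_num)).differentiableAt one_ne_zero).hasFDerivAt
  have hl : ∀ t : ℝ, HasFDerivAt (fun t : ℝ => (t, (0 : ℝ))) (ContinuousLinearMap.inl ℝ ℝ ℝ) t :=
    fun t => (ContinuousLinearMap.inl ℝ ℝ ℝ).hasFDerivAt
  have hr : ∀ t : ℝ, HasFDerivAt (fun t : ℝ => ((0 : ℝ), t)) (ContinuousLinearMap.inr ℝ ℝ ℝ) t :=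
    fun t => (ContinuousLinearMap.inr ℝ ℝ ℝ).hasFDerivAt
  have ea : a =ᶠ[𝓝 0] fun t => fderiv ℝ F (t, 0) (0, 1) := by
    filter_upwards [(hl 0).continuousAt.eventually hd] with t ht
    have h3 : HasFDerivAt (fun s : ℝ => (t, s)) (ContinuousLinearMap.inr ℝ ℝ ℝ) 0 :=
      hasFDerivAt_prodMk_right t 0
    have h4 : HasFDerivAt (fun s => F (t, s)) _ 0 := ht.hasFDerivAt.comp (0 : ℝ) h3
    rw [← ha t, h4.fderiv]
    simp
  have eb : b =ᶠ[𝓝 0] fun s => fderiv ℝ F (0, s) (1, 0) := by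
    filter_upwards [(hr 0).continuousAt.eventually hd] with s hs
    have h3 : HasFDerivAt (fun t : ℝ => (t, s)) (ContinuousLinearMap.inl ℝ ℝ ℝ) 0 :=
      hasFDerivAt_prodMk_left 0 s
    have h4 : HasFDerivAt (fun t => F (t, s)) _ 0 :=
      HasFDerivAt.comp (f := fun t : ℝ => (t, s)) (0 : ℝ) hs.hasFDerivAt h3
    rw [← hb s, h4.fderiv]
    simp
  have e1 := (HasFDerivAt.comp (f := fun t : ℝ => (t, (0 : ℝ))) (0 : ℝ) hF' (hl 0)).clm_apply
      (hasFDerivAt_const ((0 : ℝ), (1 : ℝ)) (0 : ℝ))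
  have e2 := (HasFDerivAt.comp (f := fun t : ℝ => ((0 : ℝ), t)) (0 : ℝ) hF' (hr 0)).clm_apply
      (hasFDerivAt_const ((1 : ℝ), (0 : ℝ)) (0 : ℝ))
  simp only [comp_apply] at e1 e2
  rw [ea.fderiv_eq, eb.fderiv_eq, e1.fderiv, e2.fderiv]
  simpa using (h2.isSymmSndFDerivAt (by simp)).eq (1, 0) (0, 1)

/-! ### Coordinates on the source fibres near a unit -/

namespace LieGroupoid

variable {EG : Type u} {EM : Type v} {G : Type w} {M : Type t}
  [NormedAddCommGroup EG] [NormedSpace ℝ EG] [NormedAddCommGroup EM] [NormedSpace ℝ EM]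
  [TopologicalSpace G] [ChartedSpace EG G] [TopologicalSpace M] [ChartedSpace EM M]
  (𝒢 : LieGroupoid EG EM G M)
  [FiniteDimensional ℝ EG] [FiniteDimensional ℝ EM]
  [IsManifold 𝓘(ℝ, EG) ∞ G] [IsManifold 𝓘(ℝ, EM) ∞ M]

/-- The inclusion of `A_x G` in the model space. -/
def inclModel (x : M) : 𝒢.A x →L[ℝ] EG := 𝒢.incl x

/-- The derivative of left translation, with values in the model space. -/
def leftModel (g : G) : 𝒢.A (𝒢.tgt g) →L[ℝ] EG := 𝒢.dLeft g

/-- The derivative of `k ↦ k⁻¹ h`, with values in the model space. -/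
def rightModel (h : G) : 𝒢.A (𝒢.src h) →L[ℝ] EG := 𝒢.dRightInv h

/-- The left-invariant vector field of a section, with values in the model space. -/
def leftField (X : ∀ x, 𝒢.A x) (g : G) : EG := 𝒢.leftModel g (X (𝒢.tgt g))

/-- The right-invariant vector field `h ↦ T (r_h ∘ i) (X (α h))` of a section. -/
def rightField (X : ∀ x, 𝒢.A x) (h : G) : EG := 𝒢.rightModel h (X (𝒢.src h))

theorem tder_src_inclModel (x : M) (v : 𝒢.A x) :
    tder 𝓘(ℝ, EG) 𝓘(ℝ, EM) 𝒢.src (𝒢.unit x) (𝒢.inclModel x v) = 0 := 𝒢.mfderiv_src_incl x v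

/-- The function `frameCompl x₀`, read in the preferred chart around `ε x₀`: it restricts to
coordinates on the `α`-fibres near `ε x₀`. -/
def fibreCoord (x₀ : M) (g : G) : AModel EG EM :=
  𝒢.frameCompl x₀ (extChartAt 𝓘(ℝ, EG) (𝒢.unit x₀) g)

theorem contMDiffAt_fibreCoord {x₀ : M} {g : G} (hg : g ∈ (chartAt EG (𝒢.unit x₀)).source) :
    ContMDiffAt 𝓘(ℝ, EG) 𝓘(ℝ, AModel EG EM) ∞ (𝒢.fibreCoord x₀) g :=
  (𝒢.frameCompl x₀).contMDiff.contMDiffAt.comp g (contMDiffAt_extChartAt' hg)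

/-- The tangent trivialisation in `toCoord` is the derivative of the chart used in `fibreCoord`, so
the bundle coordinates of `AG` are derivatives of functions on `G`. -/
theorem tder_fibreCoord_inclModel {x₀ x : M} (hx : x ∈ 𝒢.frameDom x₀) (v : 𝒢.A x) :
    tder 𝓘(ℝ, EG) 𝓘(ℝ, AModel EG EM) (𝒢.fibreCoord x₀) (𝒢.unit x) (𝒢.inclModel x v) =
      𝒢.toCoord x₀ x v := by
  have h1 := tder_comp (I := 𝓘(ℝ, EG)) (I' := 𝓘(ℝ, EG)) (I'' := 𝓘(ℝ, AModel EG EM))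
    (x := 𝒢.unit x) (f := extChartAt 𝓘(ℝ, EG) (𝒢.unit x₀))
    (g := 𝒢.frameCompl x₀) rfl (𝒢.frameCompl x₀).mdifferentiableAt
    (mdifferentiableAt_extChartAt hx.1.1) (𝒢.inclModel x v)
  refine h1.trans ?_
  rw [tder_eq_fderiv, ContinuousLinearMap.fderiv]
  have e1 : (𝒢.tanTriv x₀).continuousLinearMapAt ℝ (𝒢.unit x) =
      mfderiv 𝓘(ℝ, EG) 𝓘(ℝ, EG) (extChartAt 𝓘(ℝ, EG) (𝒢.unit x₀)) (𝒢.unit x) :=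
    TangentBundle.continuousLinearMapAt_trivializationAt hx.1.1
  exact congrArg (𝒢.frameCompl x₀) (DFunLike.congr_fun e1 (𝒢.incl x v)).symm

/-- Near `ε x₀`, the source map and `fibreCoord x₀` form a system of coordinates. -/
theorem exists_fibreCoord_inverse (x₀ : M) : ∃ σ : M × AModel EG EM → G,
    ContMDiffAt (𝓘(ℝ, EM).prod 𝓘(ℝ, AModel EG EM)) 𝓘(ℝ, EG) ∞ σ
      (x₀, 𝒢.fibreCoord x₀ (𝒢.unit x₀)) ∧
    (∀ᶠ p in 𝓝 (x₀, 𝒢.fibreCoord x₀ (𝒢.unit x₀)), 𝒢.src (σ p) = p.1) ∧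
    ∀ᶠ k in 𝓝 (𝒢.unit x₀), σ (𝒢.src k, 𝒢.fibreCoord x₀ k) = k := by
  let c := extChartAt 𝓘(ℝ, EG) (𝒢.unit x₀)
  let d := extChartAt 𝓘(ℝ, EM) x₀
  let φ : EG → EM × AModel EG EM := fun y => (d (𝒢.src (c.symm y)), 𝒢.frameCompl x₀ y)
  have hsrc := 𝒢.contDiffAt_srcLoc (𝒢.mem_frameDom₀ x₀)
  have hφ : ContDiffAt ℝ ∞ φ (c (𝒢.unit x₀)) :=
    hsrc.prodMk (𝒢.frameCompl x₀).contDiff.contDiffAt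
  -- Membership in `frameDom` says exactly that the derivative of `φ` is invertible here, so the
  -- inverse function theorem applies.
  obtain ⟨e, he⟩ := (𝒢.mem_frameDom x₀).2
  have hφ' : HasFDerivAt φ (e : EG →L[ℝ] EM × AModel EG EM) (c (𝒢.unit x₀)) := by
    rw [he]
    exact (hsrc.differentiableAt (by simp)).hasFDerivAt.prodMk (𝒢.frameCompl x₀).hasFDerivAt
  have hstrict := hφ.hasStrictFDerivAt' hφ' (by simp)
  let ψ := hφ.localInverse hφ' (by simp)
  have hψ : ContDiffAt ℝ ∞ ψ (φ (c (𝒢.unit x₀))) := hφ.to_localInverse hφ' (by simp)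
  have hψ0 : ψ (φ (c (𝒢.unit x₀))) = c (𝒢.unit x₀) := hφ.localInverse_apply_image hφ' (by simp)
  have hl : ∀ᶠ y in 𝓝 (c (𝒢.unit x₀)), ψ (φ y) = y := hstrict.eventually_left_inverse
  have hr : ∀ᶠ p in 𝓝 (φ (c (𝒢.unit x₀))), φ (ψ p) = p := hstrict.eventually_right_inverse
  have hc0 : c.symm (c (𝒢.unit x₀)) = 𝒢.unit x₀ := extChartAt_to_inv _
  have hφ0 : φ (c (𝒢.unit x₀)) = (d x₀, 𝒢.fibreCoord x₀ (𝒢.unit x₀)) := by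
    change (d (𝒢.src (c.symm (c (𝒢.unit x₀)))), _) = _
    rw [hc0, 𝒢.src_unit]; rfl
  have hθ : ContMDiffAt (𝓘(ℝ, EM).prod 𝓘(ℝ, AModel EG EM)) 𝓘(ℝ, EM × AModel EG EM) ∞
      (fun p : M × AModel EG EM => (d p.1, p.2)) (x₀, 𝒢.fibreCoord x₀ (𝒢.unit x₀)) :=
    ContMDiffAt.prodMk_space
      (ContMDiffAt.comp (x₀, _) (contMDiffAt_extChartAt (I := 𝓘(ℝ, EM)) (x := x₀)) contMDiffAt_fst)
      contMDiffAt_snd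
  have hψθ : ContMDiffAt (𝓘(ℝ, EM).prod 𝓘(ℝ, AModel EG EM)) 𝓘(ℝ, EG) ∞
      (fun p : M × AModel EG EM => ψ (d p.1, p.2)) (x₀, 𝒢.fibreCoord x₀ (𝒢.unit x₀)) :=
    ContMDiffAt.comp_of_eq (hψ.contMDiffAt) hθ hφ0.symm
  have hσ : ContMDiffAt (𝓘(ℝ, EM).prod 𝓘(ℝ, AModel EG EM)) 𝓘(ℝ, EG) ∞
      (fun p : M × AModel EG EM => c.symm (ψ (d p.1, p.2)))
      (x₀, 𝒢.fibreCoord x₀ (𝒢.unit x₀)) :=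
    ContMDiffAt.comp_of_eq ((contMDiffOn_extChartAt_symm (𝒢.unit x₀)).contMDiffAt
      (extChartAt_target_mem_nhds _)) hψθ (by rw [← hφ0]; exact hψ0)
  refine ⟨fun p => c.symm (ψ (d p.1, p.2)), hσ, ?_, ?_⟩
  · have h1 : ∀ᶠ p in 𝓝 (x₀, 𝒢.fibreCoord x₀ (𝒢.unit x₀)), φ (ψ (d p.1, p.2)) = (d p.1, p.2) := by
      rw [hφ0] at hr
      exact hθ.continuousAt.eventually hr
    have h2 : ∀ᶠ p in 𝓝 (x₀, 𝒢.fibreCoord x₀ (𝒢.unit x₀)), p.1 ∈ d.source :=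
      continuousAt_fst.eventually (extChartAt_source_mem_nhds x₀)
    have h3 : ∀ᶠ p in 𝓝 (x₀, 𝒢.fibreCoord x₀ (𝒢.unit x₀)),
        𝒢.src (c.symm (ψ (d p.1, p.2))) ∈ d.source := by
      refine ((𝒢.contMDiff_src.continuous.continuousAt).comp hσ.continuousAt).eventually ?_
      have : 𝒢.src (c.symm (ψ (d x₀, 𝒢.fibreCoord x₀ (𝒢.unit x₀)))) = x₀ := by
        rw [← hφ0, hψ0, hc0, 𝒢.src_unit]
      simp only [comp_apply]
      rw [this]
      exact extChartAt_source_mem_nhds x₀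
    filter_upwards [h1, h2, h3] with p hp1 hp2 hp3
    exact d.injOn hp3 hp2 (congrArg Prod.fst hp1)
  · have h1 : ∀ᶠ k in 𝓝 (𝒢.unit x₀), ψ (φ (c k)) = c k :=
      (continuousAt_extChartAt (I := 𝓘(ℝ, EG)) (𝒢.unit x₀)).eventually hl
    filter_upwards [h1, extChartAt_source_mem_nhds (I := 𝓘(ℝ, EG)) (𝒢.unit x₀)] with k hk1 hk2
    have h2 : c.symm (c k) = k := c.left_inv hk2
    have h3 : φ (c k) = (d (𝒢.src k), 𝒢.fibreCoord x₀ k) := by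
      change (d (𝒢.src (c.symm (c k))), _) = _
      rw [h2]; rfl
    change c.symm (ψ (d (𝒢.src k), 𝒢.fibreCoord x₀ k)) = k
    rw [← h3, hk1, h2]

/-! ### Groupoid algebra and derivatives of translations -/

theorem inv_inv (g : G) : 𝒢.inv (𝒢.inv g) = g := by
  have h1 := 𝒢.mul_assoc (𝒢.inv (𝒢.inv g)) (𝒢.inv g) g (by rw [𝒢.tgt_inv]) (𝒢.tgt_inv g)
  rw [𝒢.inv_mul, 𝒢.inv_mul, 𝒢.tgt_inv, 𝒢.unit_mul] at h1
  have h2 := 𝒢.mul_unit (𝒢.inv (𝒢.inv g))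
  rw [𝒢.tgt_inv, 𝒢.src_inv] at h2
  exact h2.symm.trans h1

theorem inv_mul_cancel_left {g h : G} (e : 𝒢.tgt g = 𝒢.src h) :
    𝒢.mul (𝒢.inv g) (𝒢.mul g h) = h := by
  rw [𝒢.mul_assoc _ _ _ (𝒢.tgt_inv g) e, 𝒢.inv_mul, e, 𝒢.unit_mul]

theorem mul_inv_rev {g h : G} (e : 𝒢.tgt g = 𝒢.src h) :
    𝒢.inv (𝒢.mul g h) = 𝒢.mul (𝒢.inv h) (𝒢.inv g) := by
  have e1 : 𝒢.tgt (𝒢.inv h) = 𝒢.src (𝒢.inv g) := by rw [𝒢.tgt_inv, 𝒢.src_inv, e]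
  have h1 := 𝒢.inv_mul_cancel_left (g := 𝒢.inv (𝒢.mul g h)) (h := 𝒢.inv (𝒢.mul g h))
  have h2 : 𝒢.mul (𝒢.mul g h) (𝒢.mul (𝒢.inv h) (𝒢.inv g)) = 𝒢.unit (𝒢.src g) := by
    rw [𝒢.mul_assoc _ _ _ (by rw [𝒢.tgt_mul _ _ e, 𝒢.src_inv]) e1,
      ← 𝒢.mul_assoc _ _ _ e (by rw [𝒢.src_inv]), 𝒢.mul_inv, ← e, 𝒢.mul_unit, 𝒢.mul_inv]
  have e2 : 𝒢.tgt (𝒢.mul g h) = 𝒢.src (𝒢.mul (𝒢.inv h) (𝒢.inv g)) := by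
    rw [𝒢.tgt_mul _ _ e, 𝒢.src_mul _ _ e1, 𝒢.src_inv]
  have h3 := 𝒢.inv_mul_cancel_left e2
  rw [h2] at h3
  have h4 := 𝒢.mul_unit (𝒢.inv (𝒢.mul g h))
  rw [𝒢.tgt_inv, 𝒢.src_mul _ _ e] at h4
  exact h4.symm.trans h3

section

variable {E H P : Type*} [NormedAddCommGroup E] [NormedSpace ℝ E] [TopologicalSpace H]
  {I : ModelWithCorners ℝ E H} [TopologicalSpace P] [ChartedSpace H P]

/-- Multiplication is smooth only within the composable pairs; composability near `p` makes the
pulled-back set a neighbourhood and removes the restriction. -/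
theorem contMDiffAt_mul {a b : P → G} {p : P} (ha : ContMDiffAt I 𝓘(ℝ, EG) ∞ a p)
    (hb : ContMDiffAt I 𝓘(ℝ, EG) ∞ b p) (hab : ∀ᶠ q in 𝓝 p, 𝒢.tgt (a q) = 𝒢.src (b q)) :
    ContMDiffAt I 𝓘(ℝ, EG) ∞ (fun q => 𝒢.mul (a q) (b q)) p := by
  have h1 := 𝒢.contMDiffOn_mul (a p, b p) hab.self_of_nhds
  have h2 := h1.comp' p (ha.prodMk hb).contMDiffWithinAt (s := univ) (f := fun q => (a q, b q))
  exact h2.contMDiffAt (by rw [univ_inter]; exact hab)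

/-- The derivative of left translation along the `α`-fibre. -/
theorem tder_mul_left {s : P → G} {p : P} {g : G} (hs : MDifferentiableAt I 𝓘(ℝ, EG) s p)
    (hp : s p = 𝒢.unit (𝒢.tgt g)) (hsrc : ∀ᶠ q in 𝓝 p, 𝒢.src (s q) = 𝒢.tgt g) {u : E}
    {v : 𝒢.A (𝒢.tgt g)} (hv : tder I 𝓘(ℝ, EG) s p u = 𝒢.inclModel _ v) :
    tder I 𝓘(ℝ, EG) (fun q => 𝒢.mul g (s q)) p u = 𝒢.leftModel g v := by
  have h1 : ContMDiffOn 𝓘(ℝ, EG) 𝓘(ℝ, EG) ∞ (fun k => 𝒢.mul g k) {k | 𝒢.src k = 𝒢.tgt g} :=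
    𝒢.contMDiffOn_mul.comp (contMDiff_const.prodMk contMDiff_id).contMDiffOn fun k hk => hk.symm
  have h2 := tder_comp_mfderivWithin
    ((h1 (𝒢.unit (𝒢.tgt g)) (𝒢.src_unit _)).mdifferentiableWithinAt (by simp)) hs hp hsrc u
  rw [hv] at h2
  exact h2

/-- The derivative of `k ↦ k⁻¹ h` along the `α`-fibre. -/
theorem tder_inv_mul {s : P → G} {p : P} {h : G} (hs : MDifferentiableAt I 𝓘(ℝ, EG) s p)
    (hp : s p = 𝒢.unit (𝒢.src h)) (hsrc : ∀ᶠ q in 𝓝 p, 𝒢.src (s q) = 𝒢.src h) {u : E}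
    {v : 𝒢.A (𝒢.src h)} (hv : tder I 𝓘(ℝ, EG) s p u = 𝒢.inclModel _ v) :
    tder I 𝓘(ℝ, EG) (fun q => 𝒢.mul (𝒢.inv (s q)) h) p u = 𝒢.rightModel h v := by
  have h1 : ContMDiffOn 𝓘(ℝ, EG) 𝓘(ℝ, EG) ∞ (fun k => 𝒢.mul (𝒢.inv k) h)
      {k | 𝒢.src k = 𝒢.src h} :=
    𝒢.contMDiffOn_mul.comp (𝒢.contMDiff_inv.prodMk contMDiff_const).contMDiffOn fun k hk => by
      simpa [𝒢.tgt_inv] using hk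
  have h2 := tder_comp_mfderivWithin
    ((h1 (𝒢.unit (𝒢.src h)) (𝒢.src_unit _)).mdifferentiableWithinAt (by simp)) hs hp hsrc u
  rw [hv] at h2
  exact h2

end

/-- Differentiate `σ (α k, fibreCoord k) = k` at `ε x` along `A_x G`: the first argument contributes
nothing, since `Tα` kills these vectors, and the second contributes `toCoord`. This turns the
inclusion of `A_x G` into an ordinary derivative along a parametrised fibre. -/
theorem eventually_incl_eq_tder {x₀ : M} {σ : M × AModel EG EM → G}
    (hσ : ContMDiffAt (𝓘(ℝ, EM).prod 𝓘(ℝ, AModel EG EM)) 𝓘(ℝ, EG) ∞ σ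
      (x₀, 𝒢.fibreCoord x₀ (𝒢.unit x₀)))
    (h : ∀ᶠ k in 𝓝 (𝒢.unit x₀), σ (𝒢.src k, 𝒢.fibreCoord x₀ k) = k) :
    ∀ᶠ x in 𝓝 x₀, ∀ v : 𝒢.A x, 𝒢.inclModel x v =
      tder 𝓘(ℝ, AModel EG EM) 𝓘(ℝ, EG) (fun w => σ (x, w)) (𝒢.fibreCoord x₀ (𝒢.unit x))
        (𝒢.toCoord x₀ x v) := by
  have hq := 𝒢.contMDiffAt_fibreCoord (mem_chart_source EG (𝒢.unit x₀))
  have hu : ContinuousAt 𝒢.unit x₀ := 𝒢.contMDiff_unit.continuous.continuousAt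
  have h1 : ∀ᶠ x in 𝓝 x₀, MDifferentiableAt (𝓘(ℝ, EM).prod 𝓘(ℝ, AModel EG EM)) 𝓘(ℝ, EG) σ
      (x, 𝒢.fibreCoord x₀ (𝒢.unit x)) := by
    have h2 := (contMDiffAt_iff_contMDiffAt_nhds (n := 1) (by norm_num)).1 (hσ.of_le (by simp))
    have h3 : ContinuousAt (fun x => (x, 𝒢.fibreCoord x₀ (𝒢.unit x))) x₀ :=
      continuousAt_id.prodMk (ContinuousAt.comp (g := 𝒢.fibreCoord x₀) hq.continuousAt hu)
    filter_upwards [h3.eventually h2] with x hx using hx.mdifferentiableAt (by simp)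
  filter_upwards [hu.eventually h.eventually_nhds, h1,
    (𝒢.isOpen_frameDom x₀).mem_nhds (𝒢.mem_frameDom x₀)] with x hx1 hx2 hx3 v
  have hs := 𝒢.contMDiff_src.mdifferentiable (by simp) (𝒢.unit x)
  have hqx := (𝒢.contMDiffAt_fibreCoord hx3.1.1).mdifferentiableAt (by simp)
  have e1 : tder 𝓘(ℝ, EG) 𝓘(ℝ, EG) (fun k => σ (𝒢.src k, 𝒢.fibreCoord x₀ k)) (𝒢.unit x)
      (𝒢.inclModel x v) = 𝒢.inclModel x v := by
    rw [tder_congr hx1]; exact tder_id _ _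
  rw [tder_comp (y := (x, 𝒢.fibreCoord x₀ (𝒢.unit x))) (by rw [𝒢.src_unit]) hx2
    (hs.prodMk hqx), tder_prodMk hs hqx, 𝒢.tder_fibreCoord_inclModel hx3] at e1
  rw [𝒢.tder_src_inclModel] at e1
  rw [← e1, tder_comp (I := 𝓘(ℝ, AModel EG EM)) (f := fun w => (x, w)) rfl hx2
    (mdifferentiableAt_const.prodMk mdifferentiableAt_id),
    tder_prodMk (f := fun _ => x) (g := fun w => w) mdifferentiableAt_const mdifferentiableAt_id,
    tder_const, tder_id]
  rfl

/-! ### Curves in the source fibres; smoothness of invariant vector fields -/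

/-- A smooth curve in the `α`-fibre through `ε x` with velocity `v`. -/
structure IsFibreCurve (x : M) (v : 𝒢.A x) (c : ℝ → G) : Prop where
  contMDiffAt : ContMDiffAt 𝓘(ℝ, ℝ) 𝓘(ℝ, EG) ∞ c 0
  zero : c 0 = 𝒢.unit x
  src_eq : ∀ t, 𝒢.src (c t) = x
  tder_one : tder 𝓘(ℝ, ℝ) 𝓘(ℝ, EG) c 0 1 = 𝒢.inclModel x v

/-- Take a straight line in the fibre coordinates. With such curves, derivatives of translations,
which exist only within fibres, become derivatives of functions of a real variable, and groupoid
identities can be differentiated directly. -/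
theorem exists_isFibreCurve (x : M) (v : 𝒢.A x) : ∃ c, 𝒢.IsFibreCurve x v c := by
  classical
  obtain ⟨σ, hσ, hsrc, hinv⟩ := 𝒢.exists_fibreCoord_inverse x
  have hv := (𝒢.eventually_incl_eq_tder hσ hinv).self_of_nhds v
  let q := 𝒢.fibreCoord x (𝒢.unit x)
  let w := 𝒢.toCoord x x v
  let l : ℝ → AModel EG EM := fun t => q + t • w
  have hl : ContDiff ℝ ∞ l := contDiff_const.add (contDiff_id.smul contDiff_const)
  have hl0 : l 0 = q := by simp [l]
  let c₀ : ℝ → G := fun t => σ (x, l t)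
  have hσx : ContMDiffAt 𝓘(ℝ, AModel EG EM) 𝓘(ℝ, EG) ∞ (fun w => σ (x, w)) q :=
    ContMDiffAt.comp q hσ (contMDiffAt_const.prodMk contMDiffAt_id)
  have hc₀ : ContMDiffAt 𝓘(ℝ, ℝ) 𝓘(ℝ, EG) ∞ c₀ 0 :=
    ContMDiffAt.comp_of_eq (g := fun w => σ (x, w)) hσx hl.contMDiff.contMDiffAt hl0
  have hs₀ : ∀ᶠ t in 𝓝 (0 : ℝ), 𝒢.src (c₀ t) = x := by
    have h1 : ContinuousAt (fun t => (x, l t)) 0 :=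
      continuousAt_const.prodMk hl.continuous.continuousAt
    have h2 : ∀ᶠ p in 𝓝 (x, l 0), 𝒢.src (σ p) = p.1 := by rw [hl0]; exact hsrc
    exact h1.eventually h2
  -- `c₀` lies in the fibre only for small `t`. Replacing it by the unit elsewhere keeps `c` in the
  -- fibre for every `t`, so that products with it are always composable.
  let c : ℝ → G := fun t => if 𝒢.src (c₀ t) = x then c₀ t else 𝒢.unit x
  have hc : c =ᶠ[𝓝 0] c₀ := hs₀.mono fun t ht => if_pos ht
  have h00 : c₀ 0 = 𝒢.unit x := by
    have := hinv.self_of_nhds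
    rw [𝒢.src_unit] at this
    change σ (x, l 0) = _
    rw [hl0]; exact this
  refine ⟨c, hc₀.congr_of_eventuallyEq hc, hc.self_of_nhds.trans h00, fun t => ?_, ?_⟩
  · by_cases ht : 𝒢.src (c₀ t) = x
    · simp [c, ht]
    · simp [c, ht, 𝒢.src_unit]
  · rw [tder_congr hc, hv, tder_comp (I := 𝓘(ℝ, ℝ)) hl0 (hσx.mdifferentiableAt (by simp))
      (hl.contMDiff.mdifferentiable (by simp) 0)]
    congr 1
    rw [tder_eq_fderiv]
    have : HasDerivAt l w 0 := by
      have h1 := ((hasDerivAt_id (0 : ℝ)).smul_const w).const_add q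
      rw [one_smul] at h1
      exact h1
    rw [this.hasFDerivAt.fderiv]
    simp [w]

theorem contMDiffAt_toCoord {X : ∀ x, 𝒢.A x} (hX : 𝒢.SmoothSection X) (x₀ : M) :
    ContMDiffAt 𝓘(ℝ, EM) 𝓘(ℝ, AModel EG EM) ∞ (fun x => 𝒢.toCoord x₀ x (X x)) x₀ :=
  (contMDiffAt_section x₀).1 (hX x₀)

/-- Near `g₀` the field is the partial derivative of `(g, w) ↦ g · σ (β g, w)` in `w`, at the
coordinate of the unit and in the direction of the coordinates of `X (β g)`. That map is jointly
smooth, whereas the derivative within a fibre used to define the field shows no dependence on `g`.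
-/
theorem contMDiff_leftField {X : ∀ x, 𝒢.A x} (hX : 𝒢.SmoothSection X) :
    ContMDiff 𝓘(ℝ, EG) 𝓘(ℝ, EG).tangent ∞
      (fun g => (⟨g, 𝒢.leftField X g⟩ : TangentBundle 𝓘(ℝ, EG) G)) := by
  intro g₀
  obtain ⟨σ, hσ, hsrc, hinv⟩ := 𝒢.exists_fibreCoord_inverse (𝒢.tgt g₀)
  let x₀ := 𝒢.tgt g₀
  let q : G → AModel EG EM := fun g => 𝒢.fibreCoord x₀ (𝒢.unit (𝒢.tgt g))
  let f : G → AModel EG EM → G := fun g w => 𝒢.mul g (σ (𝒢.tgt g, w))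
  have hu : ContMDiff 𝓘(ℝ, EG) 𝓘(ℝ, EG) ∞ (fun g => 𝒢.unit (𝒢.tgt g)) :=
    𝒢.contMDiff_unit.comp 𝒢.contMDiff_tgt
  have hq : ContMDiffAt 𝓘(ℝ, EG) 𝓘(ℝ, AModel EG EM) ∞ q g₀ :=
    ContMDiffAt.comp (g := 𝒢.fibreCoord x₀) g₀
      (𝒢.contMDiffAt_fibreCoord (mem_chart_source EG (𝒢.unit x₀))) (hu g₀)
  have hθ : ContMDiffAt (𝓘(ℝ, EG).prod 𝓘(ℝ, AModel EG EM)) (𝓘(ℝ, EM).prod 𝓘(ℝ, AModel EG EM)) ∞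
      (fun p : G × AModel EG EM => (𝒢.tgt p.1, p.2)) (g₀, q g₀) :=
    ContMDiffAt.prodMk ((𝒢.contMDiff_tgt g₀).comp (g₀, q g₀) contMDiffAt_fst) contMDiffAt_snd
  have hf : ContMDiffAt (𝓘(ℝ, EG).prod 𝓘(ℝ, AModel EG EM)) 𝓘(ℝ, EG) ∞ (uncurry f) (g₀, q g₀) := by
    refine 𝒢.contMDiffAt_mul contMDiffAt_fst (ContMDiffAt.comp (g₀, q g₀) hσ hθ) ?_
    exact (hθ.continuousAt.eventually hsrc).mono fun p hp => hp.symm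
  have hd := ContMDiffAt.mfderiv (m := ∞) f q hf hq (by simp)
  have htgt : ContMDiffAt 𝓘(ℝ, EG) 𝓘(ℝ, EM) ∞ 𝒢.tgt g₀ := 𝒢.contMDiff_tgt g₀
  have hc : ContMDiffAt 𝓘(ℝ, EG) 𝓘(ℝ, AModel EG EM) ∞
      (fun g => 𝒢.toCoord x₀ (𝒢.tgt g) (X (𝒢.tgt g))) g₀ :=
    ContMDiffAt.comp (g := fun x => 𝒢.toCoord x₀ x (X x)) g₀ (𝒢.contMDiffAt_toCoord hX x₀) htgt
  have hv : ContMDiffAt 𝓘(ℝ, EG) 𝓘(ℝ, AModel EG EM).tangent ∞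
      (fun g => (⟨q g, 𝒢.toCoord x₀ (𝒢.tgt g) (X (𝒢.tgt g))⟩ :
        TangentBundle 𝓘(ℝ, AModel EG EM) (AModel EG EM))) g₀ := by
    rw [contMDiffAt_totalSpace]
    refine ⟨hq, ?_⟩
    simp only [trivializationAt_model_space_apply]
    exact hc
  have hb : ContMDiffAt 𝓘(ℝ, EG) 𝓘(ℝ, EG) ∞ (fun g => f g (q g)) g₀ :=
    ContMDiffAt.comp g₀ (g := uncurry f) (f := fun g => (g, q g)) hf (contMDiffAt_id.prodMk hq)
  have key := ContMDiffAt.clm_apply_of_inCoordinates hd hv hb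
  refine key.congr_of_eventuallyEq ?_
  have htc : ContinuousAt 𝒢.tgt g₀ := htgt.continuousAt
  have hσ1 : ∀ᶠ p in 𝓝 (x₀, 𝒢.fibreCoord x₀ (𝒢.unit x₀)), MDifferentiableAt
      (𝓘(ℝ, EM).prod 𝓘(ℝ, AModel EG EM)) 𝓘(ℝ, EG) σ p := by
    have h2 := (contMDiffAt_iff_contMDiffAt_nhds (n := 1) (by norm_num)).1 (hσ.of_le (by simp))
    exact h2.mono fun p hp => hp.mdifferentiableAt (by simp)
  have hpq : ContinuousAt (fun g => (𝒢.tgt g, q g)) g₀ := htc.prodMk hq.continuousAt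
  filter_upwards [htc.eventually (𝒢.eventually_incl_eq_tder hσ hinv), hpq.eventually hσ1,
    hpq.eventually hsrc.eventually_nhds, (hu g₀).continuousAt.eventually hinv]
    with g hg1 hg2 hg3 hg4
  have e1 : σ (𝒢.tgt g, q g) = 𝒢.unit (𝒢.tgt g) := by
    rw [𝒢.src_unit] at hg4; exact hg4
  have e2 : f g (q g) = g := by
    change 𝒢.mul g (σ (𝒢.tgt g, q g)) = g
    rw [e1, 𝒢.mul_unit]
  refine totalSpace_tangent_ext e2.symm ?_
  have hs : MDifferentiableAt 𝓘(ℝ, AModel EG EM) 𝓘(ℝ, EG) (fun w => σ (𝒢.tgt g, w)) (q g) :=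
    MDifferentiableAt.comp (q g) hg2 (mdifferentiableAt_const.prodMk mdifferentiableAt_id)
  have hc2 : ContinuousAt (fun w : AModel EG EM => (𝒢.tgt g, w)) (q g) := by fun_prop
  exact (𝒢.tder_mul_left hs e1 (hc2.eventually hg3) (hg1 (X (𝒢.tgt g))).symm).symm

namespace IsFibreCurve

variable {𝒢} {x : M} {v : 𝒢.A x} {c : ℝ → G}

theorem mul_left_contMDiffAt (hc : 𝒢.IsFibreCurve x v c) {g : G} (hg : 𝒢.tgt g = x) :
    ContMDiffAt 𝓘(ℝ, ℝ) 𝓘(ℝ, EG) ∞ (fun t => 𝒢.mul g (c t)) 0 :=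
  𝒢.contMDiffAt_mul contMDiffAt_const hc.contMDiffAt (.of_forall fun t => by rw [hg, hc.src_eq])

theorem mul_left_zero (hc : 𝒢.IsFibreCurve x v c) {g : G} (hg : 𝒢.tgt g = x) :
    𝒢.mul g (c 0) = g := by rw [hc.zero, ← hg, 𝒢.mul_unit]

theorem tder_mul_left {X : ∀ x, 𝒢.A x} (hc : 𝒢.IsFibreCurve x (X x) c) {g : G}
    (hg : 𝒢.tgt g = x) :
    tder 𝓘(ℝ, ℝ) 𝓘(ℝ, EG) (fun t => 𝒢.mul g (c t)) 0 1 = 𝒢.leftField X g := by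
  subst hg
  exact 𝒢.tder_mul_left (hc.contMDiffAt.mdifferentiableAt (by simp)) hc.zero
    (.of_forall hc.src_eq) hc.tder_one

theorem tder_mul_left' {g : G} {v : 𝒢.A (𝒢.tgt g)} (hc : 𝒢.IsFibreCurve (𝒢.tgt g) v c) :
    tder 𝓘(ℝ, ℝ) 𝓘(ℝ, EG) (fun t => 𝒢.mul g (c t)) 0 1 = 𝒢.leftModel g v :=
  𝒢.tder_mul_left (hc.contMDiffAt.mdifferentiableAt (by simp)) hc.zero
    (.of_forall hc.src_eq) hc.tder_one

theorem inv_mul_contMDiffAt (hc : 𝒢.IsFibreCurve x v c) {h : G} (hh : 𝒢.src h = x) :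
    ContMDiffAt 𝓘(ℝ, ℝ) 𝓘(ℝ, EG) ∞ (fun t => 𝒢.mul (𝒢.inv (c t)) h) 0 :=
  𝒢.contMDiffAt_mul ((𝒢.contMDiff_inv _).comp 0 hc.contMDiffAt) contMDiffAt_const
    (.of_forall fun t => by rw [hh, 𝒢.tgt_inv, hc.src_eq])

theorem inv_mul_zero (hc : 𝒢.IsFibreCurve x v c) {h : G} (hh : 𝒢.src h = x) :
    𝒢.mul (𝒢.inv (c 0)) h = h := by rw [hc.zero, 𝒢.inv_unit, ← hh, 𝒢.unit_mul]

theorem tder_inv_mul {X : ∀ x, 𝒢.A x} (hc : 𝒢.IsFibreCurve x (X x) c) {h : G}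
    (hh : 𝒢.src h = x) :
    tder 𝓘(ℝ, ℝ) 𝓘(ℝ, EG) (fun t => 𝒢.mul (𝒢.inv (c t)) h) 0 1 = 𝒢.rightField X h := by
  subst hh
  exact 𝒢.tder_inv_mul (hc.contMDiffAt.mdifferentiableAt (by simp)) hc.zero
    (.of_forall hc.src_eq) hc.tder_one

theorem tder_inv_mul' {h : G} {v : 𝒢.A (𝒢.src h)} (hc : 𝒢.IsFibreCurve (𝒢.src h) v c) :
    tder 𝓘(ℝ, ℝ) 𝓘(ℝ, EG) (fun t => 𝒢.mul (𝒢.inv (c t)) h) 0 1 = 𝒢.rightModel h v :=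
  𝒢.tder_inv_mul (hc.contMDiffAt.mdifferentiableAt (by simp)) hc.zero
    (.of_forall hc.src_eq) hc.tder_one

end IsFibreCurve

/-! ### Invariant vector fields as derivations; left and right ones commute -/

/-- Inversion exchanges left- and right-invariant vector fields. -/
theorem tder_inv_leftField (X : ∀ x, 𝒢.A x) (h : G) :
    tder 𝓘(ℝ, EG) 𝓘(ℝ, EG) 𝒢.inv (𝒢.inv h) (𝒢.leftField X (𝒢.inv h)) = 𝒢.rightField X h := by
  obtain ⟨c, hc⟩ := 𝒢.exists_isFibreCurve (𝒢.src h) (X (𝒢.src h))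
  have e := 𝒢.tgt_inv h
  rw [← hc.tder_mul_left e, ← hc.tder_inv_mul rfl,
    ← tder_comp (f := fun t => 𝒢.mul (𝒢.inv h) (c t)) (hc.mul_left_zero e)
    (𝒢.contMDiff_inv.mdifferentiable (by simp) _)
    ((hc.mul_left_contMDiffAt e).mdifferentiableAt (by simp))]
  congr 2
  funext t
  rw [𝒢.mul_inv_rev (by rw [e, hc.src_eq]), 𝒢.inv_inv]

theorem contMDiff_rightField {X : ∀ x, 𝒢.A x} (hX : 𝒢.SmoothSection X) :
    ContMDiff 𝓘(ℝ, EG) 𝓘(ℝ, EG).tangent ∞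
      (fun g => (⟨g, 𝒢.rightField X g⟩ : TangentBundle 𝓘(ℝ, EG) G)) := by
  have h1 := (𝒢.contMDiff_inv.contMDiff_tangentMap (m := ∞) (by simp)).comp
    ((𝒢.contMDiff_leftField hX).comp 𝒢.contMDiff_inv)
  convert h1 using 2 with g
  exact totalSpace_tangent_ext (𝒢.inv_inv g).symm (𝒢.tder_inv_leftField X g).symm

/-- The derivative of a function along a left-invariant vector field. -/
def leftDeriv (X : ∀ x, 𝒢.A x) (f : G → ℝ) (g : G) : ℝ :=
  tder 𝓘(ℝ, EG) 𝓘(ℝ, ℝ) f g (𝒢.leftField X g)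

/-- The derivative of a function along a right-invariant vector field. -/
def rightDeriv (X : ∀ x, 𝒢.A x) (f : G → ℝ) (g : G) : ℝ :=
  tder 𝓘(ℝ, EG) 𝓘(ℝ, ℝ) f g (𝒢.rightField X g)

section

variable {X Y : ∀ x, 𝒢.A x} {f : G → ℝ}

theorem contMDiff_leftDeriv (hX : 𝒢.SmoothSection X) (hf : ContMDiff 𝓘(ℝ, EG) 𝓘(ℝ, ℝ) ∞ f) :
    ContMDiff 𝓘(ℝ, EG) 𝓘(ℝ, ℝ) ∞ (𝒢.leftDeriv X f) := fun g =>
  contMDiffAt_tder_apply (hf g) (𝒢.contMDiff_leftField hX g)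

theorem contMDiff_rightDeriv (hX : 𝒢.SmoothSection X) (hf : ContMDiff 𝓘(ℝ, EG) 𝓘(ℝ, ℝ) ∞ f) :
    ContMDiff 𝓘(ℝ, EG) 𝓘(ℝ, ℝ) ∞ (𝒢.rightDeriv X f) := fun g =>
  contMDiffAt_tder_apply (hf g) (𝒢.contMDiff_rightField hX g)

theorem IsFibreCurve.fderiv_comp_mul_left {x : M} {c : ℝ → G} (hc : 𝒢.IsFibreCurve x (X x) c)
    {g : G} (hg : 𝒢.tgt g = x) (hf : MDifferentiableAt 𝓘(ℝ, EG) 𝓘(ℝ, ℝ) f g) :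
    fderiv ℝ (fun t => f (𝒢.mul g (c t))) 0 1 = 𝒢.leftDeriv X f g := by
  rw [← tder_eq_fderiv, tder_comp (f := fun t => 𝒢.mul g (c t)) (hc.mul_left_zero hg) hf
    ((hc.mul_left_contMDiffAt hg).mdifferentiableAt (by simp)), hc.tder_mul_left hg]
  rfl

theorem IsFibreCurve.fderiv_comp_inv_mul {x : M} {c : ℝ → G} (hc : 𝒢.IsFibreCurve x (X x) c)
    {g : G} (hg : 𝒢.src g = x) (hf : MDifferentiableAt 𝓘(ℝ, EG) 𝓘(ℝ, ℝ) f g) :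
    fderiv ℝ (fun t => f (𝒢.mul (𝒢.inv (c t)) g)) 0 1 = 𝒢.rightDeriv X f g := by
  rw [← tder_eq_fderiv, tder_comp (f := fun t => 𝒢.mul (𝒢.inv (c t)) g) (hc.inv_mul_zero hg) hf
    ((hc.inv_mul_contMDiffAt hg).mdifferentiableAt (by simp)), hc.tder_inv_mul hg]
  rfl

/-- Left- and right-invariant vector fields commute. -/
theorem rightDeriv_leftDeriv_comm (hX : 𝒢.SmoothSection X) (hY : 𝒢.SmoothSection Y)
    (hf : ContMDiff 𝓘(ℝ, EG) 𝓘(ℝ, ℝ) ∞ f) (g : G) :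
    𝒢.rightDeriv X (𝒢.leftDeriv Y f) g = 𝒢.leftDeriv Y (𝒢.rightDeriv X f) g := by
  obtain ⟨k, hk⟩ := 𝒢.exists_isFibreCurve (𝒢.src g) (X (𝒢.src g))
  obtain ⟨l, hl⟩ := 𝒢.exists_isFibreCurve (𝒢.tgt g) (Y (𝒢.tgt g))
  have e1 : ∀ t, 𝒢.tgt (𝒢.inv (k t)) = 𝒢.src g := fun t => by rw [𝒢.tgt_inv, hk.src_eq]
  have e2 : ∀ s, 𝒢.tgt g = 𝒢.src (l s) := fun s => (hl.src_eq s).symm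
  have e3 : ∀ t, 𝒢.tgt (𝒢.mul (𝒢.inv (k t)) g) = 𝒢.tgt g := fun t => 𝒢.tgt_mul _ _ (e1 t)
  have e4 : ∀ s, 𝒢.src (𝒢.mul g (l s)) = 𝒢.src g := fun s => 𝒢.src_mul _ _ (e2 s)
  -- By associativity the two translations can be performed in either order. The two iterated
  -- derivatives are then the mixed partial derivatives of this one function at the origin.
  let F : ℝ × ℝ → ℝ := fun p => f (𝒢.mul (𝒢.mul (𝒢.inv (k p.1)) g) (l p.2))
  have hF : ContDiffAt ℝ ∞ F (0, 0) := by
    have h1 : ContMDiffAt (𝓘(ℝ, ℝ).prod 𝓘(ℝ, ℝ)) 𝓘(ℝ, ℝ) ∞ F (0, 0) := by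
      refine ContMDiffAt.comp (g := f) ((0 : ℝ), (0 : ℝ)) (hf _) (𝒢.contMDiffAt_mul ?_ ?_ ?_)
      · exact ContMDiffAt.comp (g := fun t => 𝒢.mul (𝒢.inv (k t)) g) ((0 : ℝ), (0 : ℝ))
          (hk.inv_mul_contMDiffAt rfl) contMDiffAt_fst
      · exact ContMDiffAt.comp (g := l) ((0 : ℝ), (0 : ℝ)) hl.contMDiffAt contMDiffAt_snd
      · exact .of_forall fun p => by rw [e3, e2]
    rw [← contMDiffAt_iff_contDiffAt, modelWithCornersSelf_prod, ← chartedSpaceSelf_prod]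
    exact h1
  have hdf := hf.mdifferentiable (by simp)
  have key := fderiv_partial_comm hF (a := fun t => 𝒢.leftDeriv Y f (𝒢.mul (𝒢.inv (k t)) g))
    (b := fun s => 𝒢.rightDeriv X f (𝒢.mul g (l s)))
    (fun t => hl.fderiv_comp_mul_left 𝒢 (e3 t) (hdf _))
    (fun s => by
      rw [← hk.fderiv_comp_inv_mul 𝒢 (e4 s) (hdf _)]
      congr 2; funext t
      exact congrArg f (𝒢.mul_assoc _ _ _ (e1 t) (e2 s)).symm)
  rwa [hk.fderiv_comp_inv_mul 𝒢 rfl ((𝒢.contMDiff_leftDeriv hY hf).mdifferentiable (by simp) _),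
    hl.fderiv_comp_mul_left 𝒢 rfl ((𝒢.contMDiff_rightDeriv hX hf).mdifferentiable (by simp) _)]
    at key

end

/-! ### Projections of invariant fields to `M`, and their brackets -/

theorem tder_src_leftModel (g : G) (v : 𝒢.A (𝒢.tgt g)) :
    tder 𝓘(ℝ, EG) 𝓘(ℝ, EM) 𝒢.src g (𝒢.leftModel g v) = 0 := by
  obtain ⟨c, hc⟩ := 𝒢.exists_isFibreCurve (𝒢.tgt g) v
  rw [← hc.tder_mul_left', ← tder_comp (f := fun t => 𝒢.mul g (c t)) (hc.mul_left_zero rfl)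
    (𝒢.contMDiff_src.mdifferentiable (by simp) _)
    ((hc.mul_left_contMDiffAt rfl).mdifferentiableAt (by simp))]
  have : (fun t => 𝒢.src (𝒢.mul g (c t))) = fun _ => 𝒢.src g := by
    funext t; exact 𝒢.src_mul _ _ (hc.src_eq t).symm
  rw [this, tder_const]; rfl

theorem tder_tgt_leftModel (g : G) (v : 𝒢.A (𝒢.tgt g)) :
    tder 𝓘(ℝ, EG) 𝓘(ℝ, EM) 𝒢.tgt g (𝒢.leftModel g v) = 𝒢.anchor (𝒢.tgt g) v := by
  obtain ⟨c, hc⟩ := 𝒢.exists_isFibreCurve (𝒢.tgt g) v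
  have ht := 𝒢.contMDiff_tgt.mdifferentiable (by simp)
  have h1 : tder 𝓘(ℝ, EG) 𝓘(ℝ, EM) 𝒢.tgt (𝒢.unit (𝒢.tgt g)) (𝒢.inclModel _ v) =
    𝒢.anchor (𝒢.tgt g) v := rfl
  rw [← h1, ← hc.tder_mul_left', ← hc.tder_one, ← tder_comp hc.zero (ht _)
    (hc.contMDiffAt.mdifferentiableAt (by simp)),
    ← tder_comp (f := fun t => 𝒢.mul g (c t)) (hc.mul_left_zero rfl) (ht _)
    ((hc.mul_left_contMDiffAt rfl).mdifferentiableAt (by simp))]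
  congr 2
  funext t; exact 𝒢.tgt_mul _ _ (hc.src_eq t).symm

theorem tder_tgt_rightModel (g : G) (v : 𝒢.A (𝒢.src g)) :
    tder 𝓘(ℝ, EG) 𝓘(ℝ, EM) 𝒢.tgt g (𝒢.rightModel g v) = 0 := by
  obtain ⟨c, hc⟩ := 𝒢.exists_isFibreCurve (𝒢.src g) v
  rw [← hc.tder_inv_mul', ← tder_comp (f := fun t => 𝒢.mul (𝒢.inv (c t)) g) (hc.inv_mul_zero rfl)
    (𝒢.contMDiff_tgt.mdifferentiable (by simp) _)
    ((hc.inv_mul_contMDiffAt rfl).mdifferentiableAt (by simp))]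
  have : (fun t => 𝒢.tgt (𝒢.mul (𝒢.inv (c t)) g)) = fun _ => 𝒢.tgt g := by
    funext t; exact 𝒢.tgt_mul _ _ (by rw [𝒢.tgt_inv, hc.src_eq])
  rw [this, tder_const]; rfl

theorem tder_src_rightModel (g : G) (v : 𝒢.A (𝒢.src g)) :
    tder 𝓘(ℝ, EG) 𝓘(ℝ, EM) 𝒢.src g (𝒢.rightModel g v) = 𝒢.anchor (𝒢.src g) v := by
  obtain ⟨c, hc⟩ := 𝒢.exists_isFibreCurve (𝒢.src g) v
  have h1 : tder 𝓘(ℝ, EG) 𝓘(ℝ, EM) 𝒢.tgt (𝒢.unit (𝒢.src g)) (𝒢.inclModel _ v) =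
    𝒢.anchor (𝒢.src g) v := rfl
  rw [← h1, ← hc.tder_inv_mul', ← hc.tder_one,
    ← tder_comp hc.zero (𝒢.contMDiff_tgt.mdifferentiable (by simp) _)
    (hc.contMDiffAt.mdifferentiableAt (by simp)),
    ← tder_comp (f := fun t => 𝒢.mul (𝒢.inv (c t)) g) (hc.inv_mul_zero rfl)
    (𝒢.contMDiff_src.mdifferentiable (by simp) _)
    ((hc.inv_mul_contMDiffAt rfl).mdifferentiableAt (by simp))]
  congr 2
  funext t
  rw [𝒢.src_mul _ _ (by rw [𝒢.tgt_inv, hc.src_eq]), 𝒢.src_inv]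

/-- Both fields annihilate `α`, read in a chart of `M`, near `g`; hence so does their commutator.
This is why `vertProj` changes nothing in the definition of `bracket`. -/
theorem tder_src_mlieBracket {X₀ X₁ : ∀ x, 𝒢.A x} (h₀ : 𝒢.SmoothSection X₀)
    (h₁ : 𝒢.SmoothSection X₁) (g : G) :
    tder 𝓘(ℝ, EG) 𝓘(ℝ, EM) 𝒢.src g
      (mlieBracket 𝓘(ℝ, EG) (𝒢.leftField X₀) (𝒢.leftField X₁) g) = 0 := by
  have : CompleteSpace EG := FiniteDimensional.complete ℝ EG
  let d := extChartAt 𝓘(ℝ, EM) (𝒢.src g)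
  have hd : ContMDiffAt 𝓘(ℝ, EM) 𝓘(ℝ, EM) ∞ d (𝒢.src g) := contMDiffAt_extChartAt
  have hs : ContMDiffAt 𝓘(ℝ, EG) 𝓘(ℝ, EM) ∞ (fun k => d (𝒢.src k)) g :=
    ContMDiffAt.comp g hd (𝒢.contMDiff_src g)
  have hz : ∀ X : ∀ x, 𝒢.A x, (fun k => tder 𝓘(ℝ, EG) 𝓘(ℝ, EM) (fun k => d (𝒢.src k)) k
      (𝒢.leftField X k)) =ᶠ[𝓝 g] fun _ => 0 := by
    intro X
    have h1 : ∀ᶠ k in 𝓝 g, 𝒢.src k ∈ (chartAt EM (𝒢.src g)).source :=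
      (𝒢.contMDiff_src.continuous.continuousAt).eventually (chart_source_mem_nhds EM _)
    filter_upwards [h1] with k hk
    rw [tder_comp rfl (mdifferentiableAt_extChartAt hk)
      (𝒢.contMDiff_src.mdifferentiable (by simp) k)]
    exact (congrArg _ (𝒢.tder_src_leftModel k _)).trans (map_zero _)
  have h1 := tder_mlieBracket_apply (V := 𝒢.leftField X₀) (W := 𝒢.leftField X₁) hs
    ((𝒢.contMDiff_leftField h₀).mdifferentiable (by simp) g)
    ((𝒢.contMDiff_leftField h₁).mdifferentiable (by simp) g)
  rw [tder_congr (hz X₀), tder_congr (hz X₁), tder_const] at h1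
  have h2 := (tder_comp rfl (hd.mdifferentiableAt (by simp))
    (𝒢.contMDiff_src.mdifferentiable (by simp) g)
    (mlieBracket 𝓘(ℝ, EG) (𝒢.leftField X₀) (𝒢.leftField X₁) g)).symm.trans h1
  refine (isInvertible_mfderiv_extChartAt (I := 𝓘(ℝ, EM))
    (mem_extChartAt_source (𝒢.src g))).injective ?_
  exact h2.trans ((sub_self (0 : EM)).trans
    (map_zero (tder 𝓘(ℝ, EM) 𝓘(ℝ, EM) d (𝒢.src g))).symm)

theorem inclModel_bracket {X₀ X₁ : ∀ x, 𝒢.A x} (h₀ : 𝒢.SmoothSection X₀)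
    (h₁ : 𝒢.SmoothSection X₁) (x : M) :
    𝒢.inclModel x (𝒢.bracket X₀ X₁ x) =
      mlieBracket 𝓘(ℝ, EG) (𝒢.leftField X₀) (𝒢.leftField X₁) (𝒢.unit x) :=
  𝒢.incl_vertProj_of_mem (𝒢.tder_src_mlieBracket h₀ h₁ (𝒢.unit x))

/-- The left-invariant vector field of a bracket of sections is the commutator. -/
theorem leftDeriv_bracket {X₀ X₁ : ∀ x, 𝒢.A x} (h₀ : 𝒢.SmoothSection X₀)
    (h₁ : 𝒢.SmoothSection X₁) {f : G → ℝ} (hf : ContMDiff 𝓘(ℝ, EG) 𝓘(ℝ, ℝ) ∞ f) (g : G) :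
    𝒢.leftDeriv (𝒢.bracket X₀ X₁) f g =
      𝒢.leftDeriv X₀ (𝒢.leftDeriv X₁ f) g - 𝒢.leftDeriv X₁ (𝒢.leftDeriv X₀ f) g := by
  have : CompleteSpace EG := FiniteDimensional.complete ℝ EG
  -- The bracket is defined by its value at the unit `e`, so the identity at `g` is obtained from
  -- the one at `e` through `l_g`. As `l_g` is defined only on the `α`-fibre of `x`, the function `f
  -- ∘ l_g` must first be extended to a neighbourhood of `e` before the bracket can act on it.
  let x := 𝒢.tgt g
  let e := 𝒢.unit x
  have he : 𝒢.tgt e = x := 𝒢.tgt_unit x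
  obtain ⟨σ, hσ, hsrc, hinv⟩ := 𝒢.exists_fibreCoord_inverse x
  have hq : ContMDiffAt 𝓘(ℝ, EG) 𝓘(ℝ, AModel EG EM) ∞ (𝒢.fibreCoord x) e :=
    𝒢.contMDiffAt_fibreCoord (mem_chart_source EG (𝒢.unit x))
  have hxq : ContMDiffAt 𝓘(ℝ, EG) (𝓘(ℝ, EM).prod 𝓘(ℝ, AModel EG EM)) ∞
      (fun k => (x, 𝒢.fibreCoord x k)) e := contMDiffAt_const.prodMk hq
  -- a retraction onto the `α`-fibre of `e`, and an extension of `f ∘ l_g` from that fibre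
  let p : G → G := fun k => σ (x, 𝒢.fibreCoord x k)
  let F : G → ℝ := fun k => f (𝒢.mul g (p k))
  have hF : ContMDiffAt 𝓘(ℝ, EG) 𝓘(ℝ, ℝ) ∞ F e := by
    refine ContMDiffAt.comp (g := f) e (hf _) (𝒢.contMDiffAt_mul contMDiffAt_const
      (ContMDiffAt.comp (g := σ) e hσ hxq) ?_)
    exact (hxq.continuousAt.eventually hsrc).mono fun k hk => hk.symm
  have hp : ∀ᶠ k in 𝓝 e, 𝒢.src k = x → F k = f (𝒢.mul g k) := by
    filter_upwards [hinv] with k hk hkx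
    rw [hkx] at hk
    exact congrArg (fun k => f (𝒢.mul g k)) hk
  have hdF : ∀ᶠ k in 𝓝 e, MDifferentiableAt 𝓘(ℝ, EG) 𝓘(ℝ, ℝ) F k := by
    have h2 := (contMDiffAt_iff_contMDiffAt_nhds (n := 1) (by norm_num)).1 (hF.of_le (by simp))
    exact h2.mono fun p hp => hp.mdifferentiableAt (by simp)
  have hdf := hf.mdifferentiable (by simp)
  -- A left-invariant field is tangent to the fibre, so the choice of extension is invisible to it;
  -- associativity `g (k c) = (g k) c` then gives invariance.
  have h1 : ∀ Y : (∀ x, 𝒢.A x), ∀ᶠ k in 𝓝 e, 𝒢.src k = x →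
      𝒢.leftDeriv Y F k = 𝒢.leftDeriv Y f (𝒢.mul g k) := by
    intro Y
    filter_upwards [hp.eventually_nhds, hdF] with k hk hk' hkx
    obtain ⟨c, hc⟩ := 𝒢.exists_isFibreCurve (𝒢.tgt k) (Y (𝒢.tgt k))
    have e1 : 𝒢.tgt g = 𝒢.src k := hkx.symm
    rw [← hc.fderiv_comp_mul_left 𝒢 rfl hk',
      ← hc.fderiv_comp_mul_left 𝒢 (𝒢.tgt_mul _ _ e1) (hdf _)]
    have h2 : ∀ᶠ t in 𝓝 (0 : ℝ), 𝒢.src (𝒢.mul k (c t)) = x →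
        F (𝒢.mul k (c t)) = f (𝒢.mul g (𝒢.mul k (c t))) := by
      have h3 := (hc.mul_left_contMDiffAt rfl).continuousAt.tendsto
      rw [hc.mul_left_zero rfl] at h3
      exact h3.eventually hk
    have h3 : (fun t => F (𝒢.mul k (c t))) =ᶠ[𝓝 0] fun t => f (𝒢.mul (𝒢.mul g k) (c t)) := by
      filter_upwards [h2] with t ht
      have e2 : 𝒢.tgt k = 𝒢.src (c t) := (hc.src_eq t).symm
      rw [ht (by rw [𝒢.src_mul _ _ e2, hkx]), 𝒢.mul_assoc _ _ _ e1 e2]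
    rw [h3.fderiv_eq]
  -- The second derivative again uses only values on the fibre, namely those identified in `h1`.
  have h2 : ∀ Y Z : (∀ x, 𝒢.A x), 𝒢.SmoothSection Y →
      𝒢.leftDeriv Z (𝒢.leftDeriv Y F) e = 𝒢.leftDeriv Z (𝒢.leftDeriv Y f) g := by
    intro Y Z hY
    obtain ⟨c, hc⟩ := 𝒢.exists_isFibreCurve x (Z x)
    have hYF : ContMDiffAt 𝓘(ℝ, EG) 𝓘(ℝ, ℝ) ∞ (𝒢.leftDeriv Y F) e :=
      contMDiffAt_tder_apply hF (𝒢.contMDiff_leftField hY e)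
    rw [← hc.fderiv_comp_mul_left 𝒢 he (hYF.mdifferentiableAt (by simp)),
      ← hc.fderiv_comp_mul_left 𝒢 rfl ((𝒢.contMDiff_leftDeriv hY hf).mdifferentiable (by simp) _)]
    have h3 : ∀ᶠ t in 𝓝 (0 : ℝ), 𝒢.src (c t) = x →
        𝒢.leftDeriv Y F (c t) = 𝒢.leftDeriv Y f (𝒢.mul g (c t)) := by
      have h3 := hc.contMDiffAt.continuousAt.tendsto
      rw [hc.zero] at h3
      exact h3.eventually (h1 Y)
    have h4 : (fun t => 𝒢.leftDeriv Y F (𝒢.mul e (c t))) =ᶠ[𝓝 0]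
        fun t => 𝒢.leftDeriv Y f (𝒢.mul g (c t)) := by
      filter_upwards [h3] with t ht
      have e3 : 𝒢.mul e (c t) = c t := by
        have := 𝒢.unit_mul (c t)
        rwa [hc.src_eq] at this
      rw [e3, ht (hc.src_eq t)]
    rw [h4.fderiv_eq]
  rw [← h2 X₁ X₀ h₁, ← h2 X₀ X₁ h₀]
  have h3 := tder_mlieBracket_apply (V := 𝒢.leftField X₀) (W := 𝒢.leftField X₁) hF
    ((𝒢.contMDiff_leftField h₀).mdifferentiable (by simp) e)
    ((𝒢.contMDiff_leftField h₁).mdifferentiable (by simp) e)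
  refine Eq.trans ?_ h3
  rw [← 𝒢.inclModel_bracket h₀ h₁]
  obtain ⟨c, hc⟩ := 𝒢.exists_isFibreCurve x (𝒢.bracket X₀ X₁ x)
  rw [← hc.fderiv_comp_mul_left 𝒢 rfl (hdf _), ← hc.tder_one,
    ← tder_comp hc.zero (hF.mdifferentiableAt (by simp))
      (hc.contMDiffAt.mdifferentiableAt (by simp)),
    ← tder_eq_fderiv]
  have h4 : ∀ᶠ t in 𝓝 (0 : ℝ), 𝒢.src (c t) = x → F (c t) = f (𝒢.mul g (c t)) := by
    have h5 := hc.contMDiffAt.continuousAt.tendsto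
    rw [hc.zero] at h5
    exact h5.eventually hp
  have h5 : (fun t => F (c t)) =ᶠ[𝓝 0] fun t => f (𝒢.mul g (c t)) :=
    h4.mono fun t ht => ht (hc.src_eq t)
  rw [tder_congr h5]

theorem rightDeriv_eq_leftDeriv_inv (X : ∀ x, 𝒢.A x) {f : G → ℝ}
    (hf : ContMDiff 𝓘(ℝ, EG) 𝓘(ℝ, ℝ) ∞ f) (g : G) :
    𝒢.rightDeriv X f g = 𝒢.leftDeriv X (fun k => f (𝒢.inv k)) (𝒢.inv g) := by
  rw [rightDeriv, leftDeriv, tder_comp (𝒢.inv_inv g) (hf.mdifferentiable (by simp) _)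
    (𝒢.contMDiff_inv.mdifferentiable (by simp) _), 𝒢.tder_inv_leftField]

/-- The right-invariant vector field of a bracket of sections is the commutator. -/
theorem rightDeriv_bracket {X₀ X₁ : ∀ x, 𝒢.A x} (h₀ : 𝒢.SmoothSection X₀)
    (h₁ : 𝒢.SmoothSection X₁) {f : G → ℝ} (hf : ContMDiff 𝓘(ℝ, EG) 𝓘(ℝ, ℝ) ∞ f) (g : G) :
    𝒢.rightDeriv (𝒢.bracket X₀ X₁) f g =
      𝒢.rightDeriv X₀ (𝒢.rightDeriv X₁ f) g - 𝒢.rightDeriv X₁ (𝒢.rightDeriv X₀ f) g := by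
  have hfi : ContMDiff 𝓘(ℝ, EG) 𝓘(ℝ, ℝ) ∞ (fun k => f (𝒢.inv k)) := hf.comp 𝒢.contMDiff_inv
  have h2 : ∀ Y Z : (∀ x, 𝒢.A x), 𝒢.SmoothSection Y →
      𝒢.rightDeriv Z (𝒢.rightDeriv Y f) g =
        𝒢.leftDeriv Z (𝒢.leftDeriv Y fun k => f (𝒢.inv k)) (𝒢.inv g) := by
    intro Y Z hY
    rw [𝒢.rightDeriv_eq_leftDeriv_inv Z (𝒢.contMDiff_rightDeriv hY hf)]
    congr 1
    funext k
    rw [𝒢.rightDeriv_eq_leftDeriv_inv Y hf, 𝒢.inv_inv]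
  rw [h2 _ _ h₀, h2 _ _ h₁, 𝒢.rightDeriv_eq_leftDeriv_inv _ hf, 𝒢.leftDeriv_bracket h₀ h₁ hfi]

/-! ### Global sections, and translations as isomorphisms of vertical spaces -/

/-- Every frame section extends to a global smooth section. -/
theorem exists_smoothSection_eventually [T2Space M] (x₀ : M) (w : AModel EG EM) :
    ∃ X : ∀ x, 𝒢.A x, 𝒢.SmoothSection X ∧ ∀ᶠ x in 𝓝 x₀, X x = 𝒢.ofCoord x₀ x w := by
  obtain ⟨ρ, hρ⟩ := (SmoothBumpFunction.nhds_basis_support (I := 𝓘(ℝ, EM))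
    ((𝒢.isOpen_frameDom x₀).mem_nhds (𝒢.mem_frameDom x₀))).ex_mem
  have h1 : ContMDiffOn 𝓘(ℝ, EM) (𝓘(ℝ, EM).prod 𝓘(ℝ, AModel EG EM)) ∞
      (fun x => (⟨x, 𝒢.ofCoord x₀ x w⟩ : TotalSpace (AModel EG EM) 𝒢.A)) (𝒢.frameDom x₀) := by
    refine ((trivializationAt (AModel EG EM) 𝒢.A x₀).contMDiffOn_section_baseSet_iff
      (IB := 𝓘(ℝ, EM))).2 ?_
    exact (contMDiffOn_const (c := w)).congr fun x hx => 𝒢.toCoord_ofCoord hx w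
  refine ⟨fun x => ρ x • 𝒢.ofCoord x₀ x w, ContMDiffOn.smul_section_of_tsupport
    ρ.contMDiff.contMDiffOn (𝒢.isOpen_frameDom x₀) hρ h1, ?_⟩
  filter_upwards [ρ.eventuallyEq_one] with x hx
  rw [hx, Pi.one_apply, one_smul]

theorem exists_smoothSection [T2Space M] (x : M) (v : 𝒢.A x) :
    ∃ X : ∀ x, 𝒢.A x, 𝒢.SmoothSection X ∧ X x = v := by
  obtain ⟨X, hX, hx⟩ := 𝒢.exists_smoothSection_eventually x (𝒢.toCoord x x v)
  exact ⟨X, hX, by rw [hx.self_of_nhds, 𝒢.ofCoord_toCoord (𝒢.mem_frameDom x)]⟩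

theorem leftModel_mem (g : G) (v : 𝒢.A (𝒢.tgt g)) : 𝒢.leftModel g v ∈ 𝒢.vertSrc g :=
  𝒢.tder_src_leftModel g v

theorem rightModel_mem (g : G) (v : 𝒢.A (𝒢.src g)) : 𝒢.rightModel g v ∈ 𝒢.vertTgt g :=
  𝒢.tder_tgt_rightModel g v

/-- Left translation, as a map `A_{β g} G → V_g α`. -/
def leftTrans (g : G) : 𝒢.A (𝒢.tgt g) →ₗ[ℝ] 𝒢.vertSrc g :=
  (show 𝒢.A (𝒢.tgt g) →ₗ[ℝ] TangentSpace 𝓘(ℝ, EG) g from (𝒢.dLeft g).toLinearMap).codRestrict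
    (𝒢.vertSrc g) (𝒢.leftModel_mem g)

/-- The derivative of `k ↦ k⁻¹ h`, as a map `A_{α h} G → V_h β`. -/
def rightTrans (h : G) : 𝒢.A (𝒢.src h) →ₗ[ℝ] 𝒢.vertTgt h :=
  (show 𝒢.A (𝒢.src h) →ₗ[ℝ] TangentSpace 𝓘(ℝ, EG) h from (𝒢.dRightInv h).toLinearMap).codRestrict
    (𝒢.vertTgt h) (𝒢.rightModel_mem h)

/-- Differentiate `g⁻¹ (g c(t)) = c(t)` along a fibre curve with velocity `v`. -/
theorem phiBeta_leftTrans (g : G) (v : 𝒢.A (𝒢.tgt g)) : 𝒢.phiBeta g (𝒢.leftTrans g v) = v := by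
  obtain ⟨c, hc⟩ := 𝒢.exists_isFibreCurve (𝒢.tgt g) v
  have h1 := tder_comp_mfderivWithin (𝒢.mdifferentiableWithinAt_leftAux g)
    (s := fun t => 𝒢.mul g (c t)) ((hc.mul_left_contMDiffAt rfl).mdifferentiableAt (by simp))
    (hc.mul_left_zero rfl) (.of_forall fun t => 𝒢.src_mul _ _ (hc.src_eq t).symm) 1
  have h2 : (fun t => 𝒢.mul (𝒢.inv g) (𝒢.mul g (c t))) = c := by
    funext t; exact 𝒢.inv_mul_cancel_left (hc.src_eq t).symm
  rw [h2, hc.tder_mul_left', hc.tder_one] at h1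
  exact 𝒢.incl_injective _ h1.symm

theorem phiAlpha_rightTrans (h : G) (v : 𝒢.A (𝒢.src h)) : 𝒢.phiAlpha h (𝒢.rightTrans h v) = v := by
  obtain ⟨c, hc⟩ := 𝒢.exists_isFibreCurve (𝒢.src h) v
  have e1 : ∀ t, 𝒢.tgt (𝒢.inv (c t)) = 𝒢.src h := fun t => by rw [𝒢.tgt_inv, hc.src_eq]
  have h1 := tder_comp_mfderivWithin (𝒢.mdifferentiableWithinAt_rightAux h)
    (s := fun t => 𝒢.mul (𝒢.inv (c t)) h) ((hc.inv_mul_contMDiffAt rfl).mdifferentiableAt (by simp))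
    (hc.inv_mul_zero rfl) (.of_forall fun t => 𝒢.tgt_mul _ _ (e1 t)) 1
  have h2 : (fun t => 𝒢.inv (𝒢.mul (𝒢.mul (𝒢.inv (c t)) h) (𝒢.inv h))) = c := by
    funext t
    rw [← 𝒢.mul_assoc _ _ _ (e1 t) (by rw [𝒢.src_inv]), 𝒢.mul_inv, ← e1 t, 𝒢.mul_unit, 𝒢.inv_inv]
  rw [h2, hc.tder_inv_mul', hc.tder_one] at h1
  exact 𝒢.incl_injective _ h1.symm

instance (g : G) : FiniteDimensional ℝ (𝒢.vertSrc g) :=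
  inferInstanceAs (FiniteDimensional ℝ (tder 𝓘(ℝ, EG) 𝓘(ℝ, EM) 𝒢.src g).ker)

instance (g : G) : FiniteDimensional ℝ (𝒢.vertTgt g) :=
  inferInstanceAs (FiniteDimensional ℝ (tder 𝓘(ℝ, EG) 𝓘(ℝ, EM) 𝒢.tgt g).ker)

instance (x : M) : FiniteDimensional ℝ (𝒢.A x) :=
  inferInstanceAs (FiniteDimensional ℝ (𝒢.vertSrc (𝒢.unit x)))

theorem finrank_ker_add {f : EG →L[ℝ] EM} (hf : Surjective f) :
    Module.finrank ℝ EM + Module.finrank ℝ f.ker = Module.finrank ℝ EG := by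
  have h1 := LinearMap.finrank_range_add_finrank_ker (f : EG →ₗ[ℝ] EM)
  rwa [LinearMap.range_eq_top.2 hf, finrank_top] at h1

theorem finrank_vertSrc (g : G) :
    Module.finrank ℝ EM + Module.finrank ℝ (𝒢.vertSrc g) = Module.finrank ℝ EG :=
  finrank_ker_add (f := tder 𝓘(ℝ, EG) 𝓘(ℝ, EM) 𝒢.src g) (𝒢.submersion_src g)

theorem finrank_vertTgt (g : G) :
    Module.finrank ℝ EM + Module.finrank ℝ (𝒢.vertTgt g) = Module.finrank ℝ EG :=
  finrank_ker_add (f := tder 𝓘(ℝ, EG) 𝓘(ℝ, EM) 𝒢.tgt g) (𝒢.submersion_tgt g)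

theorem finrank_A (x : M) :
    Module.finrank ℝ EM + Module.finrank ℝ (𝒢.A x) = Module.finrank ℝ EG :=
  𝒢.finrank_vertSrc (𝒢.unit x)

/-- The one-sided inverse is two-sided because both spaces have dimension `dim G - dim M`. -/
theorem leftTrans_phiBeta (g : G) (n : 𝒢.vertSrc g) : 𝒢.leftTrans g (𝒢.phiBeta g n) = n := by
  have hinj : Injective (𝒢.leftTrans g) := LeftInverse.injective (𝒢.phiBeta_leftTrans g)
  have h1 := 𝒢.finrank_vertSrc g
  have h2 := 𝒢.finrank_A (𝒢.tgt g)
  obtain ⟨v, rfl⟩ := (LinearMap.injective_iff_surjective_of_finrank_eq_finrank (by omega)).1 hinj n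
  rw [𝒢.phiBeta_leftTrans]

theorem rightTrans_phiAlpha (h : G) (m : 𝒢.vertTgt h) :
    𝒢.rightTrans h (𝒢.phiAlpha h m) = m := by
  have hinj : Injective (𝒢.rightTrans h) := LeftInverse.injective (𝒢.phiAlpha_rightTrans h)
  have h1 := 𝒢.finrank_vertTgt h
  have h2 := 𝒢.finrank_A (𝒢.src h)
  obtain ⟨v, rfl⟩ := (LinearMap.injective_iff_surjective_of_finrank_eq_finrank (by omega)).1 hinj m
  rw [𝒢.phiAlpha_rightTrans]

/-- The tangent vector underlying an element of `V_g α`, in the model space. -/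
def vertSrcModel (g : G) : 𝒢.vertSrc g →ₗ[ℝ] EG := (𝒢.vertSrc g).subtype

/-- The tangent vector underlying an element of `V_g β`, in the model space. -/
def vertTgtModel (g : G) : 𝒢.vertTgt g →ₗ[ℝ] EG := (𝒢.vertTgt g).subtype

/-- Realises vertical vectors by invariant fields, so that derivatives along `V_g α` become values
of `leftDeriv`. -/
theorem leftField_eq {X : ∀ x, 𝒢.A x} {g : G} {n : 𝒢.vertSrc g} (h : X (𝒢.tgt g) = 𝒢.phiBeta g n) :
    𝒢.leftField X g = 𝒢.vertSrcModel g n := by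
  have h1 := congrArg Subtype.val (𝒢.leftTrans_phiBeta g n)
  rw [← h] at h1
  exact h1

theorem rightField_eq {X : ∀ x, 𝒢.A x} {g : G} {m : 𝒢.vertTgt g}
    (h : X (𝒢.src g) = 𝒢.phiAlpha g m) : 𝒢.rightField X g = 𝒢.vertTgtModel g m := by
  have h1 := congrArg Subtype.val (𝒢.rightTrans_phiAlpha g m)
  rw [← h] at h1
  exact h1

/-! ### The mixed Hessian -/

/-- The bilinear form `b` is the mixed second derivative of `f` at `g` along the vertical spaces of
`β` and `α`. -/
structure IsMixedHessian (f : G → ℝ) (g : G) (b : 𝒢.vertTgt g →ₗ[ℝ] 𝒢.vertSrc g →ₗ[ℝ] ℝ) :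
    Prop where
  right : ∀ X, 𝒢.SmoothSection X → ∀ m n, X (𝒢.src g) = 𝒢.phiAlpha g m →
    b m n = tder 𝓘(ℝ, EG) 𝓘(ℝ, ℝ) (𝒢.rightDeriv X f) g (𝒢.vertSrcModel g n)
  left : ∀ Y, 𝒢.SmoothSection Y → ∀ m n, Y (𝒢.tgt g) = 𝒢.phiBeta g n →
    b m n = tder 𝓘(ℝ, EG) 𝓘(ℝ, ℝ) (𝒢.leftDeriv Y f) g (𝒢.vertTgtModel g m)

/-- Differentiating the right-invariant derivative along `n` is linear in `n`, and differentiating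
the left-invariant derivative along `m` is linear in `m`. As invariant fields of the two kinds
commute, the two expressions agree. This gives bilinearity and independence of the extending
sections at once. -/
theorem exists_isMixedHessian [T2Space M] {f : G → ℝ} (hf : ContMDiff 𝓘(ℝ, EG) 𝓘(ℝ, ℝ) ∞ f)
    (g : G) : ∃ b, 𝒢.IsMixedHessian f g b := by
  choose E hE hEv using 𝒢.exists_smoothSection (𝒢.src g)
  choose E' hE' hEv' using 𝒢.exists_smoothSection (𝒢.tgt g)
  have key : ∀ X Y, 𝒢.SmoothSection X → 𝒢.SmoothSection Y → ∀ m n,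
      X (𝒢.src g) = 𝒢.phiAlpha g m → Y (𝒢.tgt g) = 𝒢.phiBeta g n →
      tder 𝓘(ℝ, EG) 𝓘(ℝ, ℝ) (𝒢.rightDeriv X f) g (𝒢.vertSrcModel g n) =
        tder 𝓘(ℝ, EG) 𝓘(ℝ, ℝ) (𝒢.leftDeriv Y f) g (𝒢.vertTgtModel g m) := by
    intro X Y hX hY m n hm hn
    rw [← 𝒢.leftField_eq hn, ← 𝒢.rightField_eq hm]
    exact (𝒢.rightDeriv_leftDeriv_comm hX hY hf g).symm
  let B : 𝒢.vertTgt g → 𝒢.vertSrc g → ℝ := fun m n =>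
    tder 𝓘(ℝ, EG) 𝓘(ℝ, ℝ) (𝒢.rightDeriv (E (𝒢.phiAlpha g m)) f) g (𝒢.vertSrcModel g n)
  have hB : ∀ m n, B m n = tder 𝓘(ℝ, EG) 𝓘(ℝ, ℝ) (𝒢.leftDeriv (E' (𝒢.phiBeta g n)) f) g
      (𝒢.vertTgtModel g m) := fun m n =>
    key _ _ (hE _) (hE' _) m n (hEv _) (hEv' _)
  refine ⟨LinearMap.mk₂ ℝ B ?_ ?_ ?_ ?_, ?_, ?_⟩
  · intro m m' n; simp only [hB, map_add]
  · intro c m n; simp only [hB, map_smul]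
  · intro m n n'; simp only [B, map_add]
  · intro c m n; simp only [B, map_smul]
  · intro X hX m n hm
    exact (hB m n).trans (key _ _ hX (hE' _) m n hm (hEv' _)).symm
  · intro Y hY m n hn
    exact key _ _ (hE _) hY m n (hEv _) hn

/-! ### Tangent vectors of the dual bundle, and smooth inverses -/

/-- The function `ν ↦ ν (X)` on `A^*G`. -/
def pairing (X : ∀ x, 𝒢.A x) (ν : 𝒢.AStar) : ℝ := 𝒢.liouville ν (X ν.proj, 0)

theorem extChartAt_starModel_fst (μ ν : 𝒢.AStar) :
    (extChartAt (starModel EG EM) μ ν).1 = extChartAt 𝓘(ℝ, EM) μ.proj ν.proj := by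
  rw [starModel, FiberBundle.extChartAt]; rfl

/-- The dual trivialisation is composition with the inverse trivialisation of `AG`, and that inverse
is `ofCoord`. -/
theorem extChartAt_starModel_snd_apply (μ ν : 𝒢.AStar) (h : ν.proj ∈ 𝒢.frameDom μ.proj)
    (w : AModel EG EM) :
    (extChartAt (starModel EG EM) μ ν).2 w =
      𝒢.pairing (fun x => 𝒢.ofCoord μ.proj x w) ν := by
  have h1 : (extChartAt (starModel EG EM) μ ν).2 =
      (trivializationAt (DualModel EG EM) (fun x : M => 𝒢.A x →L[ℝ] Bundle.Trivial M ℝ x) μ.proj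
        ν).2 := by
    rw [starModel, FiberBundle.extChartAt]; rfl
  rw [h1, hom_trivializationAt_apply, ContinuousLinearMap.inCoordinates_eq h (mem_univ _)]
  have h2 : (trivializationAt (AModel EG EM) 𝒢.A μ.proj).symm ν.proj w =
      𝒢.ofCoord μ.proj ν.proj w := by
    have h3 := (trivializationAt (AModel EG EM) 𝒢.A μ.proj).symm_apply_apply_mk h
      (𝒢.ofCoord μ.proj ν.proj w)
    have h4 : (trivializationAt (AModel EG EM) 𝒢.A μ.proj
        ⟨ν.proj, 𝒢.ofCoord μ.proj ν.proj w⟩).2 = w := 𝒢.toCoord_ofCoord h w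
    rwa [h4] at h3
  exact congrArg (show 𝒢.A ν.proj →L[ℝ] ℝ from ν.2) h2

theorem tder_clm_extChartAt {F : Type*} [NormedAddCommGroup F] [NormedSpace ℝ F] {μ : 𝒢.AStar}
    (l : EM × DualModel EG EM →L[ℝ] F) (T : EM × DualModel EG EM) :
    tder (starModel EG EM) 𝓘(ℝ, F) (fun ν => l (extChartAt (starModel EG EM) μ ν)) μ T =
      l (tder (starModel EG EM) 𝓘(ℝ, EM × DualModel EG EM)
        (extChartAt (starModel EG EM) μ) μ T) := by
  have hφ : MDifferentiableAt (starModel EG EM) 𝓘(ℝ, EM × DualModel EG EM)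
      (extChartAt (starModel EG EM) μ) μ :=
    mdifferentiableAt_extChartAt (mem_chart_source _ μ)
  rw [tder_comp (g := l) rfl l.mdifferentiableAt hφ, tder_eq_fderiv, l.fderiv]

/-- A tangent vector of `A^*G` is determined by its projection to `M` and by the derivatives of the
functions `ν ↦ ν (X)`. -/
theorem eq_zero_of_tder_pairing [T2Space M] {μ : 𝒢.AStar} {T : EM × DualModel EG EM}
    (h₁ : tder (starModel EG EM) 𝓘(ℝ, EM) (fun ν : 𝒢.AStar => ν.proj) μ T = 0)
    (h₂ : ∀ X, 𝒢.SmoothSection X → tder (starModel EG EM) 𝓘(ℝ, ℝ) (𝒢.pairing X) μ T = 0) :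
    T = 0 := by
  have hi : (tder (starModel EG EM) 𝓘(ℝ, EM × DualModel EG EM)
      (extChartAt (starModel EG EM) μ) μ).IsInvertible :=
    isInvertible_mfderiv_extChartAt (mem_extChartAt_source μ)
  refine hi.injective (Eq.trans ?_ (map_zero _).symm)
  refine Prod.ext ?_ (ContinuousLinearMap.ext fun w => ?_)
  · refine (𝒢.tder_clm_extChartAt (ContinuousLinearMap.fst ℝ _ _) T).symm.trans ?_
    have h3 : (fun ν : 𝒢.AStar => ContinuousLinearMap.fst ℝ EM (DualModel EG EM)
        (extChartAt (starModel EG EM) μ ν)) = fun ν => extChartAt 𝓘(ℝ, EM) μ.proj ν.proj := by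
      funext ν; exact 𝒢.extChartAt_starModel_fst μ ν
    rw [h3, tder_comp (g := extChartAt 𝓘(ℝ, EM) μ.proj) (f := fun ν : 𝒢.AStar => ν.proj) rfl
      (mdifferentiableAt_extChartAt (mem_chart_source _ _))
      ((Bundle.contMDiff_proj (IB := 𝓘(ℝ, EM)) (n := ∞)
        (fun x : M => 𝒢.A x →L[ℝ] Bundle.Trivial M ℝ x)).mdifferentiable (by simp) _), h₁, map_zero]
    rfl
  · refine (𝒢.tder_clm_extChartAt ((ContinuousLinearMap.apply ℝ ℝ w) ∘L
      ContinuousLinearMap.snd ℝ _ _) T).symm.trans ?_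
    -- The frame section with coordinates `w` is only local; a global section equal to it near
    -- `μ.proj` has the same derivative at `μ`.
    obtain ⟨X, hX, hXw⟩ := 𝒢.exists_smoothSection_eventually μ.proj w
    have hc : Tendsto (fun ν : 𝒢.AStar => ν.proj) (𝓝 μ) (𝓝 μ.proj) :=
      (FiberBundle.continuous_proj _ _).continuousAt
    refine Eq.trans (congrArg (fun D : EM × DualModel EG EM →L[ℝ] ℝ => D T)
      (tder_congr ?_)) (h₂ X hX)
    filter_upwards [hc.eventually hXw,
      hc.eventually ((𝒢.isOpen_frameDom μ.proj).mem_nhds (𝒢.mem_frameDom μ.proj))] with ν h3 h4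
    refine (𝒢.extChartAt_starModel_snd_apply μ ν h4 w).trans ?_
    rw [pairing, pairing, h3]

/-- The map `S` is a smooth inverse of the smooth map `F`. -/
structure IsSmoothInverse (F : G → 𝒢.AStar) (S : 𝒢.AStar → G) : Prop where
  contMDiff : ContMDiff 𝓘(ℝ, EG) (starModel EG EM) ∞ F
  contMDiff_inverse : ContMDiff (starModel EG EM) 𝓘(ℝ, EG) ∞ S
  left_inv : ∀ g, S (F g) = g
  right_inv : ∀ μ, F (S μ) = μ

section Inverse

variable {𝒢} {F : G → 𝒢.AStar} {S : 𝒢.AStar → G}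

theorem IsSmoothInverse.mdifferentiableAt (h : 𝒢.IsSmoothInverse F S) (g : G) :
    MDifferentiableAt 𝓘(ℝ, EG) (starModel EG EM) F g := h.contMDiff.mdifferentiable (by simp) g

theorem IsSmoothInverse.mdifferentiableAt_inverse (h : 𝒢.IsSmoothInverse F S) (μ : 𝒢.AStar) :
    MDifferentiableAt (starModel EG EM) 𝓘(ℝ, EG) S μ :=
  h.contMDiff_inverse.mdifferentiable (by simp) μ

theorem IsSmoothInverse.tder_inverse_apply (h : 𝒢.IsSmoothInverse F S) (g : G) (v : EG) :
    tder (starModel EG EM) 𝓘(ℝ, EG) S (F g) (tder 𝓘(ℝ, EG) (starModel EG EM) F g v) = v := by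
  rw [← tder_comp rfl (h.mdifferentiableAt_inverse _) (h.mdifferentiableAt g), funext h.left_inv]
  exact tder_id g v

theorem IsSmoothInverse.tder_apply_inverse (h : 𝒢.IsSmoothInverse F S) (g : G)
    (T : EM × DualModel EG EM) :
    tder 𝓘(ℝ, EG) (starModel EG EM) F g (tder (starModel EG EM) 𝓘(ℝ, EG) S (F g) T) = T := by
  rw [← tder_comp (h.left_inv g) (h.mdifferentiableAt g) (h.mdifferentiableAt_inverse _),
    funext h.right_inv]
  exact tder_id _ T

/-- The derivative of a function on `A^*G` along the image of a tangent vector of `G`. -/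
theorem IsSmoothInverse.tder_apply_tder (h : 𝒢.IsSmoothInverse F S) {k : 𝒢.AStar → ℝ} {f : G → ℝ}
    (hf : ContMDiff 𝓘(ℝ, EG) 𝓘(ℝ, ℝ) ∞ f) (hk : ∀ g, k (F g) = f g) (g : G) (v : EG) :
    tder (starModel EG EM) 𝓘(ℝ, ℝ) k (F g) (tder 𝓘(ℝ, EG) (starModel EG EM) F g v) =
      tder 𝓘(ℝ, EG) 𝓘(ℝ, ℝ) f g v := by
  have h1 : k = fun μ => f (S μ) := by funext μ; rw [← hk, h.right_inv]
  have h2 : MDifferentiableAt (starModel EG EM) 𝓘(ℝ, ℝ) k (F g) := by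
    rw [h1]
    exact (hf.comp h.contMDiff_inverse).mdifferentiable (by simp) _
  rw [← tder_comp rfl h2 (h.mdifferentiableAt g), funext hk]

end Inverse

/-- The element of `T_g G` underlying an element of `P^τ_g G`, in the model space. -/
def anchorModel (g : G) : 𝒢.PTau g →ₗ[ℝ] EG := 𝒢.anchorTau g

theorem anchorModel_apply (g : G) (p : 𝒢.PTau g) :
    𝒢.anchorModel g p = 𝒢.vertTgtModel g p.1 + 𝒢.vertSrcModel g p.2 := rfl

theorem phiAlpha_injective (h : G) : Injective (𝒢.phiAlpha h) :=
  LeftInverse.injective (𝒢.rightTrans_phiAlpha h)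

theorem phiBeta_injective (g : G) : Injective (𝒢.phiBeta g) :=
  LeftInverse.injective (𝒢.leftTrans_phiBeta g)

theorem vertTgtModel_injective (g : G) : Injective (𝒢.vertTgtModel g) := Subtype.val_injective

theorem vertSrcModel_injective (g : G) : Injective (𝒢.vertSrcModel g) := Subtype.val_injective

/-! ### The Legendre transformations, and the form `Ω` in terms of the mixed Hessian -/

section Legendre

variable {L : G → ℝ} {S S' : 𝒢.AStar → G}

/-- The `V_h β` component is determined by the `AG` component through translation. The rest of the
tangent vector `v` of `G` is then forced, and it lies in `V_h α` because the compatibility condition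
of the prolongation says that both `v` and its `V_h β` component have `α`-projection given by the
anchor. -/
theorem bijective_prolMinus (hS : 𝒢.IsSmoothInverse (𝒢.legMinus L) S) (h : G) :
    Bijective (𝒢.prolMinus hS.contMDiff h) := by
  refine ⟨(injective_iff_map_eq_zero _).2 fun p hp => ?_, fun z => ?_⟩
  · have h1 : 𝒢.phiAlpha h p.1 = 0 := congrArg (fun z => z.1.1) hp
    have h2 : tder 𝓘(ℝ, EG) (starModel EG EM) (𝒢.legMinus L) h (𝒢.anchorModel h p) = 0 :=
      congrArg (fun z => z.1.2) hp
    have h3 : p.1 = 0 := 𝒢.phiAlpha_injective h (h1.trans (map_zero _).symm)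
    have h4 := hS.tder_inverse_apply h (𝒢.anchorModel h p)
    rw [h2, map_zero, anchorModel_apply, h3, map_zero, zero_add] at h4
    exact Prod.ext h3 (𝒢.vertSrcModel_injective h (h4.symm.trans (map_zero _).symm))
  · let T : EM × DualModel EG EM := z.1.2
    let v : EG := tder (starModel EG EM) 𝓘(ℝ, EG) S (𝒢.legMinus L h) T
    let m : 𝒢.vertTgt h := 𝒢.rightTrans h z.1.1
    have hv : tder 𝓘(ℝ, EG) (starModel EG EM) (𝒢.legMinus L) h v = T := hS.tder_apply_inverse h T
    have h1 : tder 𝓘(ℝ, EG) 𝓘(ℝ, EM) 𝒢.src h v = 𝒢.anchor (𝒢.src h) z.1.1 := by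
      refine Eq.trans ?_ z.2.symm
      refine (𝒢.dProj_mfderiv (hS.mdifferentiableAt h) v).symm.trans ?_
      exact congrArg (𝒢.dProj (𝒢.legMinus L h)) hv
    have h2 : tder 𝓘(ℝ, EG) 𝓘(ℝ, EM) 𝒢.src h (v - 𝒢.vertTgtModel h m) = 0 := by
      have h3 : tder 𝓘(ℝ, EG) 𝓘(ℝ, EM) 𝒢.src h (𝒢.vertTgtModel h m) =
        𝒢.anchor (𝒢.src h) z.1.1 := 𝒢.tder_src_rightModel h _
      rw [map_sub, h1, h3]
      exact sub_self _
    let n : 𝒢.vertSrc h := ⟨v - 𝒢.vertTgtModel h m, h2⟩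
    refine ⟨(m, n), Subtype.ext (Prod.ext (𝒢.phiAlpha_rightTrans h _) ?_)⟩
    refine Eq.trans ?_ hv
    exact congrArg (tder 𝓘(ℝ, EG) (starModel EG EM) (𝒢.legMinus L) h) (add_sub_cancel _ _)

theorem bijective_prolPlus (hS : 𝒢.IsSmoothInverse (𝒢.legPlus L) S) (g : G) :
    Bijective (𝒢.prolPlus hS.contMDiff g) := by
  refine ⟨(injective_iff_map_eq_zero _).2 fun p hp => ?_, fun z => ?_⟩
  · have h1 : 𝒢.phiBeta g p.2 = 0 := congrArg (fun z => z.1.1) hp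
    have h2 : tder 𝓘(ℝ, EG) (starModel EG EM) (𝒢.legPlus L) g (𝒢.anchorModel g p) = 0 :=
      congrArg (fun z => z.1.2) hp
    have h3 : p.2 = 0 := 𝒢.phiBeta_injective g (h1.trans (map_zero _).symm)
    have h4 := hS.tder_inverse_apply g (𝒢.anchorModel g p)
    rw [h2, map_zero, anchorModel_apply, h3, map_zero, add_zero] at h4
    exact Prod.ext (𝒢.vertTgtModel_injective g (h4.symm.trans (map_zero _).symm)) h3
  · let T : EM × DualModel EG EM := z.1.2
    let v : EG := tder (starModel EG EM) 𝓘(ℝ, EG) S (𝒢.legPlus L g) T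
    let n : 𝒢.vertSrc g := 𝒢.leftTrans g z.1.1
    have hv : tder 𝓘(ℝ, EG) (starModel EG EM) (𝒢.legPlus L) g v = T := hS.tder_apply_inverse g T
    have h1 : tder 𝓘(ℝ, EG) 𝓘(ℝ, EM) 𝒢.tgt g v = 𝒢.anchor (𝒢.tgt g) z.1.1 := by
      refine Eq.trans ?_ z.2.symm
      refine (𝒢.dProj_mfderiv (hS.mdifferentiableAt g) v).symm.trans ?_
      exact congrArg (𝒢.dProj (𝒢.legPlus L g)) hv
    have h2 : tder 𝓘(ℝ, EG) 𝓘(ℝ, EM) 𝒢.tgt g (v - 𝒢.vertSrcModel g n) = 0 := by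
      have h3 : tder 𝓘(ℝ, EG) 𝓘(ℝ, EM) 𝒢.tgt g (𝒢.vertSrcModel g n) =
        𝒢.anchor (𝒢.tgt g) z.1.1 := 𝒢.tder_tgt_leftModel g _
      rw [map_sub, h1, h3]
      exact sub_self _
    let m : 𝒢.vertTgt g := ⟨v - 𝒢.vertSrcModel g n, h2⟩
    refine ⟨(m, n), Subtype.ext (Prod.ext (𝒢.phiBeta_leftTrans g _) ?_)⟩
    refine Eq.trans ?_ hv
    exact congrArg (tder 𝓘(ℝ, EG) (starModel EG EM) (𝒢.legPlus L) g) (sub_add_cancel _ _)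

/-- Through this identity the derivatives of `Θ` occurring in `dΘ` become second derivatives of `L`.
-/
theorem pairing_legMinus (X : ∀ x, 𝒢.A x) (h : G) :
    𝒢.pairing X (𝒢.legMinus L h) = -𝒢.rightDeriv X L h := rfl

theorem pairing_legPlus (X : ∀ x, 𝒢.A x) (g : G) :
    𝒢.pairing X (𝒢.legPlus L g) = 𝒢.leftDeriv X L g := rfl

theorem tder_neg_rightDeriv (X : ∀ x, 𝒢.A x) (h : G) (v : EG) :
    tder 𝓘(ℝ, EG) 𝓘(ℝ, ℝ) (fun g => -𝒢.rightDeriv X L g) h v =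
      -tder 𝓘(ℝ, EG) 𝓘(ℝ, ℝ) (𝒢.rightDeriv X L) h v :=
  congrArg (fun D : EG →L[ℝ] ℝ => D v)
    (mfderiv_neg (f := 𝒢.rightDeriv X L) (x := h))

/-- Split the tangent vector of `G` under `Z.U` into its `V_h β` and `V_h α` parts. The first is the
value of the right-invariant field of `Z.X` and yields an iterated right derivative of `L`; the
second yields a mixed term `b`. The iterated right derivatives cancel against the bracket by
`rightDeriv_bracket`. -/
theorem dOne_liouville_legMinus (hL : ContMDiff 𝓘(ℝ, EG) 𝓘(ℝ, ℝ) ∞ L)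
    (hS : 𝒢.IsSmoothInverse (𝒢.legMinus L) S) {h : G} {b} (hb : 𝒢.IsMixedHessian L h b)
    {Z₀ Z₁ : 𝒢.ProjSection} {p₀ p₁ : 𝒢.PTau h}
    (h₀ : Z₀.val (𝒢.legMinus L h) = 𝒢.prolMinus hS.contMDiff h p₀)
    (h₁ : Z₁.val (𝒢.legMinus L h) = 𝒢.prolMinus hS.contMDiff h p₁) :
    𝒢.dOne 𝒢.liouville Z₀ Z₁ (𝒢.legMinus L h) = b p₀.1 p₁.2 - b p₁.1 p₀.2 := by
  have key : ∀ {Z Z' : 𝒢.ProjSection} {p p' : 𝒢.PTau h},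
      Z.val (𝒢.legMinus L h) = 𝒢.prolMinus hS.contMDiff h p →
      Z'.val (𝒢.legMinus L h) = 𝒢.prolMinus hS.contMDiff h p' →
      tder (starModel EG EM) 𝓘(ℝ, ℝ) (𝒢.pairing Z'.X) (𝒢.legMinus L h) (Z.U (𝒢.legMinus L h)) =
        -(𝒢.rightDeriv Z.X (𝒢.rightDeriv Z'.X L) h + b p'.1 p.2) := by
    intro Z Z' p p' hZ hZ'
    have e1 : Z.X (𝒢.src h) = 𝒢.phiAlpha h p.1 := congrArg (fun z => z.1.1) hZ
    have e1' : Z'.X (𝒢.src h) = 𝒢.phiAlpha h p'.1 := congrArg (fun z => z.1.1) hZ'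
    have e2 : Z.U (𝒢.legMinus L h) = tder 𝓘(ℝ, EG) (starModel EG EM) (𝒢.legMinus L) h
      (𝒢.anchorModel h p) := congrArg (fun z => z.1.2) hZ
    have hR := 𝒢.contMDiff_rightDeriv Z'.2.1 hL
    refine (congrArg _ e2).trans
      ((hS.tder_apply_tder hR.neg (𝒢.pairing_legMinus Z'.X) h _).trans ?_)
    rw [tder_neg_rightDeriv, anchorModel_apply, map_add, ← 𝒢.rightField_eq e1,
      hb.right Z'.X Z'.2.1 _ p.2 e1']
    rfl
  have hbr := 𝒢.rightDeriv_bracket Z₀.2.1 Z₁.2.1 hL h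
  have h3 := key h₀ h₁
  have h4 := key h₁ h₀
  have h5 : 𝒢.dOne 𝒢.liouville Z₀ Z₁ (𝒢.legMinus L h) =
      tder (starModel EG EM) 𝓘(ℝ, ℝ) (𝒢.pairing Z₁.X) (𝒢.legMinus L h) (Z₀.U (𝒢.legMinus L h)) -
      tder (starModel EG EM) 𝓘(ℝ, ℝ) (𝒢.pairing Z₀.X) (𝒢.legMinus L h) (Z₁.U (𝒢.legMinus L h)) -
      -𝒢.rightDeriv (𝒢.bracket Z₀.X Z₁.X) L h := rfl
  have hbr' : 𝒢.rightDeriv (𝒢.bracket Z₀.X Z₁.X) L h = 𝒢.rightDeriv Z₀.X (𝒢.rightDeriv Z₁.X L) h -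
    𝒢.rightDeriv Z₁.X (𝒢.rightDeriv Z₀.X L) h := hbr
  rw [h5, h3, h4, hbr']
  ring

/-- Here the `V_g α` part is the value of a left-invariant field and `leftDeriv_bracket` does the
cancelling. The mixed terms come with the opposite sign and with their arguments exchanged, compared
with `F⁻L`, which gives the same skew form. -/
theorem dOne_liouville_legPlus (hL : ContMDiff 𝓘(ℝ, EG) 𝓘(ℝ, ℝ) ∞ L)
    (hS : 𝒢.IsSmoothInverse (𝒢.legPlus L) S) {g : G} {b} (hb : 𝒢.IsMixedHessian L g b)
    {Z₀ Z₁ : 𝒢.ProjSection} {p₀ p₁ : 𝒢.PTau g}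
    (h₀ : Z₀.val (𝒢.legPlus L g) = 𝒢.prolPlus hS.contMDiff g p₀)
    (h₁ : Z₁.val (𝒢.legPlus L g) = 𝒢.prolPlus hS.contMDiff g p₁) :
    𝒢.dOne 𝒢.liouville Z₀ Z₁ (𝒢.legPlus L g) = b p₀.1 p₁.2 - b p₁.1 p₀.2 := by
  have key : ∀ {Z Z' : 𝒢.ProjSection} {p p' : 𝒢.PTau g},
      Z.val (𝒢.legPlus L g) = 𝒢.prolPlus hS.contMDiff g p →
      Z'.val (𝒢.legPlus L g) = 𝒢.prolPlus hS.contMDiff g p' →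
      tder (starModel EG EM) 𝓘(ℝ, ℝ) (𝒢.pairing Z'.X) (𝒢.legPlus L g) (Z.U (𝒢.legPlus L g)) =
        b p.1 p'.2 + 𝒢.leftDeriv Z.X (𝒢.leftDeriv Z'.X L) g := by
    intro Z Z' p p' hZ hZ'
    have e1 : Z.X (𝒢.tgt g) = 𝒢.phiBeta g p.2 := congrArg (fun z => z.1.1) hZ
    have e1' : Z'.X (𝒢.tgt g) = 𝒢.phiBeta g p'.2 := congrArg (fun z => z.1.1) hZ'
    have e2 : Z.U (𝒢.legPlus L g) = tder 𝓘(ℝ, EG) (starModel EG EM) (𝒢.legPlus L) g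
      (𝒢.anchorModel g p) := congrArg (fun z => z.1.2) hZ
    have hR := 𝒢.contMDiff_leftDeriv Z'.2.1 hL
    refine (congrArg _ e2).trans ((hS.tder_apply_tder hR (𝒢.pairing_legPlus Z'.X) g _).trans ?_)
    rw [anchorModel_apply, map_add, ← 𝒢.leftField_eq e1, hb.left Z'.X Z'.2.1 p.1 _ e1']
    rfl
  have hbr : 𝒢.leftDeriv (𝒢.bracket Z₀.X Z₁.X) L g = 𝒢.leftDeriv Z₀.X (𝒢.leftDeriv Z₁.X L) g -
    𝒢.leftDeriv Z₁.X (𝒢.leftDeriv Z₀.X L) g := 𝒢.leftDeriv_bracket Z₀.2.1 Z₁.2.1 hL g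
  have h3 := key h₀ h₁
  have h4 := key h₁ h₀
  have h5 : 𝒢.dOne 𝒢.liouville Z₀ Z₁ (𝒢.legPlus L g) =
      tder (starModel EG EM) 𝓘(ℝ, ℝ) (𝒢.pairing Z₁.X) (𝒢.legPlus L g) (Z₀.U (𝒢.legPlus L g)) -
      tder (starModel EG EM) 𝓘(ℝ, ℝ) (𝒢.pairing Z₀.X) (𝒢.legPlus L g) (Z₁.U (𝒢.legPlus L g)) -
      𝒢.leftDeriv (𝒢.bracket Z₀.X Z₁.X) L g := rfl
  rw [h5, h3, h4, hbr]
  ring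

theorem contMDiff_push {F : G → 𝒢.AStar} {S : 𝒢.AStar → G} (hS : 𝒢.IsSmoothInverse F S)
    {V : G → EG} (hV : ContMDiff 𝓘(ℝ, EG) 𝓘(ℝ, EG).tangent ∞
      (fun g => (⟨g, V g⟩ : TangentBundle 𝓘(ℝ, EG) G))) :
    𝒢.SmoothField fun μ => tder 𝓘(ℝ, EG) (starModel EG EM) F (S μ) (V (S μ)) := by
  have h1 := (hS.contMDiff.contMDiff_tangentMap (m := ∞) (by simp)).comp
    (hV.comp hS.contMDiff_inverse)
  exact h1.congr fun μ => totalSpace_tangent_ext (hS.right_inv μ).symm rfl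

/-- Every element of the prolongation is the value of a projectable section. -/
theorem exists_projSection [T2Space M] (hS : 𝒢.IsSmoothInverse (𝒢.legMinus L) S) {μ : 𝒢.AStar}
    (z : 𝒢.Prol μ) : ∃ Z : 𝒢.ProjSection, Z.val μ = z := by
  obtain ⟨h, rfl⟩ : ∃ h, 𝒢.legMinus L h = μ := ⟨S μ, hS.right_inv μ⟩
  obtain ⟨p, rfl⟩ := (𝒢.bijective_prolMinus hS h).2 z
  obtain ⟨X, hX, hXp⟩ := 𝒢.exists_smoothSection (𝒢.src h) (𝒢.phiAlpha h p.1)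
  obtain ⟨Y, hY, hYp⟩ := 𝒢.exists_smoothSection (𝒢.tgt h) (𝒢.phiBeta h p.2)
  let V : G → EG := fun g => 𝒢.rightField X g + 𝒢.leftField Y g
  have hV : ContMDiff 𝓘(ℝ, EG) 𝓘(ℝ, EG).tangent ∞
      (fun g => (⟨g, V g⟩ : TangentBundle 𝓘(ℝ, EG) G)) :=
    (𝒢.contMDiff_rightField hX).add_section (𝒢.contMDiff_leftField hY)
  have hVp : V h = 𝒢.anchorModel h p := by
    rw [anchorModel_apply, ← 𝒢.rightField_eq hXp, ← 𝒢.leftField_eq hYp]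
  have hsrc : ∀ g, tder 𝓘(ℝ, EG) 𝓘(ℝ, EM) 𝒢.src g (V g) = 𝒢.anchor (𝒢.src g) (X (𝒢.src g)) := by
    intro g
    have h1 := 𝒢.tder_src_leftModel g (Y (𝒢.tgt g))
    have h2 := 𝒢.tder_src_rightModel g (X (𝒢.src g))
    refine (map_add _ _ _).trans ?_
    exact (congrArg₂ (· + ·) h2 h1).trans (add_zero _)
  refine ⟨⟨(X, fun μ => tder 𝓘(ℝ, EG) (starModel EG EM) (𝒢.legMinus L) (S μ) (V (S μ))),
    hX, 𝒢.contMDiff_push hS hV, fun μ => ?_⟩, Subtype.ext (Prod.ext hXp ?_)⟩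
  · obtain ⟨g, rfl⟩ : ∃ g, 𝒢.legMinus L g = μ := ⟨S μ, hS.right_inv μ⟩
    refine (hsrc g).symm.trans ((𝒢.dProj_mfderiv (hS.mdifferentiableAt g) (V g)).symm.trans ?_)
    exact congrArg (fun g' => 𝒢.dProj (𝒢.legMinus L g)
      (tder 𝓘(ℝ, EG) (starModel EG EM) (𝒢.legMinus L) g' (V g'))) (hS.left_inv g).symm
  · refine (congrArg (fun g' => tder 𝓘(ℝ, EG) (starModel EG EM) (𝒢.legMinus L) g' (V g'))
      (hS.left_inv h)).trans ?_
    exact congrArg _ hVp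

/-- The skew form `(p, q) ↦ b (p₁, q₂) - b (q₁, p₂)` on `P^τ_g G`. -/
def skewForm {g : G} (b : 𝒢.vertTgt g →ₗ[ℝ] 𝒢.vertSrc g →ₗ[ℝ] ℝ) :
    𝒢.PTau g →ₗ[ℝ] 𝒢.PTau g →ₗ[ℝ] ℝ :=
  b.compl₁₂ (LinearMap.fst ℝ _ _) (LinearMap.snd ℝ _ _) -
    (b.compl₁₂ (LinearMap.fst ℝ _ _) (LinearMap.snd ℝ _ _)).flip

theorem skewForm_apply {g : G} (b : 𝒢.vertTgt g →ₗ[ℝ] 𝒢.vertSrc g →ₗ[ℝ] ℝ) (p q : 𝒢.PTau g) :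
    𝒢.skewForm b p q = b p.1 q.2 - b q.1 p.2 := rfl

/-- `dOne` involves derivatives of the sections, but by `dOne_liouville_legMinus` it depends on
their values at the point only, and bilinearly. This existence is what makes the choice in
`differential` meaningful. -/
theorem exists_isDifferential_liouville [T2Space M] (hL : ContMDiff 𝓘(ℝ, EG) 𝓘(ℝ, ℝ) ∞ L)
    (hS : 𝒢.IsSmoothInverse (𝒢.legMinus L) S) : ∃ η, 𝒢.IsDifferential 𝒢.liouville η := by
  have key : ∀ μ, ∃ B : 𝒢.Prol μ →ₗ[ℝ] 𝒢.Prol μ →ₗ[ℝ] ℝ, ∀ Z₀ Z₁ : 𝒢.ProjSection,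
      B (Z₀.val μ) (Z₁.val μ) = 𝒢.dOne 𝒢.liouville Z₀ Z₁ μ := by
    intro μ
    obtain ⟨h, rfl⟩ : ∃ h, 𝒢.legMinus L h = μ := ⟨S μ, hS.right_inv μ⟩
    obtain ⟨b, hb⟩ := 𝒢.exists_isMixedHessian hL h
    let e := LinearEquiv.ofBijective _ (𝒢.bijective_prolMinus hS h)
    refine ⟨(𝒢.skewForm b).compl₁₂ e.symm.toLinearMap e.symm.toLinearMap, fun Z₀ Z₁ => ?_⟩
    exact (𝒢.dOne_liouville_legMinus hL hS hb (e.apply_symm_apply (Z₀.val _)).symm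
      (e.apply_symm_apply (Z₁.val _)).symm).symm
  choose η hη using key
  exact ⟨η, fun Z₀ Z₁ μ => hη μ Z₀ Z₁⟩

theorem isDifferential_neg_Omega [T2Space M] (hL : ContMDiff 𝓘(ℝ, EG) 𝓘(ℝ, ℝ) ∞ L)
    (hS : 𝒢.IsSmoothInverse (𝒢.legMinus L) S) : 𝒢.IsDifferential 𝒢.liouville (-𝒢.Omega) := by
  have h := 𝒢.exists_isDifferential_liouville hL hS
  have h1 : -𝒢.Omega = 𝒢.differential 𝒢.liouville :=
    funext fun μ => neg_neg (𝒢.differential 𝒢.liouville μ)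
  rw [h1, differential, dif_pos h]
  exact h.choose_spec

theorem Omega_val [T2Space M] (hL : ContMDiff 𝓘(ℝ, EG) 𝓘(ℝ, ℝ) ∞ L)
    (hS : 𝒢.IsSmoothInverse (𝒢.legMinus L) S) (Z₀ Z₁ : 𝒢.ProjSection) (μ : 𝒢.AStar) :
    𝒢.Omega μ (Z₀.val μ) (Z₁.val μ) = -𝒢.dOne 𝒢.liouville Z₀ Z₁ μ := by
  rw [← 𝒢.isDifferential_neg_Omega hL hS Z₀ Z₁ μ]
  exact (neg_neg _).symm

theorem Omega_prolMinus [T2Space M] (hL : ContMDiff 𝓘(ℝ, EG) 𝓘(ℝ, ℝ) ∞ L)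
    (hS : 𝒢.IsSmoothInverse (𝒢.legMinus L) S) {h : G} {b} (hb : 𝒢.IsMixedHessian L h b)
    (p q : 𝒢.PTau h) :
    𝒢.Omega (𝒢.legMinus L h) (𝒢.prolMinus hS.contMDiff h p) (𝒢.prolMinus hS.contMDiff h q) =
      -𝒢.skewForm b p q := by
  obtain ⟨Z₀, h₀⟩ := 𝒢.exists_projSection hS (𝒢.prolMinus hS.contMDiff h p)
  obtain ⟨Z₁, h₁⟩ := 𝒢.exists_projSection hS (𝒢.prolMinus hS.contMDiff h q)
  have h2 := 𝒢.Omega_val hL hS Z₀ Z₁ (𝒢.legMinus L h)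
  rw [h₀, h₁] at h2
  exact h2.trans (congrArg Neg.neg (𝒢.dOne_liouville_legMinus hL hS hb h₀ h₁))

/-- The right side is the same as in `Omega_prolMinus`, with the same `b`: this coincidence is the
invariance of `Ω`. The hypothesis on `F⁻L` serves to know that `Ω` exists and that projectable
sections reach every element. -/
theorem Omega_prolPlus [T2Space M] (hL : ContMDiff 𝓘(ℝ, EG) 𝓘(ℝ, ℝ) ∞ L)
    (hS : 𝒢.IsSmoothInverse (𝒢.legMinus L) S) (hS' : 𝒢.IsSmoothInverse (𝒢.legPlus L) S')
    {g : G} {b} (hb : 𝒢.IsMixedHessian L g b) (p q : 𝒢.PTau g) :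
    𝒢.Omega (𝒢.legPlus L g) (𝒢.prolPlus hS'.contMDiff g p) (𝒢.prolPlus hS'.contMDiff g q) =
      -𝒢.skewForm b p q := by
  obtain ⟨Z₀, h₀⟩ := 𝒢.exists_projSection hS (𝒢.prolPlus hS'.contMDiff g p)
  obtain ⟨Z₁, h₁⟩ := 𝒢.exists_projSection hS (𝒢.prolPlus hS'.contMDiff g q)
  have h2 := 𝒢.Omega_val hL hS Z₀ Z₁ (𝒢.legPlus L g)
  rw [h₀, h₁] at h2
  exact h2.trans (congrArg Neg.neg (𝒢.dOne_liouville_legPlus hL hS' hb h₀ h₁))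

theorem tder_proj {F : G → 𝒢.AStar} {S : 𝒢.AStar → G} (hS : 𝒢.IsSmoothInverse F S) (g : G)
    (v : EG) :
    tder (starModel EG EM) 𝓘(ℝ, EM) (fun ν : 𝒢.AStar => ν.proj) (F g)
      (tder 𝓘(ℝ, EG) (starModel EG EM) F g v) = tder 𝓘(ℝ, EG) 𝓘(ℝ, EM) (fun h => (F h).proj) g v :=
  𝒢.dProj_mfderiv (hS.mdifferentiableAt g) v

/-- The image of `n` under `T F⁻L` projects to zero in `M`, as `n` is `α`-vertical, and its
derivatives of the functions `ν ↦ ν(X)` are the numbers `-b(m, n)`. So it vanishes, and `F⁻L` is an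
immersion. -/
theorem IsMixedHessian.separatingRight [T2Space M] {𝒢 : LieGroupoid EG EM G M} {L : G → ℝ}
    {S : 𝒢.AStar → G} (hL : ContMDiff 𝓘(ℝ, EG) 𝓘(ℝ, ℝ) ∞ L)
    (hS : 𝒢.IsSmoothInverse (𝒢.legMinus L) S) {h : G} {b} (hb : 𝒢.IsMixedHessian L h b)
    {n : 𝒢.vertSrc h} (hn : ∀ m, b m n = 0) : n = 0 := by
  have h1 : tder 𝓘(ℝ, EG) (starModel EG EM) (𝒢.legMinus L) h (𝒢.vertSrcModel h n) = 0 := by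
    refine 𝒢.eq_zero_of_tder_pairing (μ := 𝒢.legMinus L h) ((𝒢.tder_proj hS h _).trans n.2)
      fun X hX => ?_
    rw [hS.tder_apply_tder (𝒢.contMDiff_rightDeriv hX hL).neg (𝒢.pairing_legMinus X),
      tder_neg_rightDeriv, ← hb.right X hX (𝒢.rightTrans h (X (𝒢.src h))) n
      (𝒢.phiAlpha_rightTrans h _).symm, hn, neg_zero]
  have h2 := hS.tder_inverse_apply h (𝒢.vertSrcModel h n)
  rw [h1, map_zero] at h2
  exact 𝒢.vertSrcModel_injective h (h2.symm.trans (map_zero _).symm)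

/-- The mirror argument: `m` is `β`-vertical and `F⁺L` covers `β`. -/
theorem IsMixedHessian.separatingLeft [T2Space M] {𝒢 : LieGroupoid EG EM G M} {L : G → ℝ}
    {S : 𝒢.AStar → G} (hL : ContMDiff 𝓘(ℝ, EG) 𝓘(ℝ, ℝ) ∞ L)
    (hS : 𝒢.IsSmoothInverse (𝒢.legPlus L) S) {g : G} {b} (hb : 𝒢.IsMixedHessian L g b)
    {m : 𝒢.vertTgt g} (hm : ∀ n, b m n = 0) : m = 0 := by
  have h1 : tder 𝓘(ℝ, EG) (starModel EG EM) (𝒢.legPlus L) g (𝒢.vertTgtModel g m) = 0 := by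
    refine 𝒢.eq_zero_of_tder_pairing (μ := 𝒢.legPlus L g) ((𝒢.tder_proj hS g _).trans m.2)
      fun X hX => ?_
    rw [hS.tder_apply_tder (𝒢.contMDiff_leftDeriv hX hL) (𝒢.pairing_legPlus X),
      ← hb.left X hX m (𝒢.leftTrans g (X (𝒢.tgt g))) (𝒢.phiBeta_leftTrans g _).symm, hm]
  have h2 := hS.tder_inverse_apply g (𝒢.vertTgtModel g m)
  rw [h1, map_zero] at h2
  exact 𝒢.vertTgtModel_injective g (h2.symm.trans (map_zero _).symm)

theorem Omega_nondegenerate [T2Space M] (hL : ContMDiff 𝓘(ℝ, EG) 𝓘(ℝ, ℝ) ∞ L)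
    (hS : 𝒢.IsSmoothInverse (𝒢.legMinus L) S) (hS' : 𝒢.IsSmoothInverse (𝒢.legPlus L) S')
    {μ : 𝒢.AStar} {z : 𝒢.Prol μ} (hz : ∀ w, 𝒢.Omega μ z w = 0) : z = 0 := by
  obtain ⟨h, rfl⟩ : ∃ h, 𝒢.legMinus L h = μ := ⟨S μ, hS.right_inv μ⟩
  obtain ⟨p, rfl⟩ := (𝒢.bijective_prolMinus hS h).2 z
  obtain ⟨b, hb⟩ := 𝒢.exists_isMixedHessian hL h
  have h1 : ∀ q : 𝒢.PTau h, b p.1 q.2 - b q.1 p.2 = 0 := fun q => by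
    have h2 := hz (𝒢.prolMinus hS.contMDiff h q)
    rwa [𝒢.Omega_prolMinus hL hS hb, skewForm_apply, neg_eq_zero] at h2
  -- Testing against `(0, n)` and `(m, 0)` isolates the two halves of the skew form.
  have h3 : p.1 = 0 := hb.separatingLeft hL hS' fun n => by simpa using h1 (0, n)
  have h4 : p.2 = 0 := hb.separatingRight hL hS fun m => by simpa using h1 (m, 0)
  have h5 : p = 0 := Prod.ext h3 h4
  rw [h5, map_zero]

theorem finiteDimensional_prol (hS : 𝒢.IsSmoothInverse (𝒢.legMinus L) S) (μ : 𝒢.AStar) :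
    FiniteDimensional ℝ (𝒢.Prol μ) := by
  obtain ⟨h, rfl⟩ : ∃ h, 𝒢.legMinus L h = μ := ⟨S μ, hS.right_inv μ⟩
  exact Module.Finite.of_surjective _ (𝒢.bijective_prolMinus hS h).2

/-- The differential of a function, as a linear form. -/
def dFunLinear (f : 𝒢.AStar → ℝ) (μ : 𝒢.AStar) : 𝒢.Prol μ →ₗ[ℝ] ℝ :=
  (show TangentSpace (starModel EG EM) μ →L[ℝ] ℝ from
    mfderiv (starModel EG EM) 𝓘(ℝ, ℝ) f μ).toLinearMap ∘ₗ
      LinearMap.snd ℝ (𝒢.A μ.proj) (TangentSpace (starModel EG EM) μ) ∘ₗ (𝒢.Prol μ).subtype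

/-- On a finite-dimensional fibre the injective map `z ↦ Ω(z, ·)` is onto the dual, so the default
value in `hamSection` is never taken. -/
theorem Omega_hamSection [T2Space M] (hL : ContMDiff 𝓘(ℝ, EG) 𝓘(ℝ, ℝ) ∞ L)
    (hS : 𝒢.IsSmoothInverse (𝒢.legMinus L) S) (hS' : 𝒢.IsSmoothInverse (𝒢.legPlus L) S')
    (f : 𝒢.AStar → ℝ) (μ : 𝒢.AStar) (w : 𝒢.Prol μ) :
    𝒢.Omega μ (𝒢.hamSection f μ) w = 𝒢.dFun f μ w := by
  have := 𝒢.finiteDimensional_prol hS μ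
  have hinj : Injective (𝒢.Omega μ) := (injective_iff_map_eq_zero _).2 fun z hz =>
    𝒢.Omega_nondegenerate hL hS hS' fun w => by rw [hz]; rfl
  obtain ⟨z, hz⟩ := (LinearMap.injective_iff_surjective_of_finrank_eq_finrank
    (Subspace.dual_finrank_eq (K := ℝ) (V := 𝒢.Prol μ)).symm).1 hinj (𝒢.dFunLinear f μ)
  have h : ∃ z, ∀ w, 𝒢.Omega μ z w = 𝒢.dFun f μ w := ⟨z, fun w => by rw [hz]; rfl⟩
  rw [hamSection, dif_pos h]
  exact h.choose_spec w

end Legendre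

/-- Needed because `μ` and `F⁻L((F⁻L)⁻¹ μ)` are equal but not definitionally so. -/
theorem liouville_congr {μ ν : 𝒢.AStar} (h : μ = ν) {z : 𝒢.Prol μ} {z' : 𝒢.Prol ν}
    (hz : 𝒢.transport h z = z') : 𝒢.liouville μ z = 𝒢.liouville ν z' := by
  subst h hz; rfl

theorem dFun_congr {μ ν : 𝒢.AStar} (h : μ = ν) (f : 𝒢.AStar → ℝ) {z : 𝒢.Prol μ} {z' : 𝒢.Prol ν}
    (hz : 𝒢.transport h z = z') : 𝒢.dFun f μ z = 𝒢.dFun f ν z' := by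
  subst h hz; rfl

theorem Omega_congr {μ ν : 𝒢.AStar} (h : μ = ν) {z w : 𝒢.Prol μ} {z' w' : 𝒢.Prol ν}
    (hz : 𝒢.transport h z = z') (hw : 𝒢.transport h w = w') :
    𝒢.Omega μ z w = 𝒢.Omega ν z' w' := by
  subst h hz hw; rfl

theorem transport_surjective {μ ν : 𝒢.AStar} (h : μ = ν) : Surjective (𝒢.transport h) := by
  subst h; exact fun z => ⟨z, rfl⟩

theorem dFun_prolMinus {L : G → ℝ} {S : 𝒢.AStar → G} (hS : 𝒢.IsSmoothInverse (𝒢.legMinus L) S)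
    {k : 𝒢.AStar → ℝ} {f : G → ℝ} (hf : ContMDiff 𝓘(ℝ, EG) 𝓘(ℝ, ℝ) ∞ f)
    (hk : ∀ g, k (𝒢.legMinus L g) = f g) (g : G) (p : 𝒢.PTau g) :
    𝒢.dFun k (𝒢.legMinus L g) (𝒢.prolMinus hS.contMDiff g p) =
      tder 𝓘(ℝ, EG) 𝓘(ℝ, ℝ) f g (𝒢.anchorModel g p) :=
  hS.tder_apply_tder hf hk g _

theorem dFun_prolPlus {L : G → ℝ} {S : 𝒢.AStar → G} (hS : 𝒢.IsSmoothInverse (𝒢.legPlus L) S)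
    {k : 𝒢.AStar → ℝ} {f : G → ℝ} (hf : ContMDiff 𝓘(ℝ, EG) 𝓘(ℝ, ℝ) ∞ f)
    (hk : ∀ g, k (𝒢.legPlus L g) = f g) (g : G) (p : 𝒢.PTau g) :
    𝒢.dFun k (𝒢.legPlus L g) (𝒢.prolPlus hS.contMDiff g p) =
      tder 𝓘(ℝ, EG) 𝓘(ℝ, ℝ) f g (𝒢.anchorModel g p) :=
  hS.tder_apply_tder hf hk g _

/-- The translation in `phiAlpha` and the one in `F⁻L` are inverse to each other. -/
theorem liouville_prolMinus {L : G → ℝ} (hF : ContMDiff 𝓘(ℝ, EG) (starModel EG EM) ∞ (𝒢.legMinus L))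
    (g : G) (p : 𝒢.PTau g) :
    𝒢.liouville (𝒢.legMinus L g) (𝒢.prolMinus hF g p) =
      -tder 𝓘(ℝ, EG) 𝓘(ℝ, ℝ) L g (𝒢.vertTgtModel g p.1) :=
  congrArg (fun m => -tder 𝓘(ℝ, EG) 𝓘(ℝ, ℝ) L g (𝒢.vertTgtModel g m)) (𝒢.rightTrans_phiAlpha g p.1)

theorem liouville_prolPlus {L : G → ℝ} (hF : ContMDiff 𝓘(ℝ, EG) (starModel EG EM) ∞ (𝒢.legPlus L))
    (g : G) (p : 𝒢.PTau g) :
    𝒢.liouville (𝒢.legPlus L g) (𝒢.prolPlus hF g p) =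
      tder 𝓘(ℝ, EG) 𝓘(ℝ, ℝ) L g (𝒢.vertSrcModel g p.2) :=
  congrArg (fun n => tder 𝓘(ℝ, EG) 𝓘(ℝ, ℝ) L g (𝒢.vertSrcModel g n)) (𝒢.leftTrans_phiBeta g p.2)

/-! ### The discrete evolution operator -/

section Evolution

variable {L : G → ℝ} {Φ Ψ : G ≃ₘ⟮𝓘(ℝ, EG), starModel EG EM⟯ 𝒢.AStar}

theorem isSmoothInverse_legMinus (hΦ : ∀ g, Φ g = 𝒢.legMinus L g) :
    𝒢.IsSmoothInverse (𝒢.legMinus L) Φ.symm where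
  contMDiff := funext hΦ ▸ Φ.contMDiff
  contMDiff_inverse := Φ.symm.contMDiff
  left_inv g := by rw [← hΦ, Φ.symm_apply_apply]
  right_inv μ := by rw [← hΦ, Φ.apply_symm_apply]

theorem isSmoothInverse_legPlus (hΨ : ∀ g, Ψ g = 𝒢.legPlus L g) :
    𝒢.IsSmoothInverse (𝒢.legPlus L) Ψ.symm where
  contMDiff := funext hΨ ▸ Ψ.contMDiff
  contMDiff_inverse := Ψ.symm.contMDiff
  left_inv g := by rw [← hΨ, Ψ.symm_apply_apply]
  right_inv μ := by rw [← hΨ, Ψ.apply_symm_apply]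

theorem legMinus_symm (hΦ : ∀ g, Φ g = 𝒢.legMinus L g) (μ : 𝒢.AStar) :
    μ = 𝒢.legMinus L (Φ.symm μ) :=
  (Φ.apply_symm_apply μ).symm.trans (hΦ (Φ.symm μ))

variable (hΦ : ∀ g, Φ g = 𝒢.legMinus L g) (hΨ : ∀ g, Ψ g = 𝒢.legPlus L g)

/-- A single `p` in `V_gβ ⊕ V_gα` represents `z` through `F⁻L` and its image through `F⁺L`; `invFun`
gives a true preimage by surjectivity of the first map. Every comparison below is made at this `p`.
-/
theorem exists_prolHamEvol_eq (μ : 𝒢.AStar) (z : 𝒢.Prol μ) :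
    ∃ p : 𝒢.PTau (Φ.symm μ), 𝒢.transport (𝒢.legMinus_symm hΦ μ) z =
        𝒢.prolMinus (𝒢.isSmoothInverse_legMinus hΦ).contMDiff (Φ.symm μ) p ∧
      𝒢.prolHamEvol hΦ hΨ μ z =
        𝒢.prolPlus (𝒢.isSmoothInverse_legPlus hΨ).contMDiff (Φ.symm μ) p :=
  ⟨_, (invFun_eq ((𝒢.bijective_prolMinus (𝒢.isSmoothInverse_legMinus hΦ) (Φ.symm μ)).2
    (𝒢.transport (𝒢.legMinus_symm hΦ μ) z))).symm, rfl⟩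

theorem prolHamEvol_surjective (μ : 𝒢.AStar) : Surjective (𝒢.prolHamEvol hΦ hΨ μ) :=
  (𝒢.bijective_prolPlus (𝒢.isSmoothInverse_legPlus hΨ) (Φ.symm μ)).2.comp
    ((invFun_surjective (𝒢.bijective_prolMinus (𝒢.isSmoothInverse_legMinus hΦ) (Φ.symm μ)).1).comp
      (𝒢.transport_surjective (𝒢.legMinus_symm hΦ μ)))

/-- At `p = (X, Y)` this reads `dL(Y) = -dL(X) + dL(X + Y)`. -/
theorem liouville_prolHamEvol (hL : ContMDiff 𝓘(ℝ, EG) 𝓘(ℝ, ℝ) ∞ L) (μ : 𝒢.AStar)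
    (z : 𝒢.Prol μ) :
    𝒢.liouville (𝒢.hamEvol L Φ μ) (𝒢.prolHamEvol hΦ hΨ μ z) =
      𝒢.liouville μ z + 𝒢.dFun (fun ν => L (Φ.symm ν)) μ z := by
  have hS := 𝒢.isSmoothInverse_legMinus hΦ
  obtain ⟨p, hp, hp'⟩ := 𝒢.exists_prolHamEvol_eq hΦ hΨ μ z
  have h1 : 𝒢.dFun (fun ν => L (Φ.symm ν)) μ z =
      tder 𝓘(ℝ, EG) 𝓘(ℝ, ℝ) L (Φ.symm μ) (𝒢.anchorModel (Φ.symm μ) p) :=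
    (𝒢.dFun_congr (𝒢.legMinus_symm hΦ μ) _ hp).trans
      (𝒢.dFun_prolMinus hS hL (fun g => congrArg L (hS.left_inv g)) (Φ.symm μ) p)
  have h2 : 𝒢.liouville μ z =
      -tder 𝓘(ℝ, EG) 𝓘(ℝ, ℝ) L (Φ.symm μ) (𝒢.vertTgtModel (Φ.symm μ) p.1) :=
    (𝒢.liouville_congr (𝒢.legMinus_symm hΦ μ) hp).trans
      (𝒢.liouville_prolMinus hS.contMDiff (Φ.symm μ) p)
  rw [h1, h2, anchorModel_apply, map_add, neg_add_cancel_left, hp']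
  exact 𝒢.liouville_prolPlus _ (Φ.symm μ) p

theorem Omega_prolHamEvol [T2Space M] (hL : ContMDiff 𝓘(ℝ, EG) 𝓘(ℝ, ℝ) ∞ L) (μ : 𝒢.AStar)
    (z w : 𝒢.Prol μ) :
    𝒢.Omega (𝒢.hamEvol L Φ μ) (𝒢.prolHamEvol hΦ hΨ μ z) (𝒢.prolHamEvol hΦ hΨ μ w) =
      𝒢.Omega μ z w := by
  have hS := 𝒢.isSmoothInverse_legMinus hΦ
  have hS' := 𝒢.isSmoothInverse_legPlus hΨ
  obtain ⟨b, hb⟩ := 𝒢.exists_isMixedHessian hL (Φ.symm μ)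
  obtain ⟨p, hp, hp'⟩ := 𝒢.exists_prolHamEvol_eq hΦ hΨ μ z
  obtain ⟨q, hq, hq'⟩ := 𝒢.exists_prolHamEvol_eq hΦ hΨ μ w
  have h1 := (𝒢.Omega_congr (𝒢.legMinus_symm hΦ μ) hp hq).trans (𝒢.Omega_prolMinus hL hS hb p q)
  have h2 := 𝒢.Omega_prolPlus hL hS hS' hb p q
  exact (congrArg₂ (fun a c => 𝒢.Omega (𝒢.hamEvol L Φ μ) a c) hp' hq').trans (h2.trans h1.symm)

/-- Both sides are the derivative of `f ∘ F⁺L` on `G` along `X + Y`. -/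
theorem dFun_prolHamEvol {f : 𝒢.AStar → ℝ} (hf : ContMDiff (starModel EG EM) 𝓘(ℝ, ℝ) ∞ f)
    (μ : 𝒢.AStar) (z : 𝒢.Prol μ) :
    𝒢.dFun f (𝒢.hamEvol L Φ μ) (𝒢.prolHamEvol hΦ hΨ μ z) =
      𝒢.dFun (fun ν => f (𝒢.hamEvol L Φ ν)) μ z := by
  have hS := 𝒢.isSmoothInverse_legMinus hΦ
  have hS' := 𝒢.isSmoothInverse_legPlus hΨ
  have hfF : ContMDiff 𝓘(ℝ, EG) 𝓘(ℝ, ℝ) ∞ (fun g => f (𝒢.legPlus L g)) := hf.comp hS'.contMDiff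
  obtain ⟨p, hp, hp'⟩ := 𝒢.exists_prolHamEvol_eq hΦ hΨ μ z
  have h1 : 𝒢.dFun (fun ν => f (𝒢.hamEvol L Φ ν)) μ z =
      tder 𝓘(ℝ, EG) 𝓘(ℝ, ℝ) (fun g => f (𝒢.legPlus L g)) (Φ.symm μ) (𝒢.anchorModel (Φ.symm μ) p) :=
    (𝒢.dFun_congr (𝒢.legMinus_symm hΦ μ) _ hp).trans
      (𝒢.dFun_prolMinus hS hfF (fun g => congrArg (fun g => f (𝒢.legPlus L g)) (hS.left_inv g))
        (Φ.symm μ) p)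
  rw [hp', h1]
  exact 𝒢.dFun_prolPlus hS' hfF (fun _ => rfl) (Φ.symm μ) p

/-- Against the image of any `w`, both sides pair under `Ω` to the differential of `f` on that
image. Such images exhaust the fibre, so nondegeneracy forces equality. -/
theorem prolHamEvol_hamSection [T2Space M] (hL : ContMDiff 𝓘(ℝ, EG) 𝓘(ℝ, ℝ) ∞ L)
    {f : 𝒢.AStar → ℝ} (hf : ContMDiff (starModel EG EM) 𝓘(ℝ, ℝ) ∞ f) (μ : 𝒢.AStar) :
    𝒢.prolHamEvol hΦ hΨ μ (𝒢.hamSection (fun ν => f (𝒢.hamEvol L Φ ν)) μ) =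
      𝒢.hamSection f (𝒢.hamEvol L Φ μ) := by
  have hS := 𝒢.isSmoothInverse_legMinus hΦ
  have hS' := 𝒢.isSmoothInverse_legPlus hΨ
  refine sub_eq_zero.1 (𝒢.Omega_nondegenerate hL hS hS' fun w' => ?_)
  obtain ⟨w, rfl⟩ := 𝒢.prolHamEvol_surjective hΦ hΨ μ w'
  rw [map_sub, LinearMap.sub_apply, 𝒢.Omega_prolHamEvol hΦ hΨ hL, 𝒢.Omega_hamSection hL hS hS',
    𝒢.Omega_hamSection hL hS hS', 𝒢.dFun_prolHamEvol hΦ hΨ hf, sub_self]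

end Evolution

end LieGroupoid

end

theorem mainTheorem8 {EG : Type u} {EM : Type v} {G : Type w} {M : Type t}
    [NormedAddCommGroup EG] [NormedSpace ℝ EG] [FiniteDimensional ℝ EG]
    [NormedAddCommGroup EM] [NormedSpace ℝ EM] [FiniteDimensional ℝ EM]
    [TopologicalSpace G] [T2Space G] [SecondCountableTopology G]
    [ChartedSpace EG G] [IsManifold 𝓘(ℝ, EG) ∞ G]
    [TopologicalSpace M] [T2Space M] [SecondCountableTopology M]
    [ChartedSpace EM M] [IsManifold 𝓘(ℝ, EM) ∞ M]
    (𝒢 : LieGroupoid EG EM G M) (L : G → ℝ) (_hL : ContMDiff 𝓘(ℝ, EG) 𝓘(ℝ, ℝ) ∞ L)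
    (Φ Ψ : G ≃ₘ⟮𝓘(ℝ, EG), LieGroupoid.starModel EG EM⟯ 𝒢.AStar)
    (hΦ : ∀ g, Φ g = 𝒢.legMinus L g) (hΨ : ∀ g, Ψ g = 𝒢.legPlus L g) :
    -- the two-section `Ω` is indeed `- dΘ`, and it is nondegenerate
    𝒢.IsDifferential 𝒢.liouville (-𝒢.Omega) ∧
    (∀ (μ : 𝒢.AStar) (z : 𝒢.Prol μ), (∀ w, 𝒢.Omega μ z w = 0) → z = 0) ∧
    -- the prolongation of `F⁻L` is invertible
    (∀ h : G, Bijective (𝒢.prolMinus (funext hΦ ▸ Φ.contMDiff) h)) ∧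
    -- the pull-back of `Θ`
    (∀ (μ : 𝒢.AStar) (z : 𝒢.Prol μ),
      𝒢.liouville (𝒢.hamEvol L Φ μ) (𝒢.prolHamEvol hΦ hΨ μ z) =
        𝒢.liouville μ z + 𝒢.dFun (fun ν => L (Φ.symm ν)) μ z) ∧
    -- the pull-back of `Ω`
    (∀ (μ : 𝒢.AStar) (z w : 𝒢.Prol μ),
      𝒢.Omega (𝒢.hamEvol L Φ μ) (𝒢.prolHamEvol hΦ hΨ μ z) (𝒢.prolHamEvol hΦ hΨ μ w) =
        𝒢.Omega μ z w) ∧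
    -- the evolution operator is a Poisson morphism
    (∀ f g : 𝒢.AStar → ℝ,
      ContMDiff (LieGroupoid.starModel EG EM) 𝓘(ℝ, ℝ) ∞ f →
      ContMDiff (LieGroupoid.starModel EG EM) 𝓘(ℝ, ℝ) ∞ g →
      ∀ μ : 𝒢.AStar,
        𝒢.poissonBracket (fun ν => f (𝒢.hamEvol L Φ ν)) (fun ν => g (𝒢.hamEvol L Φ ν)) μ =
          𝒢.poissonBracket f g (𝒢.hamEvol L Φ μ)) := by
  refine ⟨?_, ?_, ?_, ?_, ?_, ?_⟩
  · exact 𝒢.isDifferential_neg_Omega _hL (𝒢.isSmoothInverse_legMinus hΦ)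
  · exact fun μ z => 𝒢.Omega_nondegenerate _hL (𝒢.isSmoothInverse_legMinus hΦ)
      (𝒢.isSmoothInverse_legPlus hΨ)
  · exact 𝒢.bijective_prolMinus (𝒢.isSmoothInverse_legMinus hΦ)
  · exact 𝒢.liouville_prolHamEvol hΦ hΨ _hL
  · exact 𝒢.Omega_prolHamEvol hΦ hΨ _hL
  · intro f g hf hg μ
    rw [LieGroupoid.poissonBracket, LieGroupoid.poissonBracket,
      ← 𝒢.prolHamEvol_hamSection hΦ hΨ _hL hf, ← 𝒢.prolHamEvol_hamSection hΦ hΨ _hL hg,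
      𝒢.Omega_prolHamEvol hΦ hΨ _hL]
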